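/- Let $K$ be a field, $A$ a (not necessarily unital) associative $K$-algebra with non-degenerate product, $M(A)$ its multiplier algebra, and $(A,\Delta)$ a regular multiplier Hopf algebra with counit $\varepsilon$: $\Delta:A\to M(A\otimes A)$ is a coassociative homomorphism such that $a\otimes b\mapsto\Delta(a)(1\otimes b)$ and $a\otimes b\mapsto(a\otimes 1)\Delta(b)$ are bijections of $A\otimes A$, and $(A,\Delta^{cop})$ with $\Delta^{cop}=\tau\circ\Delta$, $\tau$ the flip, has the same properties. Homomorphisms such as $\Delta\otimes\iota$, $\iota\otimes\Delta$, $\varepsilon\otimes\iota$, $\iota\otimes\varepsilon$ are extended to $M(A\otimes A)$. A generalized $R$-matrix for $(A,\Delta)$ is an invertible $\mathcal R\in M(A\otimes A)$ with $(\Delta\otimes\iota)(\mathcal R)=\mathcal R^{13}\mathcal R^{23}$, $(\iota\otimes\Delta)(\mathcal R)=\mathcal R^{13}\mathcal R^{12}$, $\mathcal R\,\Delta(a)=\Delta^{cop}(a)\,\mathcal R$ for all $a\in A$, and $(\iota\otimes\varepsilon)(\mathcal R)=1=(\varepsilon\otimes\iota)(\mathcal R)$; a regular multiplier Hopf algebra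 with such an $\mathcal R$ is called quasitriangular. Let $J\in M(A\otimes A)$ be a normalized twist, that is, an invertible element with $(\Delta\otimes\iota)(J)(J\otimes 1)=(\iota\otimes\Delta)(J)(1\otimes J)$ and $(\varepsilon\otimes\iota)(J)=1=(\iota\otimes\varepsilon)(J)$, and suppose that $J(1\otimes a),(1\otimes a)J\in M(A)\otimes A$ and $J(a\otimes 1),(a\otimes 1)J\in A\otimes M(A)$ for all $a\in A$. Let $A^J$ be the algebra $A$ with $\Delta^J(a)=J^{-1}\Delta(a)J$. **Theorem 2.6.** If $(A,\Delta)$ is quasitriangular with generalized $R$-matrix $\mathcal R$, then $(A^J,\Delta^J)$ is a quasitriangular (in particular regular) multiplier Hopf algebra, and $\mathcal R^J=J_{21}^{-1}\,\mathcal R\,J$, where $J_{21}=\tau(J)$, is a generalized $R$-matrix for it. -/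

import Mathlib

open scoped TensorProduct

noncomputable section

namespace MultiplierHopf

universe u v w

section Multipliers

variable (K : Type u) [Field K]
variable (A : Type v) [NonUnitalRing A] [Module K A] [SMulCommClass K A A] [IsScalarTower K A A]
variable (B : Type w) [NonUnitalRing B] [Module K B] [SMulCommClass K B B] [IsScalarTower K B B]

/-- The product of `A` is non-degenerate. -/
def NondegenerateMul (A : Type v) [NonUnitalRing A] : Prop :=
  (∀ a : A, (∀ b : A, a * b = 0) → a = 0) ∧ (∀ a : A, (∀ b : A, b * a = 0) → a = 0)

/-- Double centralizers of `A`: pairs `(L, R)` of linear maps (left and right multiplication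
by the multiplier) with `R(a) b = a L(b)`. The second factor is opposite because right
multiplications compose in the reverse order. -/
def multiplierSubalgebra :
    Subalgebra K (Module.End K A × (Module.End K A)ᵐᵒᵖ) where
  carrier := {p | ∀ a b : A, p.2.unop a * b = a * p.1 b}
  mul_mem' := by
    intro p q hp hq a b
    simp only [Set.mem_ofPred_eq] at hp hq
    simp [hp, hq]
  add_mem' := by
    intro p q hp hq a b
    simp only [Set.mem_ofPred_eq] at hp hq
    simp [add_mul, mul_add, hp, hq]
  algebraMap_mem' := by
    intro r a b
    simp [Algebra.algebraMap_eq_smul_one, smul_mul_assoc, mul_smul_comm]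

/-- The multiplier algebra `M(A)`, a unital `K`-algebra. -/
abbrev Multiplier : Type v := multiplierSubalgebra K A

variable {K A B}

/-- `m.left a` is the product `m a`. -/
def Multiplier.left (m : Multiplier K A) : A →ₗ[K] A := m.1.1

/-- `m.right a` is the product `a m`. -/
def Multiplier.right (m : Multiplier K A) : A →ₗ[K] A := m.1.2.unop

theorem Multiplier.central (m : Multiplier K A) (a b : A) : m.right a * b = a * m.left b :=
  m.2 a b

/-- The multiplier with given left and right multiplication. -/
def Multiplier.mk (L R : A →ₗ[K] A) (h : ∀ a b, R a * b = a * L b) : Multiplier K A :=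
  ⟨(L, MulOpposite.op R), h⟩

theorem Multiplier.ext' {m n : Multiplier K A} (h₁ : ∀ a, m.left a = n.left a)
    (h₂ : ∀ a, m.right a = n.right a) : m = n :=
  Subtype.ext (Prod.ext (LinearMap.ext h₁) (MulOpposite.unop_injective (LinearMap.ext h₂)))

variable (K A) in
/-- The canonical homomorphism `A → M(A)` (injective when `A` is non-degenerate). -/
def incl : A →ₙₐ[K] Multiplier K A where
  toFun a := Multiplier.mk (LinearMap.mulLeft K a) (LinearMap.mulRight K a)
    (fun x y => by simp [mul_assoc])
  map_smul' r a := Multiplier.ext' (fun x => smul_mul_assoc r a x) (fun x => mul_smul_comm r x a)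
  map_zero' := Multiplier.ext' (fun x => zero_mul x) (fun x => mul_zero x)
  map_add' a b := Multiplier.ext' (fun x => add_mul a b x) (fun x => mul_add x a b)
  map_mul' a b := Multiplier.ext' (fun x => mul_assoc a b x) (fun x => (mul_assoc x a b).symm)

theorem map_central (m : Multiplier K A) (n : Multiplier K B) (x y : A ⊗[K] B) :
    TensorProduct.map m.right n.right x * y = x * TensorProduct.map m.left n.left y := by
  induction x using TensorProduct.induction_on with
  | zero => simp
  | add x₁ x₂ h₁ h₂ => simp only [map_add, add_mul, h₁, h₂]
  | tmul a b =>
    induction y using TensorProduct.induction_on with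
    | zero => simp
    | add y₁ y₂ h₁ h₂ => simp only [map_add, mul_add, h₁, h₂]
    | tmul c d =>
      simp [Algebra.TensorProduct.tmul_mul_tmul, Multiplier.central]

variable (K A B) in
/-- The canonical linear map `M(A) ⊗ M(B) → M(A ⊗ B)`, as a bilinear map. -/
def tensorMul : Multiplier K A →ₗ[K] Multiplier K B →ₗ[K] Multiplier K (A ⊗[K] B) :=
  LinearMap.mk₂ K
    (fun m n => Multiplier.mk (TensorProduct.map m.left n.left)
      (TensorProduct.map m.right n.right) (map_central m n))
    (fun m m' n => Multiplier.ext'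
      (fun x => LinearMap.congr_fun (TensorProduct.map_add_left m.left m'.left n.left) x)
      (fun x => LinearMap.congr_fun (TensorProduct.map_add_left m.right m'.right n.right) x))
    (fun r m n => Multiplier.ext'
      (fun x => LinearMap.congr_fun (TensorProduct.map_smul_left r m.left n.left) x)
      (fun x => LinearMap.congr_fun (TensorProduct.map_smul_left r m.right n.right) x))
    (fun m n n' => Multiplier.ext'
      (fun x => LinearMap.congr_fun (TensorProduct.map_add_right m.left n.left n'.left) x)
      (fun x => LinearMap.congr_fun (TensorProduct.map_add_right m.right n.right n'.right) x))
    (fun r m n => Multiplier.ext'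
      (fun x => LinearMap.congr_fun (TensorProduct.map_smul_right r m.left n.left) x)
      (fun x => LinearMap.congr_fun (TensorProduct.map_smul_right r m.right n.right) x))


/-- A multiplicative linear bijection `e : A → B` induces `M(A) ≃ M(B)`, by conjugation. -/
def congr (e : A ≃ₗ[K] B) (he : ∀ x y, e (x * y) = e x * e y) :
    Multiplier K A →ₐ[K] Multiplier K B where
  toFun m := Multiplier.mk (e.toLinearMap ∘ₗ m.left ∘ₗ e.symm.toLinearMap)
    (e.toLinearMap ∘ₗ m.right ∘ₗ e.symm.toLinearMap) (fun a b => by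
      have h := congrArg e (m.central (e.symm a) (e.symm b))
      simpa [he] using h)
  map_one' := Multiplier.ext' (fun x => e.apply_symm_apply x) (fun x => e.apply_symm_apply x)
  map_mul' m n := Multiplier.ext'
    (fun x => congrArg e (congrArg m.left (e.symm_apply_apply (n.left (e.symm x))).symm))
    (fun x => congrArg e (congrArg n.right (e.symm_apply_apply (m.right (e.symm x))).symm))
  map_zero' := Multiplier.ext' (fun _ => e.map_zero) (fun _ => e.map_zero)
  map_add' m n := Multiplier.ext' (fun x => e.map_add (m.left (e.symm x)) (n.left (e.symm x)))
    (fun x => e.map_add (m.right (e.symm x)) (n.right (e.symm x)))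
  commutes' r := by
    refine Multiplier.ext' (fun x => ?_) (fun x => ?_)
    · exact (e.map_smul r (e.symm x)).trans (congrArg (r • ·) (e.apply_symm_apply x))
    · exact (e.map_smul r (e.symm x)).trans (congrArg (r • ·) (e.apply_symm_apply x))

/-- `φ : A → M(B)` is non-degenerate: `φ(A) B` and `B φ(A)` span `B`. -/
def NondegenerateHom (φ : A →ₗ[K] Multiplier K B) : Prop :=
  Submodule.span K {y : B | ∃ a b, y = (φ a).left b} = ⊤ ∧
  Submodule.span K {y : B | ∃ a b, y = (φ a).right b} = ⊤

/-- `n ∈ M(B)` is the value at `m ∈ M(A)` of the extension of `φ : A → M(B)`: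
`n φ(a) = φ(m a)` and `φ(a) n = φ(a m)` for all `a ∈ A`. -/
def IsExtendedValue (φ : A →ₗ[K] Multiplier K B) (m : Multiplier K A)
    (n : Multiplier K B) : Prop :=
  (∀ a, n * φ a = φ (m.left a)) ∧ (∀ a, φ a * n = φ (m.right a))

open Classical in
/-- The extension `M(A) → M(B)` of a non-degenerate homomorphism `φ : A → M(B)` (`0` at
multipliers at which no value, or more than one, is possible; this does not happen when `φ` is a
non-degenerate homomorphism). -/
def extend (φ : A →ₗ[K] Multiplier K B) (m : Multiplier K A) : Multiplier K B :=
  if h : ∃! n, IsExtendedValue φ m n then h.choose else 0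

theorem extend_eq {φ : A →ₗ[K] Multiplier K B} (hφ : NondegenerateHom φ) {m : Multiplier K A}
    {n : Multiplier K B} (hn : IsExtendedValue φ m n) : extend φ m = n := by
  have huniq : ∀ n', IsExtendedValue φ m n' → n' = n := by
    intro n' hn'
    refine Multiplier.ext' (fun x => ?_) (fun x => ?_)
    · have hx : x ∈ Submodule.span K {y : B | ∃ a b, y = (φ a).left b} := by
        rw [hφ.1]; trivial
      induction hx using Submodule.span_induction with
      | mem x hx =>
        obtain ⟨a, b, rfl⟩ := hx
        exact congrArg (fun t : Multiplier K B => t.left b) ((hn'.1 a).trans (hn.1 a).symm)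
      | zero => simp
      | add x y _ _ h₁ h₂ => simp only [map_add, h₁, h₂]
      | smul r x _ h => simp only [map_smul, h]
    · have hx : x ∈ Submodule.span K {y : B | ∃ a b, y = (φ a).right b} := by
        rw [hφ.2]; trivial
      induction hx using Submodule.span_induction with
      | mem x hx =>
        obtain ⟨a, b, rfl⟩ := hx
        exact congrArg (fun t : Multiplier K B => t.right b) ((hn'.2 a).trans (hn.2 a).symm)
      | zero => simp
      | add x y _ _ h₁ h₂ => simp only [map_add, h₁, h₂]
      | smul r x _ h => simp only [map_smul, h]
  have h : ∃! n, IsExtendedValue φ m n := ⟨n, hn, huniq⟩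
  unfold extend
  rw [dif_pos h]
  exact huniq _ h.choose_spec.1

end Multipliers

section Legs

variable {K : Type u} [Field K]
variable {A : Type v} [NonUnitalRing A] [Module K A] [SMulCommClass K A A] [IsScalarTower K A A]

theorem comm_mul (x y : A ⊗[K] A) :
    TensorProduct.comm K A A (x * y) = TensorProduct.comm K A A x * TensorProduct.comm K A A y := by
  induction x using TensorProduct.induction_on with
  | zero => simp
  | add x₁ x₂ h₁ h₂ => simp only [map_add, add_mul, h₁, h₂]
  | tmul a b =>
    induction y using TensorProduct.induction_on with
    | zero => simp
    | add y₁ y₂ h₁ h₂ => simp only [map_add, mul_add, h₁, h₂]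
    | tmul c d => simp [Algebra.TensorProduct.tmul_mul_tmul]

theorem assoc_symm_mul (x y : A ⊗[K] (A ⊗[K] A)) :
    (TensorProduct.assoc K A A A).symm (x * y) =
      (TensorProduct.assoc K A A A).symm x * (TensorProduct.assoc K A A A).symm y := by
  induction x using TensorProduct.induction_on with
  | zero => simp
  | add x₁ x₂ h₁ h₂ => simp only [map_add, add_mul, h₁, h₂]
  | tmul a b =>
    induction y using TensorProduct.induction_on with
    | zero => simp
    | add y₁ y₂ h₁ h₂ => simp only [map_add, mul_add, h₁, h₂]
    | tmul c d =>
      induction b using TensorProduct.induction_on with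
      | zero => simp
      | add b₁ b₂ h₁ h₂ =>
        simp only [TensorProduct.tmul_add, map_add, add_mul, h₁, h₂]
      | tmul b₁ b₂ =>
        induction d using TensorProduct.induction_on with
        | zero => simp
        | add d₁ d₂ h₁ h₂ =>
          simp only [TensorProduct.tmul_add, map_add, mul_add, h₁, h₂]
        | tmul d₁ d₂ => simp [Algebra.TensorProduct.tmul_mul_tmul]

theorem rightComm_mul (x y : (A ⊗[K] A) ⊗[K] A) :
    TensorProduct.rightComm K A A A (x * y) =
      TensorProduct.rightComm K A A A x * TensorProduct.rightComm K A A A y := by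
  induction x using TensorProduct.induction_on with
  | zero => simp
  | add x₁ x₂ h₁ h₂ => simp only [map_add, add_mul, h₁, h₂]
  | tmul b a =>
    induction y using TensorProduct.induction_on with
    | zero => simp
    | add y₁ y₂ h₁ h₂ => simp only [map_add, mul_add, h₁, h₂]
    | tmul d c =>
      induction b using TensorProduct.induction_on with
      | zero => simp
      | add b₁ b₂ h₁ h₂ =>
        simp only [TensorProduct.add_tmul, map_add, add_mul, h₁, h₂]
      | tmul b₁ b₂ =>
        induction d using TensorProduct.induction_on with
        | zero => simp
        | add d₁ d₂ h₁ h₂ =>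
          simp only [TensorProduct.add_tmul, map_add, mul_add, h₁, h₂]
        | tmul d₁ d₂ => simp [Algebra.TensorProduct.tmul_mul_tmul]

variable (K A) in
/-- `A ⊗ A`. -/
abbrev Two : Type _ := A ⊗[K] A

variable (K A) in
/-- `A ⊗ A ⊗ A`, bracketed to the left. -/
abbrev Three : Type _ := (A ⊗[K] A) ⊗[K] A

/-- The flip `τ` on `M(A ⊗ A)`; `flip X` is the multiplier `X₂₁`. -/
def flip : Multiplier K (Two K A) →ₐ[K] Multiplier K (Two K A) :=
  congr (TensorProduct.comm K A A) comm_mul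

/-- The identification of `M(A ⊗ (A ⊗ A))` with `M((A ⊗ A) ⊗ A)`. -/
def reassoc : Multiplier K (A ⊗[K] (A ⊗[K] A)) →ₐ[K] Multiplier K (Three K A) :=
  congr (TensorProduct.assoc K A A A).symm assoc_symm_mul

/-- The flip of the second and third tensor factor on `M(A ⊗ A ⊗ A)`. -/
def flip23 : Multiplier K (Three K A) →ₐ[K] Multiplier K (Three K A) :=
  congr (TensorProduct.rightComm K A A A) rightComm_mul

/-- `X¹² = X ⊗ 1`. -/
def leg12 (X : Multiplier K (Two K A)) : Multiplier K (Three K A) :=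
  tensorMul K (Two K A) A X 1

/-- `X²³ = 1 ⊗ X`. -/
def leg23 (X : Multiplier K (Two K A)) : Multiplier K (Three K A) :=
  reassoc (tensorMul K A (Two K A) 1 X)

/-- `X¹³`, obtained from `X¹²` by flipping the last two tensor factors. -/
def leg13 (X : Multiplier K (Two K A)) : Multiplier K (Three K A) :=
  flip23 (leg12 X)

/-- `a ⊗ 1 ∈ M(A ⊗ A)` for `a ∈ A`. -/
def inl (a : A) : Multiplier K (Two K A) := tensorMul K A A (incl K A a) 1

/-- `1 ⊗ a ∈ M(A ⊗ A)` for `a ∈ A`. -/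
def inr (a : A) : Multiplier K (Two K A) := tensorMul K A A 1 (incl K A a)

variable (K A) in
/-- The subspace `M(A) ⊗ A` of `M(A ⊗ A)`. -/
def multTensorAlg : Submodule K (Multiplier K (Two K A)) :=
  Submodule.span K {X | ∃ (m : Multiplier K A) (a : A), X = tensorMul K A A m (incl K A a)}

variable (K A) in
/-- The subspace `A ⊗ M(A)` of `M(A ⊗ A)`. -/
def algTensorMult : Submodule K (Multiplier K (Two K A)) :=
  Submodule.span K {X | ∃ (a : A) (m : Multiplier K A), X = tensorMul K A A (incl K A a) m}

end Legs

section Hopf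

variable {K : Type u} [Field K]
variable {A : Type v} [NonUnitalRing A] [Module K A] [SMulCommClass K A A] [IsScalarTower K A A]

/-- `Δ ⊗ ι : A ⊗ A → M(A ⊗ A ⊗ A)`, `a ⊗ b ↦ Δ(a) ⊗ b`. -/
def comulLeft (Δ : A →ₙₐ[K] Multiplier K (Two K A)) : Two K A →ₗ[K] Multiplier K (Three K A) :=
  TensorProduct.lift
    ((tensorMul K (Two K A) A).compl₁₂ (Δ : A →ₗ[K] Multiplier K (Two K A))
      (incl K A : A →ₗ[K] Multiplier K A))

/-- `ι ⊗ Δ : A ⊗ A → M(A ⊗ A ⊗ A)`, `a ⊗ b ↦ a ⊗ Δ(b)`. -/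
def comulRight (Δ : A →ₙₐ[K] Multiplier K (Two K A)) : Two K A →ₗ[K] Multiplier K (Three K A) :=
  (reassoc (K := K) (A := A)).toLinearMap ∘ₗ TensorProduct.lift
    ((tensorMul K A (Two K A)).compl₁₂ (incl K A : A →ₗ[K] Multiplier K A)
      (Δ : A →ₗ[K] Multiplier K (Two K A)))

/-- `Δ : A → M(A ⊗ A)` is a comultiplication: `Δ(a)(1 ⊗ b)` and `(a ⊗ 1)Δ(b)` lie in `A ⊗ A`,
and `Δ` is coassociative,
`(a ⊗ 1 ⊗ 1)(Δ ⊗ ι)(Δ(b)(1 ⊗ c)) = (ι ⊗ Δ)((a ⊗ 1)Δ(b))(1 ⊗ 1 ⊗ c)`. -/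
structure IsComultiplication (Δ : A →ₙₐ[K] Multiplier K (Two K A)) : Prop where
  mul_inr_mem : ∀ a b : A, ∃ x : Two K A, incl K (Two K A) x = Δ a * inr b
  inl_mul_mem : ∀ a b : A, ∃ x : Two K A, incl K (Two K A) x = inl a * Δ b
  coassoc : ∀ (a b c : A) (x y : Two K A),
    incl K (Two K A) x = Δ b * inr c → incl K (Two K A) y = inl a * Δ b →
      leg12 (inl a) * comulLeft Δ x = comulRight Δ y * leg23 (inr c)

/-- `(A, Δ)` is a multiplier Hopf algebra: the product is non-degenerate, `Δ` is a
comultiplication, and the maps `a ⊗ b ↦ Δ(a)(1 ⊗ b)` and `a ⊗ b ↦ (a ⊗ 1)Δ(b)` are bijections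
of `A ⊗ A`. -/
structure IsMultiplierHopfAlgebra (Δ : A →ₙₐ[K] Multiplier K (Two K A)) : Prop where
  nondegenerate : NondegenerateMul A
  comul : IsComultiplication Δ
  bijective_T₁ : ∃ T : Two K A →ₗ[K] Two K A, Function.Bijective T ∧
    ∀ a b : A, incl K (Two K A) (T (a ⊗ₜ[K] b)) = Δ a * inr b
  bijective_T₂ : ∃ T : Two K A →ₗ[K] Two K A, Function.Bijective T ∧
    ∀ a b : A, incl K (Two K A) (T (a ⊗ₜ[K] b)) = inl a * Δ b

/-- The co-opposite comultiplication `τ ∘ Δ`. -/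
def cop (Δ : A →ₙₐ[K] Multiplier K (Two K A)) : A →ₙₐ[K] Multiplier K (Two K A) :=
  ((flip : Multiplier K (Two K A) →ₐ[K] Multiplier K (Two K A)) :
    Multiplier K (Two K A) →ₙₐ[K] Multiplier K (Two K A)).comp Δ

/-- `(A, Δ)` is a regular multiplier Hopf algebra. -/
structure IsRegularMultiplierHopfAlgebra (Δ : A →ₙₐ[K] Multiplier K (Two K A)) : Prop where
  hopf : IsMultiplierHopfAlgebra Δ
  hopf_cop : IsMultiplierHopfAlgebra (cop Δ)

/-- `ε ⊗ ι : A ⊗ A → A`. -/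
def sliceLeft (ε : A →ₙₐ[K] K) : Two K A →ₗ[K] A :=
  (TensorProduct.lid K A).toLinearMap ∘ₗ TensorProduct.map (ε : A →ₗ[K] K) LinearMap.id

/-- `ι ⊗ ε : A ⊗ A → A`. -/
def sliceRight (ε : A →ₙₐ[K] K) : Two K A →ₗ[K] A :=
  (TensorProduct.rid K A).toLinearMap ∘ₗ TensorProduct.map LinearMap.id (ε : A →ₗ[K] K)

/-- `ε` is a counit: a homomorphism with `(ε ⊗ ι)(Δ(a)(1 ⊗ b)) = ab` and
`(ι ⊗ ε)((a ⊗ 1)Δ(b)) = ab`. -/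
structure IsCounit (Δ : A →ₙₐ[K] Multiplier K (Two K A)) (ε : A →ₙₐ[K] K) : Prop where
  slice_left : ∀ (a b : A) (x : Two K A), incl K (Two K A) x = Δ a * inr b → sliceLeft ε x = a * b
  slice_right : ∀ (a b : A) (x : Two K A), incl K (Two K A) x = inl a * Δ b → sliceRight ε x = a * b

open Classical in
/-- The counit of `(A, Δ)` (it exists and is unique for every multiplier Hopf algebra). -/
def counit (Δ : A →ₙₐ[K] Multiplier K (Two K A)) : A →ₙₐ[K] K :=
  if h : ∃ ε, IsCounit Δ ε then h.choose else 0

/-- `(Δ ⊗ ι)(X)` for `X ∈ M(A ⊗ A)`. -/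
def comulLeftExt (Δ : A →ₙₐ[K] Multiplier K (Two K A)) (X : Multiplier K (Two K A)) :
    Multiplier K (Three K A) := extend (comulLeft Δ) X

/-- `(ι ⊗ Δ)(X)` for `X ∈ M(A ⊗ A)`. -/
def comulRightExt (Δ : A →ₙₐ[K] Multiplier K (Two K A)) (X : Multiplier K (Two K A)) :
    Multiplier K (Three K A) := extend (comulRight Δ) X

/-- `(ε ⊗ ι)(X) ∈ M(A)` for `X ∈ M(A ⊗ A)`, where `ε` is the counit. -/
def counitLeftExt (Δ : A →ₙₐ[K] Multiplier K (Two K A)) (X : Multiplier K (Two K A)) :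
    Multiplier K A := extend ((incl K A : A →ₗ[K] Multiplier K A) ∘ₗ sliceLeft (counit Δ)) X

/-- `(ι ⊗ ε)(X) ∈ M(A)` for `X ∈ M(A ⊗ A)`, where `ε` is the counit. -/
def counitRightExt (Δ : A →ₙₐ[K] Multiplier K (Two K A)) (X : Multiplier K (Two K A)) :
    Multiplier K A := extend ((incl K A : A →ₗ[K] Multiplier K A) ∘ₗ sliceRight (counit Δ)) X

/-- `R` is a generalized R-matrix for `(A, Δ)`. -/
structure IsRMatrix (Δ : A →ₙₐ[K] Multiplier K (Two K A)) (R : (Multiplier K (Two K A))ˣ) :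
    Prop where
  comul_left : comulLeftExt Δ R = leg13 (R : Multiplier K (Two K A)) * leg23 R
  comul_right : comulRightExt Δ R = leg13 (R : Multiplier K (Two K A)) * leg12 R
  intertwine : ∀ a : A, (R : Multiplier K (Two K A)) * Δ a = cop Δ a * R
  counit_right : counitRightExt Δ R = 1
  counit_left : counitLeftExt Δ R = 1

/-- `(A, Δ)` is a quasitriangular (regular) multiplier Hopf algebra with generalized
R-matrix `R`. -/
structure IsQuasitriangular (Δ : A →ₙₐ[K] Multiplier K (Two K A))
    (R : (Multiplier K (Two K A))ˣ) : Prop where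
  regular : IsRegularMultiplierHopfAlgebra Δ
  rMatrix : IsRMatrix Δ R

/-- `J` is a normalized twist for `(A, Δ)`:
`(Δ ⊗ ι)(J)(J ⊗ 1) = (ι ⊗ Δ)(J)(1 ⊗ J)` and `(ε ⊗ ι)(J) = 1 = (ι ⊗ ε)(J)`. -/
structure IsTwist (Δ : A →ₙₐ[K] Multiplier K (Two K A)) (J : (Multiplier K (Two K A))ˣ) :
    Prop where
  cocycle : comulLeftExt Δ J * leg12 J = comulRightExt Δ J * leg23 J
  counit_left : counitLeftExt Δ J = 1
  counit_right : counitRightExt Δ J = 1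

/-- `J` is a general twisting for `(A, Δ)`: a twist such that `J(1 ⊗ a)` and `(1 ⊗ a)J` lie in
`M(A) ⊗ A`, and `J(a ⊗ 1)` and `(a ⊗ 1)J` lie in `A ⊗ M(A)`, for all `a ∈ A`. -/
structure IsGeneralTwisting (Δ : A →ₙₐ[K] Multiplier K (Two K A))
    (J : (Multiplier K (Two K A))ˣ) : Prop where
  twist : IsTwist Δ J
  mul_inr_mem : ∀ a : A, (J : Multiplier K (Two K A)) * inr a ∈ multTensorAlg K A
  inr_mul_mem : ∀ a : A, inr a * (J : Multiplier K (Two K A)) ∈ multTensorAlg K A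
  mul_inl_mem : ∀ a : A, (J : Multiplier K (Two K A)) * inl a ∈ algTensorMult K A
  inl_mul_mem : ∀ a : A, inl a * (J : Multiplier K (Two K A)) ∈ algTensorMult K A

/-- The twisted comultiplication `Δᴶ(a) = J⁻¹ Δ(a) J`, on the same algebra `A`. -/
def twistedComul (Δ : A →ₙₐ[K] Multiplier K (Two K A)) (J : (Multiplier K (Two K A))ˣ) :
    A →ₙₐ[K] Multiplier K (Two K A) where
  toFun a := ((J⁻¹ : (Multiplier K (Two K A))ˣ) : Multiplier K (Two K A)) * Δ a * J
  map_smul' r a := by simp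
  map_zero' := by simp
  map_add' a b := by simp [mul_add, add_mul]
  map_mul' a b := by simp [mul_assoc]

/-- The invertible multiplier `Rᴶ = J₂₁⁻¹ R J`. -/
def twistedRMatrix (R J : (Multiplier K (Two K A))ˣ) : (Multiplier K (Two K A))ˣ :=
  (Units.map (flip : Multiplier K (Two K A) →ₐ[K] Multiplier K (Two K A)).toMonoidHom J)⁻¹ * R * J

end Hopf

end MultiplierHopf

end

/-!
Write `J = J₁ ⊗ J₂`, let `S` be the antipode of `(A, Δ)`, `T(a ⊗ b) = Δ(a)(1 ⊗ b)` its Galois map,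
and `Δᴶ = J⁻¹ΔJ`. Three things have to be shown: `Δᴶ` is coassociative, its two Galois maps are
bijective (also for the co-opposite), and `Rᴶ = J₂₁⁻¹RJ` satisfies the axioms of an R-matrix.

Coassociativity is the cocycle identity, once `Δ ⊗ ι` and `ι ⊗ Δ` are known to extend to
multipliers. The co-opposite of `Δᴶ` is the twist of the co-opposite of `Δ` by `J₂₁`, which is again
a normalized cocycle. So every statement about `(Δ, J)` also holds for `(cop Δ, J₂₁)`; this gives
regularity, and one of the two hexagon identities from the other.

The heart of the matter is the bijectivity of the Galois maps. The first one is `J⁻¹W` with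
`W(a ⊗ b) = Δ(a)J(1 ⊗ b)`. Nothing is assumed about `J⁻¹` beyond its existence, so an inverse of `W`
cannot be written down directly. Instead, the cocycle identity gives a mixed pentagon equation
`T²³W¹² = W¹²W¹³(J⁻¹T)²³` (`HopfData.pentagon`).

* `W` is surjective (`HopfData.twistedGalois_surjective`). The pentagon equation says that the range
  of `W` is stable under `T²³`. The range is then also stable under `(T²³)⁻¹`: a subspace stable
  under a coaction is stable under its inverse Galois map (`HopfData.mem_range_rTensor_of_T₂₃`).
  Reading the pentagon equation backwards and applying the counit to the middle leg gives the claim.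
* The map `s(a) = S(J₁a)J₂ = S(a)Q`, with `Q = S(J₁)J₂`, is a bijection of `A`
  (`HopfData.twistedAntipode_bijective`). It is surjective because the map `S⁻¹(x)y` of
  `x ⊗ y`, applied to the range of the map `W` of the co-opposite algebra, yields exactly
  `S⁻¹(s(A))`. It is injective because its co-opposite version is surjective.
* `W` is injective (`HopfData.twistedGalois_injective`), again by the pentagon equation and the
  surjectivity of `s`.
* The second Galois map is computed explicitly. The cocycle identity yields
  `(s(a) ⊗ 1)J⁻¹Δ(b) = ∑ S(y) ⊗ x` for `∑ Δ(x)(y ⊗ 1) = J(a ⊗ b)`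
  (`HopfData.inl_mul_inv_mul_comul`), and the right side is a composite of bijections of `A ⊗ A`.

For the hexagon identity `(Δᴶ ⊗ ι)(Rᴶ) = (Rᴶ)¹³(Rᴶ)²³`, the left side is
`(J¹²)⁻¹ (Δ ⊗ ι)(J₂₁⁻¹) R¹³R²³ (Δ ⊗ ι)(J) J¹²`. The cocycle identity and two of its permuted forms,
together with `RΔ = Δᶜᵒᵖ R`, move the twists across `R²³` and `R¹³`.

All of this is done for a counit `ε ≠ 0`. Such a counit exists as soon as `A ≠ 0`, because the
normalization `(ε ⊗ ι)(R) = 1` would fail for `ε = 0`; for `A = 0` there is nothing to prove.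
-/

noncomputable section

namespace MultiplierHopf

universe u v w

set_option linter.unusedSectionVars false

/-! ### Multipliers and non-degenerate algebras -/

section Basic

variable {K : Type u} [Field K]
variable {A : Type v} [NonUnitalRing A] [Module K A] [SMulCommClass K A A] [IsScalarTower K A A]
variable {B : Type w} [NonUnitalRing B] [Module K B] [SMulCommClass K B B] [IsScalarTower K B B]

namespace Multiplier

@[simp] theorem mul_left (m n : Multiplier K A) (x : A) : (m * n).left x = m.left (n.left x) := rfl

@[simp] theorem mul_right (m n : Multiplier K A) (x : A) :
    (m * n).right x = n.right (m.right x) := rfl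

@[simp] theorem one_left (x : A) : (1 : Multiplier K A).left x = x := rfl

@[simp] theorem one_right (x : A) : (1 : Multiplier K A).right x = x := rfl

theorem left_mul_assoc (hA : NondegenerateMul A) (m : Multiplier K A) (x y : A) :
    m.left (x * y) = m.left x * y := by
  refine sub_eq_zero.1 (hA.2 _ fun z => ?_)
  rw [mul_sub, ← m.central, ← mul_assoc, ← mul_assoc, ← m.central, sub_self]

theorem ext_left (hA : NondegenerateMul A) {m n : Multiplier K A}
    (h : ∀ x, m.left x = n.left x) : m = n := by
  refine Multiplier.ext' h fun x => sub_eq_zero.1 (hA.1 _ fun z => ?_)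
  rw [sub_mul, m.central, n.central, h, sub_self]

theorem left_bijective (J : (Multiplier K A)ˣ) :
    Function.Bijective (J : Multiplier K A).left := by
  refine Function.bijective_iff_has_inverse.2
    ⟨((J⁻¹ : (Multiplier K A)ˣ) : Multiplier K A).left, fun x => ?_, fun x => ?_⟩
  · rw [← mul_left, Units.inv_mul, one_left]
  · rw [← mul_left, Units.mul_inv, one_left]

theorem right_bijective (J : (Multiplier K A)ˣ) :
    Function.Bijective (J : Multiplier K A).right := by
  refine Function.bijective_iff_has_inverse.2
    ⟨((J⁻¹ : (Multiplier K A)ˣ) : Multiplier K A).right, fun x => ?_, fun x => ?_⟩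
  · rw [← mul_right, Units.mul_inv, one_right]
  · rw [← mul_right, Units.inv_mul, one_right]

end Multiplier

@[simp] theorem incl_left (a x : A) : (incl K A a).left x = a * x := rfl

@[simp] theorem incl_right (a x : A) : (incl K A a).right x = x * a := rfl

theorem incl_injective (hA : NondegenerateMul A) : Function.Injective (incl K A) := by
  intro a b h
  refine sub_eq_zero.1 (hA.1 _ fun z => ?_)
  rw [sub_mul, ← incl_left (K := K), ← incl_left (K := K), h, sub_self]

theorem mul_incl (hA : NondegenerateMul A) (m : Multiplier K A) (a : A) :
    m * incl K A a = incl K A (m.left a) :=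
  Multiplier.ext_left hA fun x => m.left_mul_assoc hA a x

theorem incl_mul (hA : NondegenerateMul A) (m : Multiplier K A) (a : A) :
    incl K A a * m = incl K A (m.right a) :=
  Multiplier.ext_left hA fun x => (m.central a x).symm

/-- Slices by functionals on the first factor separate the points of `V ⊗ B`. -/
theorem tensor_eq_zero_of_slices {V W : Type*} [AddCommGroup V] [Module K V] [AddCommGroup W]
    [Module K W] (t : V ⊗[K] W)
    (h : ∀ φ : V →ₗ[K] K, TensorProduct.lid K W (φ.rTensor W t) = 0) : t = 0 := by
  classical
  let b := Module.Basis.ofVectorSpace K V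
  refine (TensorProduct.equivFinsuppOfBasisLeft (N := W) b).injective ?_
  rw [map_zero]
  ext i
  have key : ∀ s : V ⊗[K] W, TensorProduct.equivFinsuppOfBasisLeft (N := W) b s i =
      TensorProduct.lid K W ((b.coord i).rTensor W s) := by
    intro s
    induction s using TensorProduct.induction_on with
    | zero => simp
    | add x y hx hy => simp only [map_add, Finsupp.add_apply, hx, hy]
    | tmul x y => simp
  rw [key, h, Finsupp.zero_apply]

theorem tensor_eq_zero_of_mulRight {V : Type*} [AddCommGroup V] [Module K V]
    (hB : NondegenerateMul B) (t : V ⊗[K] B)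
    (h : ∀ b : B, (LinearMap.mulRight K b).lTensor V t = 0) : t = 0 := by
  refine tensor_eq_zero_of_slices t fun φ => hB.1 _ fun b => ?_
  have key : ∀ s : V ⊗[K] B, TensorProduct.lid K B (φ.rTensor B s) * b =
      TensorProduct.lid K B (φ.rTensor B ((LinearMap.mulRight K b).lTensor V s)) := by
    intro s
    induction s using TensorProduct.induction_on with
    | zero => simp
    | add x y hx hy => simp only [map_add, add_mul, hx, hy]
    | tmul x y => simp [smul_mul_assoc]
  rw [key, h, map_zero, map_zero]

theorem tensor_eq_zero_of_mulLeft {V : Type*} [AddCommGroup V] [Module K V]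
    (hB : NondegenerateMul B) (t : V ⊗[K] B)
    (h : ∀ b : B, (LinearMap.mulLeft K b).lTensor V t = 0) : t = 0 := by
  refine tensor_eq_zero_of_slices t fun φ => hB.2 _ fun b => ?_
  have key : ∀ s : V ⊗[K] B, b * TensorProduct.lid K B (φ.rTensor B s) =
      TensorProduct.lid K B (φ.rTensor B ((LinearMap.mulLeft K b).lTensor V s)) := by
    intro s
    induction s using TensorProduct.induction_on with
    | zero => simp
    | add x y hx hy => simp only [map_add, mul_add, hx, hy]
    | tmul x y => simp [mul_smul_comm]
  rw [key, h, map_zero, map_zero]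

theorem NondegenerateMul.tensor (hA : NondegenerateMul A) (hB : NondegenerateMul B) :
    NondegenerateMul (A ⊗[K] B) := by
  constructor
  · intro t ht
    refine tensor_eq_zero_of_mulRight hB t fun b => ?_
    refine (TensorProduct.comm K A B).injective ?_
    rw [map_zero]
    refine tensor_eq_zero_of_mulRight hA _ fun a => ?_
    have key : ∀ s : A ⊗[K] B, (LinearMap.mulRight K a).lTensor B
        (TensorProduct.comm K A B ((LinearMap.mulRight K b).lTensor A s)) =
        TensorProduct.comm K A B (s * (a ⊗ₜ[K] b)) := by
      intro s
      induction s using TensorProduct.induction_on with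
      | zero => simp
      | add x y hx hy => simp only [map_add, add_mul, hx, hy]
      | tmul x y => simp [Algebra.TensorProduct.tmul_mul_tmul]
    rw [key, ht, map_zero]
  · intro t ht
    refine tensor_eq_zero_of_mulLeft hB t fun b => ?_
    refine (TensorProduct.comm K A B).injective ?_
    rw [map_zero]
    refine tensor_eq_zero_of_mulLeft hA _ fun a => ?_
    have key : ∀ s : A ⊗[K] B, (LinearMap.mulLeft K a).lTensor B
        (TensorProduct.comm K A B ((LinearMap.mulLeft K b).lTensor A s)) =
        TensorProduct.comm K A B ((a ⊗ₜ[K] b) * s) := by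
      intro s
      induction s using TensorProduct.induction_on with
      | zero => simp
      | add x y hx hy => simp only [map_add, mul_add, hx, hy]
      | tmul x y => simp [Algebra.TensorProduct.tmul_mul_tmul]
    rw [key, ht, map_zero]

/-- A bilinear family of multipliers all of which lie in `B` comes from a linear map into `B`. -/
theorem exists_linearMap_of_forall_mem (hB : NondegenerateMul B) {V W : Type*}
    [AddCommGroup V] [Module K V] [AddCommGroup W] [Module K W]
    (β : V →ₗ[K] W →ₗ[K] Multiplier K B) (h : ∀ v w, ∃ x, incl K B x = β v w) :
    ∃ F : V ⊗[K] W →ₗ[K] B, ∀ v w, incl K B (F (v ⊗ₜ[K] w)) = β v w := by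
  let ι : B →ₗ[K] Multiplier K B := (incl K B : B →ₗ[K] Multiplier K B)
  have hι : Function.Injective ι := incl_injective hB
  have hr : ∀ t : V ⊗[K] W, TensorProduct.lift β t ∈ LinearMap.range ι := by
    intro t
    induction t using TensorProduct.induction_on with
    | zero => simp
    | add x y hx hy => rw [map_add]; exact add_mem hx hy
    | tmul x y => obtain ⟨z, hz⟩ := h x y; exact ⟨z, hz⟩
  refine ⟨(LinearEquiv.ofInjective ι hι).symm.toLinearMap ∘ₗ
    (TensorProduct.lift β).codRestrict _ hr, fun v w => ?_⟩
  change ι ((LinearEquiv.ofInjective ι hι).symm _) = _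
  have := (LinearEquiv.ofInjective ι hι).apply_symm_apply
    ((TensorProduct.lift β).codRestrict _ hr (v ⊗ₜ[K] w))
  exact (congrArg Subtype.val this).trans (TensorProduct.lift.tmul v w)

/-- A linear family of left multiplications by elements of `A` comes from a linear map into `A`. -/
theorem exists_linearMap_of_forall_mulLeft (hA : NondegenerateMul A) {V : Type*}
    [AddCommGroup V] [Module K V] (g : V →ₗ[K] A →ₗ[K] A) (h : ∀ v, ∃ s, ∀ c, g v c = s * c) :
    ∃ S : V →ₗ[K] A, ∀ v c, g v c = S v * c := by
  have hι : Function.Injective (LinearMap.mul K A) := by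
    intro a b hab
    refine sub_eq_zero.1 (hA.1 _ fun z => ?_)
    have := LinearMap.congr_fun hab z
    simp only [LinearMap.mul_apply'] at this
    rw [sub_mul, this, sub_self]
  have hr : ∀ v, g v ∈ LinearMap.range (LinearMap.mul K A) := fun v => by
    obtain ⟨s, hs⟩ := h v
    exact ⟨s, LinearMap.ext fun c => (hs c).symm⟩
  refine ⟨(LinearEquiv.ofInjective _ hι).symm.toLinearMap ∘ₗ g.codRestrict _ hr, fun v c => ?_⟩
  have := (LinearEquiv.ofInjective _ hι).apply_symm_apply (g.codRestrict _ hr v)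
  exact (LinearMap.congr_fun (congrArg Subtype.val this) c).symm

end Basic

/-! ### Extension of non-degenerate homomorphisms to multiplier algebras -/

section Extension

variable {K : Type u} [Field K]
variable {A : Type v} [NonUnitalRing A] [Module K A] [SMulCommClass K A A] [IsScalarTower K A A]
variable {B : Type w} [NonUnitalRing B] [Module K B] [SMulCommClass K B B] [IsScalarTower K B B]
variable {φ : A →ₗ[K] Multiplier K B}

/-- Left multiplication, as a linear map from multipliers to endomorphisms. -/
def Multiplier.leftHom : Multiplier K A →ₗ[K] A →ₗ[K] A where
  toFun m := m.left
  map_add' _ _ := rfl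
  map_smul' _ _ := rfl

/-- Right multiplication, as a linear map from multipliers to endomorphisms. -/
def Multiplier.rightHom : Multiplier K A →ₗ[K] A →ₗ[K] A where
  toFun m := m.right
  map_add' _ _ := rfl
  map_smul' _ _ := rfl

theorem exists_factor_of_surjective {U V W : Type*} [AddCommGroup U] [Module K U]
    [AddCommGroup V] [Module K V] [AddCommGroup W] [Module K W] (l : U →ₗ[K] V) (g : U →ₗ[K] W)
    (hl : Function.Surjective l) (h : ∀ t, l t = 0 → g t = 0) :
    ∃ L : V →ₗ[K] W, ∀ t, L (l t) = g t := by
  obtain ⟨s, hs⟩ := l.exists_rightInverse_of_surjective (LinearMap.range_eq_top.2 hl)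
  refine ⟨g ∘ₗ s, fun t => sub_eq_zero.1 ?_⟩
  have h1 : l (s (l t) - t) = 0 := by
    rw [map_sub, ← LinearMap.comp_apply l s, hs, LinearMap.id_apply, sub_self]
  have h2 := h _ h1
  rwa [map_sub] at h2

theorem NondegenerateHom.lift_left_surjective (hφ : NondegenerateHom φ) :
    Function.Surjective (TensorProduct.lift (Multiplier.leftHom ∘ₗ φ)) := by
  rw [← LinearMap.range_eq_top, eq_top_iff, ← hφ.1, Submodule.span_le]
  rintro _ ⟨a, b, rfl⟩
  exact ⟨a ⊗ₜ b, TensorProduct.lift.tmul a b⟩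

theorem NondegenerateHom.lift_right_surjective (hφ : NondegenerateHom φ) :
    Function.Surjective (TensorProduct.lift (Multiplier.rightHom ∘ₗ φ)) := by
  rw [← LinearMap.range_eq_top, eq_top_iff, ← hφ.2, Submodule.span_le]
  rintro _ ⟨a, b, rfl⟩
  exact ⟨a ⊗ₜ b, TensorProduct.lift.tmul a b⟩

theorem NondegenerateHom.eq_zero_of_left (hB : NondegenerateMul B) (hφ : NondegenerateHom φ)
    {y : B} (h : ∀ a, (φ a).left y = 0) : y = 0 := by
  refine hB.2 y fun z => ?_
  obtain ⟨t, rfl⟩ := hφ.lift_right_surjective z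
  induction t using TensorProduct.induction_on with
  | zero => simp
  | add t₁ t₂ h₁ h₂ => rw [map_add, add_mul, h₁, h₂, add_zero]
  | tmul a b =>
    change (φ a).right b * y = 0
    rw [Multiplier.central, h, mul_zero]

theorem NondegenerateHom.eq_zero_of_right (hB : NondegenerateMul B) (hφ : NondegenerateHom φ)
    {y : B} (h : ∀ a, (φ a).right y = 0) : y = 0 := by
  refine hB.1 y fun z => ?_
  obtain ⟨t, rfl⟩ := hφ.lift_left_surjective z
  induction t using TensorProduct.induction_on with
  | zero => simp
  | add t₁ t₂ h₁ h₂ => rw [map_add, mul_add, h₁, h₂, add_zero]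
  | tmul a b =>
    change y * (φ a).left b = 0
    rw [← Multiplier.central, h, zero_mul]

/-- The extension exists: `φ(a) b ↦ φ(m a) b` is well defined, because a relation
`∑ φ(aᵢ) bᵢ = 0` gives `φ(c) ∑ φ(m aᵢ) bᵢ = φ(c m) ∑ φ(aᵢ) bᵢ = 0` for all `c`. -/
theorem NondegenerateHom.exists_isExtendedValue (hB : NondegenerateMul B)
    (hφ : NondegenerateHom φ) (hmul : ∀ a b, φ (a * b) = φ a * φ b) (m : Multiplier K A) :
    ∃ n, IsExtendedValue φ m n := by
  let l := TensorProduct.lift (Multiplier.leftHom ∘ₗ φ)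
  let g := TensorProduct.lift (Multiplier.leftHom ∘ₗ φ ∘ₗ m.left)
  let l' := TensorProduct.lift (Multiplier.rightHom ∘ₗ φ)
  let g' := TensorProduct.lift (Multiplier.rightHom ∘ₗ φ ∘ₗ m.right)
  have hlg : ∀ c t, (φ c).left (g t) = (φ (m.right c)).left (l t) := by
    intro c t
    induction t using TensorProduct.induction_on with
    | zero => simp
    | add t₁ t₂ h₁ h₂ => simp only [map_add, h₁, h₂]
    | tmul a b =>
      change (φ c * φ (m.left a)).left b = (φ (m.right c) * φ a).left b
      rw [← hmul, ← hmul, m.central]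
  have hlg' : ∀ c t, (φ c).right (g' t) = (φ (m.left c)).right (l' t) := by
    intro c t
    induction t using TensorProduct.induction_on with
    | zero => simp
    | add t₁ t₂ h₁ h₂ => simp only [map_add, h₁, h₂]
    | tmul a b =>
      change (φ (m.right a) * φ c).right b = (φ a * φ (m.left c)).right b
      rw [← hmul, ← hmul, m.central]
  obtain ⟨L, hL⟩ := exists_factor_of_surjective l g hφ.lift_left_surjective fun t ht =>
    hφ.eq_zero_of_left hB fun c => by rw [hlg, ht, map_zero]
  obtain ⟨R, hR⟩ := exists_factor_of_surjective l' g' hφ.lift_right_surjective fun t ht =>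
    hφ.eq_zero_of_right hB fun c => by rw [hlg', ht, map_zero]
  have hL' : ∀ a b, L ((φ a).left b) = (φ (m.left a)).left b := fun a b => hL (a ⊗ₜ b)
  have hR' : ∀ a b, R ((φ a).right b) = (φ (m.right a)).right b := fun a b => hR (a ⊗ₜ b)
  have hc : ∀ x y, R x * y = x * L y := by
    intro x y
    obtain ⟨s, rfl⟩ := hφ.lift_right_surjective x
    obtain ⟨t, rfl⟩ := hφ.lift_left_surjective y
    change R (l' s) * l t = l' s * L (l t)
    rw [hR, hL]
    induction s using TensorProduct.induction_on with
    | zero => simp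
    | add s₁ s₂ h₁ h₂ => simp only [map_add, add_mul, h₁, h₂]
    | tmul a b =>
      change (φ (m.right a)).right b * l t = (φ a).right b * g t
      rw [Multiplier.central, Multiplier.central, hlg]
  refine ⟨Multiplier.mk L R hc, fun a => Multiplier.ext' (fun x => hL' a x) fun x => ?_,
    fun a => Multiplier.ext' (fun x => ?_) fun x => hR' a x⟩
  · change (φ a).right (R x) = (φ (m.left a)).right x
    obtain ⟨s, rfl⟩ := hφ.lift_right_surjective x
    exact (congrArg _ (hR s)).trans (hlg' a s)
  · change (φ a).left (L x) = (φ (m.right a)).left x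
    obtain ⟨s, rfl⟩ := hφ.lift_left_surjective x
    exact (congrArg _ (hL s)).trans (hlg a s)

theorem NondegenerateHom.isExtendedValue_extend (hB : NondegenerateMul B)
    (hφ : NondegenerateHom φ) (hmul : ∀ a b, φ (a * b) = φ a * φ b) (m : Multiplier K A) :
    IsExtendedValue φ m (extend φ m) := by
  obtain ⟨n, hn⟩ := hφ.exists_isExtendedValue hB hmul m
  rwa [extend_eq hφ hn]

theorem IsExtendedValue.mul {m m' : Multiplier K A} {n n' : Multiplier K B}
    (h : IsExtendedValue φ m n) (h' : IsExtendedValue φ m' n') :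
    IsExtendedValue φ (m * m') (n * n') :=
  ⟨fun a => by rw [mul_assoc, h'.1, h.1, Multiplier.mul_left],
    fun a => by rw [← mul_assoc, h.2, h'.2, Multiplier.mul_right]⟩

theorem IsExtendedValue.one : IsExtendedValue φ (1 : Multiplier K A) 1 :=
  ⟨fun a => by rw [one_mul, Multiplier.one_left], fun a => by rw [mul_one, Multiplier.one_right]⟩

theorem isExtendedValue_incl (hmul : ∀ a b, φ (a * b) = φ a * φ b) (a : A) :
    IsExtendedValue φ (incl K A a) (φ a) :=
  ⟨fun b => (hmul a b).symm, fun b => (hmul b a).symm⟩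

/-- `extend` takes the value `0` where there is no extension, so a nonzero value is genuine. -/
theorem isExtendedValue_of_extend_eq {m : Multiplier K A} {n : Multiplier K B}
    (h : extend φ m = n) (hn : n ≠ 0) : IsExtendedValue φ m n := by
  unfold extend at h
  split_ifs at h with hex
  · rw [← h]; exact hex.choose_spec.1
  · exact absurd h.symm hn

end Extension

/-! ### Multipliers of tensor products and their legs -/

section TensorMul

variable {K : Type u} [Field K]
variable {A : Type v} [NonUnitalRing A] [Module K A] [SMulCommClass K A A] [IsScalarTower K A A]
variable {B : Type w} [NonUnitalRing B] [Module K B] [SMulCommClass K B B] [IsScalarTower K B B]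

@[simp] theorem tensorMul_left (m : Multiplier K A) (n : Multiplier K B) (x : A ⊗[K] B) :
    (tensorMul K A B m n).left x = TensorProduct.map m.left n.left x := rfl

@[simp] theorem tensorMul_right (m : Multiplier K A) (n : Multiplier K B) (x : A ⊗[K] B) :
    (tensorMul K A B m n).right x = TensorProduct.map m.right n.right x := rfl

theorem tensorMul_mul (m m' : Multiplier K A) (n n' : Multiplier K B) :
    tensorMul K A B m n * tensorMul K A B m' n' = tensorMul K A B (m * m') (n * n') := by
  refine Multiplier.ext' (fun x => ?_) (fun x => ?_)
  · exact (TensorProduct.map_map m.left n.left m'.left n'.left x)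
  · exact (TensorProduct.map_map m'.right n'.right m.right n.right x)

theorem tensorMul_one_one : tensorMul K A B 1 1 = 1 :=
  Multiplier.ext' (fun x => LinearMap.congr_fun TensorProduct.map_id x)
    (fun x => LinearMap.congr_fun TensorProduct.map_id x)

theorem incl_tmul (a : A) (b : B) :
    incl K (A ⊗[K] B) (a ⊗ₜ[K] b) = tensorMul K A B (incl K A a) (incl K B b) := by
  refine Multiplier.ext' (fun x => ?_) (fun x => ?_)
  · induction x using TensorProduct.induction_on with
    | zero => simp
    | add x y hx hy => rw [map_add, map_add, hx, hy]
    | tmul c d => simp [Algebra.TensorProduct.tmul_mul_tmul]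
  · induction x using TensorProduct.induction_on with
    | zero => simp
    | add x y hx hy => rw [map_add, map_add, hx, hy]
    | tmul c d => simp [Algebra.TensorProduct.tmul_mul_tmul]

variable (K A) in
/-- `A² = A`: products span `A`. -/
def IdempotentMul : Prop := ∀ P : Submodule K A, (∀ x y, x * y ∈ P) → P = ⊤

theorem IdempotentMul.tensor (hA : IdempotentMul K A) (hB : IdempotentMul K B) :
    IdempotentMul K (A ⊗[K] B) := by
  intro P hP
  have h1 : ∀ (a a' : A) (b : B), (a * a') ⊗ₜ[K] b ∈ P := by
    intro a a' b
    have := hB (P.comap (TensorProduct.mk K A B (a * a'))) fun b b' => by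
      have := hP (a ⊗ₜ b) (a' ⊗ₜ b')
      rwa [Algebra.TensorProduct.tmul_mul_tmul] at this
    have hb : b ∈ P.comap (TensorProduct.mk K A B (a * a')) := this ▸ Submodule.mem_top
    exact hb
  have h2 : ∀ (a : A) (b : B), a ⊗ₜ[K] b ∈ P := by
    intro a b
    have := hA (P.comap ((TensorProduct.mk K A B).flip b)) fun a a' => h1 a a' b
    have ha : a ∈ P.comap ((TensorProduct.mk K A B).flip b) := this ▸ Submodule.mem_top
    exact ha
  rw [eq_top_iff, ← TensorProduct.span_tmul_eq_top, Submodule.span_le]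
  rintro _ ⟨a, b, rfl⟩
  exact h2 a b

end TensorMul

section Legs

variable {K : Type u} [Field K]
variable {A : Type v} [NonUnitalRing A] [Module K A] [SMulCommClass K A A] [IsScalarTower K A A]

@[simp] theorem flip_left (X : Multiplier K (Two K A)) (z : Two K A) :
    (flip X).left z = TensorProduct.comm K A A (X.left (TensorProduct.comm K A A z)) := rfl

@[simp] theorem flip_right (X : Multiplier K (Two K A)) (z : Two K A) :
    (flip X).right z = TensorProduct.comm K A A (X.right (TensorProduct.comm K A A z)) := rfl

@[simp] theorem flip_flip (X : Multiplier K (Two K A)) : flip (flip X) = X :=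
  Multiplier.ext' (fun z => by simp) (fun z => by simp)

theorem flip_tensorMul (m n : Multiplier K A) :
    flip (tensorMul K A A m n) = tensorMul K A A n m := by
  refine Multiplier.ext' (fun x => ?_) (fun x => ?_)
  · induction x using TensorProduct.induction_on with
    | zero => simp
    | add x y hx hy => rw [map_add, map_add, hx, hy]
    | tmul c d => simp
  · induction x using TensorProduct.induction_on with
    | zero => simp
    | add x y hx hy => rw [map_add, map_add, hx, hy]
    | tmul c d => simp

@[simp] theorem flip_inl (a : A) : flip (inl (K := K) a) = inr a := flip_tensorMul _ _

@[simp] theorem flip_inr (a : A) : flip (inr (K := K) a) = inl a := flip_tensorMul _ _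

theorem flip_incl (z : Two K A) :
    flip (incl K (Two K A) z) = incl K (Two K A) (TensorProduct.comm K A A z) := by
  refine Multiplier.ext' (fun x => ?_) (fun x => ?_)
  · simp [comm_mul]
  · simp [comm_mul]

theorem reassoc_left (X : Multiplier K (A ⊗[K] (A ⊗[K] A))) (z : Three K A) :
    (reassoc X).left z = (TensorProduct.assoc K A A A).symm
      (X.left (TensorProduct.assoc K A A A z)) := rfl

theorem reassoc_right (X : Multiplier K (A ⊗[K] (A ⊗[K] A))) (z : Three K A) :
    (reassoc X).right z = (TensorProduct.assoc K A A A).symm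
      (X.right (TensorProduct.assoc K A A A z)) := rfl

theorem reassoc_incl (z : A ⊗[K] (A ⊗[K] A)) :
    reassoc (incl K (A ⊗[K] (A ⊗[K] A)) z) = incl K (Three K A) ((TensorProduct.assoc K A A A).symm z) := by
  refine Multiplier.ext' (fun x => ?_) (fun x => ?_)
  · rw [reassoc_left, incl_left, assoc_symm_mul, LinearEquiv.symm_apply_apply, incl_left]
  · rw [reassoc_right, incl_right, assoc_symm_mul, LinearEquiv.symm_apply_apply, incl_right]

theorem reassoc_tensorMul (l m n : Multiplier K A) :
    reassoc (tensorMul K A (Two K A) l (tensorMul K A A m n)) =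
      tensorMul K (Two K A) A (tensorMul K A A l m) n := by
  refine Multiplier.ext' (fun x => ?_) (fun x => ?_)
  · exact LinearMap.congr_fun (TensorProduct.map_map_comp_assoc_symm_eq l.left m.left n.left)
      (TensorProduct.assoc K A A A x) |>.symm.trans
      (by rw [LinearMap.comp_apply, LinearEquiv.coe_coe, LinearEquiv.symm_apply_apply]; rfl)
  · exact LinearMap.congr_fun (TensorProduct.map_map_comp_assoc_symm_eq l.right m.right n.right)
      (TensorProduct.assoc K A A A x) |>.symm.trans
      (by rw [LinearMap.comp_apply, LinearEquiv.coe_coe, LinearEquiv.symm_apply_apply]; rfl)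

theorem leg12_mul (X Y : Multiplier K (Two K A)) : leg12 (X * Y) = leg12 X * leg12 Y := by
  rw [leg12, leg12, leg12, tensorMul_mul, one_mul]

theorem leg12_one : leg12 (1 : Multiplier K (Two K A)) = 1 := tensorMul_one_one

theorem leg23_mul (X Y : Multiplier K (Two K A)) : leg23 (X * Y) = leg23 X * leg23 Y := by
  rw [leg23, leg23, leg23, ← map_mul, tensorMul_mul, one_mul]

theorem leg23_one : leg23 (1 : Multiplier K (Two K A)) = 1 := by
  rw [leg23, tensorMul_one_one, map_one]

theorem leg13_mul (X Y : Multiplier K (Two K A)) : leg13 (X * Y) = leg13 X * leg13 Y := by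
  rw [leg13, leg13, leg13, leg12_mul, map_mul]

theorem leg13_one : leg13 (1 : Multiplier K (Two K A)) = 1 := by
  rw [leg13, leg12_one, map_one]

theorem leg23_inr (c : A) : leg23 (inr (K := K) c) = tensorMul K (Two K A) A 1 (incl K A c) := by
  rw [leg23, inr, reassoc_tensorMul, tensorMul_one_one]

theorem leg12_inl (a : A) :
    leg12 (inl (K := K) a) = reassoc (tensorMul K A (Two K A) (incl K A a) 1) := by
  rw [← tensorMul_one_one, reassoc_tensorMul]; rfl

theorem leg23_inl (b : A) : leg23 (inl (K := K) b) = leg12 (inr b) := by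
  rw [leg23, inl, reassoc_tensorMul]; rfl

theorem leg12_leg23_inr_comm (X : Multiplier K (Two K A)) (c : A) :
    leg12 X * leg23 (inr c) = leg23 (inr c) * leg12 X := by
  rw [leg23_inr, leg12, tensorMul_mul, tensorMul_mul, one_mul, mul_one, one_mul, mul_one]

theorem leg12_inl_leg23_comm (X : Multiplier K (Two K A)) (c : A) :
    leg12 (inl c) * leg23 X = leg23 X * leg12 (inl c) := by
  rw [leg12_inl, leg23, ← map_mul, ← map_mul, tensorMul_mul, tensorMul_mul, one_mul, mul_one,
    one_mul, mul_one]

theorem incl_three_tmul (x : Two K A) (c : A) :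
    incl K (Three K A) (x ⊗ₜ[K] c) = leg12 (incl K (Two K A) x) * leg23 (inr c) := by
  rw [incl_tmul, leg23_inr, leg12, tensorMul_mul, mul_one, one_mul]

theorem incl_three_tmul' (a : A) (x : Two K A) :
    incl K (Three K A) ((TensorProduct.assoc K A A A).symm (a ⊗ₜ[K] x)) =
      leg12 (inl a) * leg23 (incl K (Two K A) x) := by
  rw [← reassoc_incl, incl_tmul, leg12_inl, leg23, ← map_mul, tensorMul_mul, mul_one, one_mul]

theorem incl_two_tmul (a b : A) : incl K (Two K A) (a ⊗ₜ[K] b) = inl a * inr b := by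
  rw [incl_tmul, inl, inr, tensorMul_mul, one_mul, mul_one]

theorem inl_inr_comm (a b : A) : inl (K := K) a * inr b = inr b * inl a := by
  rw [inl, inr, tensorMul_mul, tensorMul_mul, one_mul, mul_one, one_mul, mul_one]

/-- The reversal `a ⊗ b ⊗ c ↦ c ⊗ b ⊗ a` of the tensor factors of `A ⊗ A ⊗ A`. -/
def revEquiv : Three K A ≃ₗ[K] Three K A :=
  (TensorProduct.assoc K A A A).trans ((TensorProduct.comm K A (A ⊗[K] A)).trans
    (TensorProduct.congr (TensorProduct.comm K A A) (LinearEquiv.refl K A)))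

@[simp] theorem revEquiv_tmul (a b c : A) :
    revEquiv (K := K) ((a ⊗ₜ b) ⊗ₜ c) = (c ⊗ₜ b) ⊗ₜ a := rfl

theorem three_ext {V : Type*} [AddCommGroup V] [Module K V] {F G : Three K A →ₗ[K] V}
    (h : ∀ a b c, F ((a ⊗ₜ b) ⊗ₜ c) = G ((a ⊗ₜ b) ⊗ₜ c)) : F = G :=
  TensorProduct.ext_threefold h

theorem three_mem {V : Type*} [AddCommGroup V] [Module K V] (P : Submodule K V)
    (F : Three K A →ₗ[K] V) (h : ∀ a b c, F ((a ⊗ₜ b) ⊗ₜ c) ∈ P) (z : Three K A) : F z ∈ P := by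
  have : P.mkQ ∘ₗ F = 0 := three_ext fun a b c => (Submodule.Quotient.mk_eq_zero P).2 (h a b c)
  exact (Submodule.Quotient.mk_eq_zero P).1 (LinearMap.congr_fun this z)

theorem revEquiv_revEquiv (z : Three K A) : revEquiv (revEquiv z) = z :=
  LinearMap.congr_fun (three_ext (F := revEquiv.toLinearMap ∘ₗ revEquiv.toLinearMap)
    (G := LinearMap.id) fun _ _ _ => rfl) z

theorem revEquiv_symm_apply (z : Three K A) : revEquiv.symm z = revEquiv z := by
  rw [LinearEquiv.symm_apply_eq, revEquiv_revEquiv]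

theorem revEquiv_tmul' (x : Two K A) (c : A) : revEquiv (x ⊗ₜ[K] c) =
    (TensorProduct.assoc K A A A).symm (c ⊗ₜ TensorProduct.comm K A A x) := by
  induction x using TensorProduct.induction_on with
  | zero => simp
  | add x y hx hy => rw [TensorProduct.add_tmul, map_add, hx, hy, map_add, TensorProduct.tmul_add,
      map_add]
  | tmul a b => rfl

theorem three_mul_ext {F : Three K A ≃ₗ[K] Three K A}
    (h : ∀ a b c a' b' c', F (((a ⊗ₜ b) ⊗ₜ c) * ((a' ⊗ₜ b') ⊗ₜ c')) =
      F ((a ⊗ₜ b) ⊗ₜ c) * F ((a' ⊗ₜ b') ⊗ₜ c')) (x y : Three K A) : F (x * y) = F x * F y := by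
  have h1 : (LinearMap.mul K (Three K A)).compr₂ F.toLinearMap =
      (LinearMap.mul K (Three K A)).compl₁₂ F.toLinearMap F.toLinearMap :=
    three_ext fun a b c => three_ext fun a' b' c' => h a b c a' b' c'
  exact LinearMap.congr_fun (LinearMap.congr_fun h1 x) y

theorem revEquiv_mul (x y : Three K A) : revEquiv (x * y) = revEquiv x * revEquiv y :=
  three_mul_ext (fun a b c a' b' c' => by simp [Algebra.TensorProduct.tmul_mul_tmul]) x y

/-- The reversal of the three legs of a multiplier of `A ⊗ A ⊗ A`. -/
def rev : Multiplier K (Three K A) →ₐ[K] Multiplier K (Three K A) :=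
  congr revEquiv revEquiv_mul

theorem rev_left (X : Multiplier K (Three K A)) (z : Three K A) :
    (rev X).left z = revEquiv (X.left (revEquiv z)) :=
  congrArg (fun t => revEquiv (X.left t)) (revEquiv_symm_apply z)

theorem rev_right (X : Multiplier K (Three K A)) (z : Three K A) :
    (rev X).right z = revEquiv (X.right (revEquiv z)) :=
  congrArg (fun t => revEquiv (X.right t)) (revEquiv_symm_apply z)

theorem rev_rev (X : Multiplier K (Three K A)) : rev (rev X) = X :=
  Multiplier.ext' (fun z => by simp only [rev_left, revEquiv_revEquiv])
    (fun z => by simp only [rev_right, revEquiv_revEquiv])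

theorem rev_tensorMul (X : Multiplier K (Two K A)) (m : Multiplier K A) :
    rev (tensorMul K (Two K A) A X m) = reassoc (tensorMul K A (Two K A) m (flip X)) := by
  refine Multiplier.ext' (fun x => ?_) (fun x => ?_)
  · refine LinearMap.congr_fun (three_ext (F := (rev (tensorMul K (Two K A) A X m)).left)
      (G := (reassoc (tensorMul K A (Two K A) m (flip X))).left) fun a b c => ?_) x
    rw [rev_left, reassoc_left, revEquiv_tmul, tensorMul_left, TensorProduct.map_tmul,
      revEquiv_tmul']
    simp
  · refine LinearMap.congr_fun (three_ext (F := (rev (tensorMul K (Two K A) A X m)).right)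
      (G := (reassoc (tensorMul K A (Two K A) m (flip X))).right) fun a b c => ?_) x
    rw [rev_right, reassoc_right, revEquiv_tmul, tensorMul_right, TensorProduct.map_tmul,
      revEquiv_tmul']
    simp

theorem rev_leg12 (X : Multiplier K (Two K A)) : rev (leg12 X) = leg23 (flip X) :=
  rev_tensorMul X 1

theorem rev_leg23 (X : Multiplier K (Two K A)) : rev (leg23 X) = leg12 (flip X) := by
  rw [← flip_flip X, ← rev_leg12, rev_rev, flip_flip]

end Legs

/-! ### The extended homomorphisms `Δ ⊗ ι` and `ι ⊗ Δ` -/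

section Comul

variable {K : Type u} [Field K]
variable {A : Type v} [NonUnitalRing A] [Module K A] [SMulCommClass K A A] [IsScalarTower K A A]
variable {Δ : A →ₙₐ[K] Multiplier K (Two K A)}

@[simp] theorem comulLeft_tmul (a b : A) :
    comulLeft Δ (a ⊗ₜ b) = tensorMul K (Two K A) A (Δ a) (incl K A b) := rfl

@[simp] theorem comulRight_tmul (a b : A) :
    comulRight Δ (a ⊗ₜ b) = reassoc (tensorMul K A (Two K A) (incl K A a) (Δ b)) := rfl

@[simp] theorem cop_apply (a : A) : cop Δ a = flip (Δ a) := rfl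

theorem cop_cop : cop (cop Δ) = Δ := NonUnitalAlgHom.ext fun a => by simp

theorem comulLeft_mul (x y : Two K A) : comulLeft Δ (x * y) = comulLeft Δ x * comulLeft Δ y := by
  induction x using TensorProduct.induction_on with
  | zero => simp
  | add x₁ x₂ h₁ h₂ => simp only [map_add, add_mul, h₁, h₂]
  | tmul a b =>
    induction y using TensorProduct.induction_on with
    | zero => simp
    | add y₁ y₂ h₁ h₂ => simp only [map_add, mul_add, h₁, h₂]
    | tmul c d =>
      rw [Algebra.TensorProduct.tmul_mul_tmul, comulLeft_tmul, comulLeft_tmul, comulLeft_tmul,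
        tensorMul_mul, map_mul Δ, map_mul (incl K A)]

theorem rev_comulLeft_cop (z : Two K A) :
    rev (comulLeft (cop Δ) (TensorProduct.comm K A A z)) = comulRight Δ z := by
  induction z using TensorProduct.induction_on with
  | zero => simp
  | add x₁ x₂ h₁ h₂ => simp only [map_add, h₁, h₂]
  | tmul a b =>
    rw [TensorProduct.comm_tmul, comulLeft_tmul, comulRight_tmul, rev_tensorMul, cop_apply,
      flip_flip]

theorem comulRight_mul (x y : Two K A) :
    comulRight Δ (x * y) = comulRight Δ x * comulRight Δ y := by
  simp only [← rev_comulLeft_cop, comm_mul, comulLeft_mul, map_mul]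

theorem IsMultiplierHopfAlgebra.span_comulLeft_left (h : IsMultiplierHopfAlgebra Δ)
    (hsq : IdempotentMul K A) :
    Submodule.span K {y | ∃ a b, y = (comulLeft Δ a).left b} = ⊤ := by
  obtain ⟨T, hT, hT'⟩ := h.bijective_T₁
  refine (hsq.tensor hsq).tensor hsq _ fun x y => ?_
  obtain ⟨x, rfl⟩ := T.rTensor_surjective A hT.2 x
  refine three_mem _ (LinearMap.mulRight K y ∘ₗ T.rTensor A) (fun a b c => ?_) x
  refine Submodule.subset_span ⟨a ⊗ₜ c, (leg12 (inr b)).left y, ?_⟩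
  change (incl K (Three K A) (T (a ⊗ₜ b) ⊗ₜ c)).left y = _
  rw [← Multiplier.mul_left, incl_tmul, hT', comulLeft_tmul, leg12, tensorMul_mul, mul_one]

theorem IsMultiplierHopfAlgebra.span_comulLeft_right (h : IsMultiplierHopfAlgebra Δ)
    (hsq : IdempotentMul K A) :
    Submodule.span K {y | ∃ a b, y = (comulLeft Δ a).right b} = ⊤ := by
  obtain ⟨T, hT, hT'⟩ := h.bijective_T₂
  refine (hsq.tensor hsq).tensor hsq _ fun y x => ?_
  obtain ⟨x, rfl⟩ := T.rTensor_surjective A hT.2 x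
  refine three_mem _ (LinearMap.mulLeft K y ∘ₗ T.rTensor A) (fun a b c => ?_) x
  refine Submodule.subset_span ⟨b ⊗ₜ c, (leg12 (inl a)).right y, ?_⟩
  change (incl K (Three K A) (T (a ⊗ₜ b) ⊗ₜ c)).right y = _
  rw [← Multiplier.mul_right, incl_tmul, hT', comulLeft_tmul, leg12, tensorMul_mul, one_mul]

theorem IsMultiplierHopfAlgebra.span_comulRight_left (h : IsMultiplierHopfAlgebra Δ)
    (hsq : IdempotentMul K A) :
    Submodule.span K {y | ∃ a b, y = (comulRight Δ a).left b} = ⊤ := by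
  obtain ⟨T, hT, hT'⟩ := h.bijective_T₁
  refine (hsq.tensor hsq).tensor hsq _ fun x y => ?_
  obtain ⟨x, rfl⟩ := (TensorProduct.assoc K A A A).symm.surjective x
  obtain ⟨x, rfl⟩ := T.lTensor_surjective A hT.2 x
  obtain ⟨x, rfl⟩ := (TensorProduct.assoc K A A A).surjective x
  refine three_mem _ (LinearMap.mulRight K y ∘ₗ (TensorProduct.assoc K A A A).symm.toLinearMap ∘ₗ
    T.lTensor A ∘ₗ (TensorProduct.assoc K A A A).toLinearMap) (fun c a b => ?_) x
  refine Submodule.subset_span ⟨c ⊗ₜ a, (leg23 (inr b)).left y, ?_⟩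
  change (incl K (Three K A) ((TensorProduct.assoc K A A A).symm (c ⊗ₜ T (a ⊗ₜ b)))).left y = _
  rw [← Multiplier.mul_left, ← reassoc_incl, incl_tmul, hT', comulRight_tmul, leg23, ← map_mul,
    tensorMul_mul, mul_one]

theorem IsMultiplierHopfAlgebra.span_comulRight_right (h : IsMultiplierHopfAlgebra Δ)
    (hsq : IdempotentMul K A) :
    Submodule.span K {y | ∃ a b, y = (comulRight Δ a).right b} = ⊤ := by
  obtain ⟨T, hT, hT'⟩ := h.bijective_T₂
  refine (hsq.tensor hsq).tensor hsq _ fun y x => ?_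
  obtain ⟨x, rfl⟩ := (TensorProduct.assoc K A A A).symm.surjective x
  obtain ⟨x, rfl⟩ := T.lTensor_surjective A hT.2 x
  obtain ⟨x, rfl⟩ := (TensorProduct.assoc K A A A).surjective x
  refine three_mem _ (LinearMap.mulLeft K y ∘ₗ (TensorProduct.assoc K A A A).symm.toLinearMap ∘ₗ
    T.lTensor A ∘ₗ (TensorProduct.assoc K A A A).toLinearMap) (fun c a b => ?_) x
  refine Submodule.subset_span ⟨c ⊗ₜ b, (leg23 (inl a)).right y, ?_⟩
  change (incl K (Three K A) ((TensorProduct.assoc K A A A).symm (c ⊗ₜ T (a ⊗ₜ b)))).right y = _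
  rw [← Multiplier.mul_right, ← reassoc_incl, incl_tmul, hT', comulRight_tmul, leg23, ← map_mul,
    tensorMul_mul, one_mul]

theorem IsMultiplierHopfAlgebra.nondegenerateHom_comulLeft (h : IsMultiplierHopfAlgebra Δ)
    (hsq : IdempotentMul K A) : NondegenerateHom (comulLeft Δ) :=
  ⟨h.span_comulLeft_left hsq, h.span_comulLeft_right hsq⟩

theorem IsMultiplierHopfAlgebra.nondegenerateHom_comulRight (h : IsMultiplierHopfAlgebra Δ)
    (hsq : IdempotentMul K A) : NondegenerateHom (comulRight Δ) :=
  ⟨h.span_comulRight_left hsq, h.span_comulRight_right hsq⟩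

section Ext

variable (h : IsMultiplierHopfAlgebra Δ) (hsq : IdempotentMul K A)
include h hsq

theorem isExtendedValue_comulLeftExt (X : Multiplier K (Two K A)) :
    IsExtendedValue (comulLeft Δ) X (comulLeftExt Δ X) :=
  (h.nondegenerateHom_comulLeft hsq).isExtendedValue_extend
    ((h.nondegenerate.tensor h.nondegenerate).tensor h.nondegenerate) comulLeft_mul X

theorem isExtendedValue_comulRightExt (X : Multiplier K (Two K A)) :
    IsExtendedValue (comulRight Δ) X (comulRightExt Δ X) :=
  (h.nondegenerateHom_comulRight hsq).isExtendedValue_extend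
    ((h.nondegenerate.tensor h.nondegenerate).tensor h.nondegenerate) comulRight_mul X

theorem comulLeftExt_eq {X : Multiplier K (Two K A)} {Y : Multiplier K (Three K A)}
    (hY : IsExtendedValue (comulLeft Δ) X Y) : comulLeftExt Δ X = Y :=
  extend_eq (h.nondegenerateHom_comulLeft hsq) hY

theorem comulRightExt_eq {X : Multiplier K (Two K A)} {Y : Multiplier K (Three K A)}
    (hY : IsExtendedValue (comulRight Δ) X Y) : comulRightExt Δ X = Y :=
  extend_eq (h.nondegenerateHom_comulRight hsq) hY

theorem comulLeftExt_mul (X Y : Multiplier K (Two K A)) :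
    comulLeftExt Δ (X * Y) = comulLeftExt Δ X * comulLeftExt Δ Y :=
  comulLeftExt_eq h hsq
    ((isExtendedValue_comulLeftExt h hsq X).mul (isExtendedValue_comulLeftExt h hsq Y))

theorem comulRightExt_mul (X Y : Multiplier K (Two K A)) :
    comulRightExt Δ (X * Y) = comulRightExt Δ X * comulRightExt Δ Y :=
  comulRightExt_eq h hsq
    ((isExtendedValue_comulRightExt h hsq X).mul (isExtendedValue_comulRightExt h hsq Y))

theorem comulLeftExt_one : comulLeftExt Δ 1 = 1 := comulLeftExt_eq h hsq .one

theorem comulRightExt_one : comulRightExt Δ 1 = 1 := comulRightExt_eq h hsq .one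

theorem comulLeftExt_incl (x : Two K A) : comulLeftExt Δ (incl K (Two K A) x) = comulLeft Δ x :=
  comulLeftExt_eq h hsq (isExtendedValue_incl comulLeft_mul x)

theorem comulRightExt_incl (x : Two K A) :
    comulRightExt Δ (incl K (Two K A) x) = comulRight Δ x :=
  comulRightExt_eq h hsq (isExtendedValue_incl comulRight_mul x)

theorem comulLeftExt_inr (c : A) : comulLeftExt Δ (inr c) = leg23 (inr c) := by
  refine comulLeftExt_eq h hsq ⟨fun x => ?_, fun x => ?_⟩
  · rw [leg23_inr]
    induction x using TensorProduct.induction_on with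
    | zero => simp
    | add x₁ x₂ h₁ h₂ => simp only [map_add, mul_add, h₁, h₂]
    | tmul a b =>
      rw [comulLeft_tmul, tensorMul_mul, one_mul, ← map_mul]; rfl
  · rw [leg23_inr]
    induction x using TensorProduct.induction_on with
    | zero => simp
    | add x₁ x₂ h₁ h₂ => simp only [map_add, add_mul, h₁, h₂]
    | tmul a b =>
      rw [comulLeft_tmul, tensorMul_mul, mul_one, ← map_mul]; rfl

theorem comulRightExt_inl (a : A) : comulRightExt Δ (inl a) = leg12 (inl a) := by
  refine comulRightExt_eq h hsq ⟨fun x => ?_, fun x => ?_⟩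
  · rw [leg12_inl]
    induction x using TensorProduct.induction_on with
    | zero => simp
    | add x₁ x₂ h₁ h₂ => simp only [map_add, mul_add, h₁, h₂]
    | tmul a b =>
      rw [comulRight_tmul, ← map_mul, tensorMul_mul, one_mul, ← map_mul]; rfl
  · rw [leg12_inl]
    induction x using TensorProduct.induction_on with
    | zero => simp
    | add x₁ x₂ h₁ h₂ => simp only [map_add, add_mul, h₁, h₂]
    | tmul a b =>
      rw [comulRight_tmul, ← map_mul, tensorMul_mul, mul_one, ← map_mul]; rfl

theorem comulRightExt_inr (b : A) : comulRightExt Δ (inr b) = leg23 (Δ b) := by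
  refine comulRightExt_eq h hsq ⟨fun x => ?_, fun x => ?_⟩
  · rw [leg23]
    induction x using TensorProduct.induction_on with
    | zero => simp
    | add x₁ x₂ h₁ h₂ => simp only [map_add, mul_add, h₁, h₂]
    | tmul a b =>
      rw [comulRight_tmul, ← map_mul, tensorMul_mul, one_mul, ← map_mul]; rfl
  · rw [leg23]
    induction x using TensorProduct.induction_on with
    | zero => simp
    | add x₁ x₂ h₁ h₂ => simp only [map_add, add_mul, h₁, h₂]
    | tmul a b =>
      rw [comulRight_tmul, ← map_mul, tensorMul_mul, mul_one, ← map_mul]; rfl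

theorem rev_comulLeftExt_cop (hc : IsMultiplierHopfAlgebra (cop Δ)) (X : Multiplier K (Two K A)) :
    rev (comulLeftExt (cop Δ) (flip X)) = comulRightExt Δ X := by
  have hX := isExtendedValue_comulLeftExt hc hsq (flip X)
  refine (comulRightExt_eq h hsq ⟨fun x => ?_, fun x => ?_⟩).symm
  · rw [← rev_comulLeft_cop, ← map_mul, hX.1, ← rev_comulLeft_cop, flip_left,
      TensorProduct.comm_comm]
  · rw [← rev_comulLeft_cop, ← map_mul, hX.2, ← rev_comulLeft_cop, flip_right,
      TensorProduct.comm_comm]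

theorem eq_of_leg12_inl_mul_mul_leg23_inr {X Y : Multiplier K (Three K A)}
    (hXY : ∀ a c : A, leg12 (inl a) * X * leg23 (inr c) = leg12 (inl a) * Y * leg23 (inr c)) :
    X = Y := by
  have hA := h.nondegenerate
  have h3 := (hA.tensor (K := K) hA).tensor (K := K) hA
  have key : ∀ w : Three K A, (∀ a : A, (leg12 (inl (K := K) a)).left w = 0) → w = 0 := by
    intro w hw
    refine h3.2 w fun z => ?_
    induction z using TensorProduct.induction_on with
    | zero => simp
    | add x₁ x₂ h₁ h₂ => rw [add_mul, h₁, h₂, add_zero]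
    | tmul z c =>
      induction z using TensorProduct.induction_on with
      | zero => simp
      | add x₁ x₂ h₁ h₂ => rw [TensorProduct.add_tmul, add_mul, h₁, h₂, add_zero]
      | tmul a b =>
        have h1 : incl K (Three K A) ((a ⊗ₜ b) ⊗ₜ c) =
            leg23 (inr c) * leg12 (inr b) * leg12 (inl a) := by
          rw [incl_three_tmul, leg12_leg23_inr_comm, mul_assoc, ← leg12_mul, incl_two_tmul,
            inl_inr_comm]
        rw [← incl_left (K := K), h1, Multiplier.mul_left, hw, map_zero]
  have key2 : ∀ w : Three K A, (∀ c : A, (leg23 (inr (K := K) c)).right w = 0) → w = 0 := by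
    intro w hw
    refine h3.1 w fun z => ?_
    induction z using TensorProduct.induction_on with
    | zero => simp
    | add x₁ x₂ h₁ h₂ => rw [mul_add, h₁, h₂, add_zero]
    | tmul z c =>
      rw [← incl_right (K := K), incl_three_tmul, leg12_leg23_inr_comm, Multiplier.mul_right, hw,
        map_zero]
  have h4 : ∀ a : A, leg12 (inl (K := K) a) * X = leg12 (inl a) * Y := by
    intro a
    have h5 : ∀ w, (leg12 (inl (K := K) a) * X).right w = (leg12 (inl a) * Y).right w := by
      intro w
      refine sub_eq_zero.1 (key2 _ fun c => ?_)
      rw [map_sub, ← Multiplier.mul_right, ← Multiplier.mul_right, hXY, sub_self]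
    refine Multiplier.ext_left h3 fun w => sub_eq_zero.1 (h3.2 _ fun z => ?_)
    rw [mul_sub, ← Multiplier.central, ← Multiplier.central, h5, sub_self]
  refine Multiplier.ext_left h3 fun w => sub_eq_zero.1 (key _ fun a => ?_)
  rw [map_sub, ← Multiplier.mul_left, ← Multiplier.mul_left, h4, sub_self]

/-- Coassociativity as an identity of multipliers. -/
theorem comulLeftExt_comul (b : A) : comulLeftExt Δ (Δ b) = comulRightExt Δ (Δ b) := by
  refine eq_of_leg12_inl_mul_mul_leg23_inr h hsq fun a c => ?_
  obtain ⟨x, hx⟩ := h.comul.mul_inr_mem b c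
  obtain ⟨y, hy⟩ := h.comul.inl_mul_mem a b
  have := h.comul.coassoc a b c x y hx hy
  rwa [← comulLeftExt_incl h hsq, ← comulRightExt_incl h hsq, hx, hy, comulLeftExt_mul h hsq,
    comulRightExt_mul h hsq, comulLeftExt_inr h hsq, comulRightExt_inl h hsq, ← mul_assoc] at this

end Ext

end Comul

/-! ### Counits and slices -/

section Slices

variable {K : Type u} [Field K]
variable {A : Type v} [NonUnitalRing A] [Module K A] [SMulCommClass K A A] [IsScalarTower K A A]

theorem two_mem {V : Type*} [AddCommGroup V] [Module K V] (P : Submodule K V)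
    (F : Two K A →ₗ[K] V) (h : ∀ a b, F (a ⊗ₜ b) ∈ P) (z : Two K A) : F z ∈ P := by
  induction z using TensorProduct.induction_on with
  | zero => simp
  | add x y hx hy => rw [map_add]; exact add_mem hx hy
  | tmul a b => exact h a b

@[simp] theorem sliceLeft_tmul (ε : A →ₙₐ[K] K) (a b : A) :
    sliceLeft ε (a ⊗ₜ b) = ε a • b := rfl

@[simp] theorem sliceRight_tmul (ε : A →ₙₐ[K] K) (a b : A) :
    sliceRight ε (a ⊗ₜ b) = ε b • a := rfl

theorem sliceLeft_comm (ε : A →ₙₐ[K] K) (x : Two K A) :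
    sliceLeft ε (TensorProduct.comm K A A x) = sliceRight ε x :=
  LinearMap.congr_fun (TensorProduct.ext' (g := sliceLeft ε ∘ₗ (TensorProduct.comm K A A).toLinearMap)
    (h := sliceRight ε) fun _ _ => rfl) x

theorem sliceRight_comm (ε : A →ₙₐ[K] K) (x : Two K A) :
    sliceRight ε (TensorProduct.comm K A A x) = sliceLeft ε x := by
  rw [← sliceLeft_comm, TensorProduct.comm_comm]

theorem sliceLeft_mul (ε : A →ₙₐ[K] K) (x y : Two K A) :
    sliceLeft ε (x * y) = sliceLeft ε x * sliceLeft ε y := by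
  induction x using TensorProduct.induction_on with
  | zero => simp
  | add x₁ x₂ h₁ h₂ => simp only [map_add, add_mul, h₁, h₂]
  | tmul a b =>
    induction y using TensorProduct.induction_on with
    | zero => simp
    | add y₁ y₂ h₁ h₂ => simp only [map_add, mul_add, h₁, h₂]
    | tmul c d =>
      rw [Algebra.TensorProduct.tmul_mul_tmul, sliceLeft_tmul, sliceLeft_tmul, sliceLeft_tmul,
        map_mul, smul_mul_smul_comm]

theorem sliceRight_mul (ε : A →ₙₐ[K] K) (x y : Two K A) :
    sliceRight ε (x * y) = sliceRight ε x * sliceRight ε y := by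
  rw [← sliceLeft_comm, comm_mul, sliceLeft_mul, sliceLeft_comm, sliceLeft_comm]

theorem sliceRight_inl_left (ε : A →ₙₐ[K] K) (a : A) (x : Two K A) :
    sliceRight ε ((inl (K := K) a).left x) = a * sliceRight ε x :=
  LinearMap.congr_fun (TensorProduct.ext' (g := sliceRight ε ∘ₗ (inl (K := K) a).left)
    (h := LinearMap.mulLeft K a ∘ₗ sliceRight ε) fun x y => by simp [inl]) x

theorem sliceLeft_inr_left (ε : A →ₙₐ[K] K) (a : A) (x : Two K A) :
    sliceLeft ε ((inr (K := K) a).left x) = a * sliceLeft ε x :=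
  LinearMap.congr_fun (TensorProduct.ext' (g := sliceLeft ε ∘ₗ (inr (K := K) a).left)
    (h := LinearMap.mulLeft K a ∘ₗ sliceLeft ε) fun x y => by simp [inr]) x

theorem sliceLeft_inl_left (ε : A →ₙₐ[K] K) (a : A) (x : Two K A) :
    sliceLeft ε ((inl (K := K) a).left x) = ε a • sliceLeft ε x :=
  LinearMap.congr_fun (TensorProduct.ext' (g := sliceLeft ε ∘ₗ (inl (K := K) a).left)
    (h := ε a • sliceLeft ε) fun x y => by simp [inl, mul_smul]) x

theorem sliceLeft_inr_right (ε : A →ₙₐ[K] K) (a : A) (x : Two K A) :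
    sliceLeft ε ((inr (K := K) a).right x) = sliceLeft ε x * a :=
  LinearMap.congr_fun (TensorProduct.ext' (g := sliceLeft ε ∘ₗ (inr (K := K) a).right)
    (h := LinearMap.mulRight K a ∘ₗ sliceLeft ε) fun x y => by simp [inr]) x

theorem sliceRight_inr_left (ε : A →ₙₐ[K] K) (a : A) (x : Two K A) :
    sliceRight ε ((inr (K := K) a).left x) = ε a • sliceRight ε x :=
  LinearMap.congr_fun (TensorProduct.ext' (g := sliceRight ε ∘ₗ (inr (K := K) a).left)
    (h := ε a • sliceRight ε) fun x y => by simp [inr, mul_smul]) x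

theorem sliceRight_surjective {ε : A →ₙₐ[K] K} (hε : ∃ e, ε e = 1) (a : A) :
    ∃ x, sliceRight ε x = a := by
  obtain ⟨e, he⟩ := hε
  exact ⟨a ⊗ₜ e, by rw [sliceRight_tmul, he, one_smul]⟩

theorem sliceLeft_surjective {ε : A →ₙₐ[K] K} (hε : ∃ e, ε e = 1) (a : A) :
    ∃ x, sliceLeft ε x = a := by
  obtain ⟨e, he⟩ := hε
  exact ⟨e ⊗ₜ a, by rw [sliceLeft_tmul, he, one_smul]⟩

variable {Δ : A →ₙₐ[K] Multiplier K (Two K A)} {ε : A →ₙₐ[K] K}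

theorem IsCounit.idempotentMul (h : IsMultiplierHopfAlgebra Δ) (hε : IsCounit Δ ε)
    (he : ∃ e, ε e = 1) : IdempotentMul K A := by
  intro P hP
  refine eq_top_iff.2 fun z _ => ?_
  obtain ⟨T, hT, hT'⟩ := h.bijective_T₁
  obtain ⟨x, rfl⟩ := sliceLeft_surjective he z
  obtain ⟨s, rfl⟩ := hT.2 x
  refine two_mem P (sliceLeft ε ∘ₗ T) (fun a b => ?_) s
  rw [LinearMap.comp_apply, hε.slice_left a b _ (hT' a b)]
  exact hP a b

theorem IsCounit.sliceRight_comul (h : IsMultiplierHopfAlgebra Δ) (hε : IsCounit Δ ε)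
    (a : A) (x : Two K A) : sliceRight ε ((Δ a).left x) = a * sliceRight ε x := by
  refine sub_eq_zero.1 (h.nondegenerate.2 _ fun e => ?_)
  obtain ⟨y, hy⟩ := h.comul.inl_mul_mem e a
  rw [mul_sub, ← sliceRight_inl_left, ← Multiplier.mul_left, ← hy, incl_left, sliceRight_mul,
    hε.slice_right e a y hy, mul_assoc, sub_self]

theorem IsCounit.sliceLeft_comul (h : IsMultiplierHopfAlgebra Δ) (hε : IsCounit Δ ε)
    (he : ∃ e, ε e = 1) (a : A) (x : Two K A) :
    sliceLeft ε ((Δ a).left x) = a * sliceLeft ε x := by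
  have hsq := hε.idempotentMul h he
  let F : Two K A →ₗ[K] A := sliceLeft ε ∘ₗ (Δ a).left - LinearMap.mulLeft K a ∘ₗ sliceLeft ε
  have hF : LinearMap.ker F = ⊤ := by
    refine hsq.tensor hsq _ fun x y => ?_
    refine two_mem _ (LinearMap.mulRight K y) (fun e b => ?_) x
    rw [LinearMap.mem_ker]
    change sliceLeft ε ((Δ a).left ((e ⊗ₜ b) * y)) - a * sliceLeft ε ((e ⊗ₜ b) * y) = 0
    obtain ⟨t, ht⟩ := h.comul.mul_inr_mem a b
    rw [← incl_left (K := K) (e ⊗ₜ[K] b : Two K A) y, incl_two_tmul, inl_inr_comm,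
      Multiplier.mul_left, ← Multiplier.mul_left (Δ a), ← ht, incl_left, sliceLeft_mul,
      hε.slice_left a b t ht, sliceLeft_inr_left, mul_assoc, sub_self]
  have hx : x ∈ LinearMap.ker F := hF ▸ Submodule.mem_top
  exact sub_eq_zero.1 hx

theorem IsCounit.cop (h : IsMultiplierHopfAlgebra Δ) (hε : IsCounit Δ ε)
    (he : ∃ e, ε e = 1) : IsCounit (cop Δ) ε := by
  constructor
  · intro a b x hx
    have hx' : incl K (Two K A) (TensorProduct.comm K A A x) = Δ a * inl b := by
      rw [← flip_incl, hx, map_mul, cop_apply, flip_flip, flip_inr]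
    refine sub_eq_zero.1 (h.nondegenerate.1 _ fun e => ?_)
    obtain ⟨y, rfl⟩ := sliceRight_surjective he e
    rw [sub_mul, ← sliceRight_comm, ← sliceRight_mul, ← incl_left (K := K), hx',
      Multiplier.mul_left, hε.sliceRight_comul h, sliceRight_inl_left, mul_assoc, sub_self]
  · intro a b x hx
    have hx' : incl K (Two K A) (TensorProduct.comm K A A x) = inr a * Δ b := by
      rw [← flip_incl, hx, map_mul, cop_apply, flip_flip, flip_inl]
    refine sub_eq_zero.1 (h.nondegenerate.1 _ fun e => ?_)
    obtain ⟨y, rfl⟩ := sliceLeft_surjective he e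
    rw [sub_mul, ← sliceLeft_comm, ← sliceLeft_mul, ← incl_left (K := K), hx',
      Multiplier.mul_left, sliceLeft_inr_left, hε.sliceLeft_comul h he, mul_assoc, sub_self]

/-- The counit is unique. -/
theorem IsCounit.unique (h : IsMultiplierHopfAlgebra Δ) {ε' : A →ₙₐ[K] K} (hε : IsCounit Δ ε)
    (hε' : IsCounit Δ ε') : ε = ε' := by
  obtain ⟨T, hT, hT'⟩ := h.bijective_T₁
  have h1 : ∀ x, sliceLeft ε x = sliceLeft ε' x := by
    intro x
    obtain ⟨s, rfl⟩ := hT.2 x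
    refine LinearMap.congr_fun (TensorProduct.ext' (g := sliceLeft ε ∘ₗ T)
      (h := sliceLeft ε' ∘ₗ T) fun a b => ?_) s
    exact (hε.slice_left a b _ (hT' a b)).trans (hε'.slice_left a b _ (hT' a b)).symm
  refine NonUnitalAlgHom.ext fun a => ?_
  by_cases hA : ∃ b : A, b ≠ 0
  · obtain ⟨b, hb⟩ := hA
    have h2 := h1 (a ⊗ₜ b)
    rw [sliceLeft_tmul, sliceLeft_tmul] at h2
    exact smul_left_injective K hb h2
  · push Not at hA
    rw [hA a, map_zero, map_zero]

theorem IsCounit.counit_eq (h : IsMultiplierHopfAlgebra Δ) (hε : IsCounit Δ ε) :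
    counit Δ = ε := by
  have hex : ∃ ε, IsCounit Δ ε := ⟨ε, hε⟩
  unfold counit
  rw [dif_pos hex]
  exact hex.choose_spec.unique h hε

end Slices

/-! ### The Galois maps of a regular multiplier Hopf algebra -/

section Data

variable {K : Type u} [Field K]
variable {A : Type v} [NonUnitalRing A] [Module K A] [SMulCommClass K A A] [IsScalarTower K A A]

/-- A regular multiplier Hopf algebra together with its counit `ε ≠ 0` and its four Galois maps
`a ⊗ b ↦ Δ(a)(1 ⊗ b)`, `Δ(a)(b ⊗ 1)`, `(a ⊗ 1)Δ(b)`, `(1 ⊗ a)Δ(b)`. -/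
structure HopfData (Δ : A →ₙₐ[K] Multiplier K (Two K A)) (ε : A →ₙₐ[K] K) where
  hopf : IsMultiplierHopfAlgebra Δ
  hopf_cop : IsMultiplierHopfAlgebra (cop Δ)
  counit : IsCounit Δ ε
  exists_one : ∃ e, ε e = 1
  /-- `a ⊗ b ↦ Δ(a)(1 ⊗ b)` -/
  T : Two K A ≃ₗ[K] Two K A
  /-- `a ⊗ b ↦ Δ(a)(b ⊗ 1)` -/
  T' : Two K A ≃ₗ[K] Two K A
  /-- `a ⊗ b ↦ (a ⊗ 1)Δ(b)` -/
  T₂ : Two K A ≃ₗ[K] Two K A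
  /-- `a ⊗ b ↦ (1 ⊗ a)Δ(b)` -/
  T₂' : Two K A ≃ₗ[K] Two K A
  T_spec : ∀ a b, incl K (Two K A) (T (a ⊗ₜ b)) = Δ a * inr b
  T'_spec : ∀ a b, incl K (Two K A) (T' (a ⊗ₜ b)) = Δ a * inl b
  T₂_spec : ∀ a b, incl K (Two K A) (T₂ (a ⊗ₜ b)) = inl a * Δ b
  T₂'_spec : ∀ a b, incl K (Two K A) (T₂' (a ⊗ₜ b)) = inr a * Δ b

theorem IsRegularMultiplierHopfAlgebra.exists_hopfData {Δ : A →ₙₐ[K] Multiplier K (Two K A)}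
    {ε : A →ₙₐ[K] K} (h : IsRegularMultiplierHopfAlgebra Δ) (hε : IsCounit Δ ε)
    (he : ∃ e, ε e = 1) : Nonempty (HopfData Δ ε) := by
  obtain ⟨T, hT, hT'⟩ := h.hopf.bijective_T₁
  obtain ⟨T₂, hT₂, hT₂'⟩ := h.hopf.bijective_T₂
  obtain ⟨U, hU, hU'⟩ := h.hopf_cop.bijective_T₁
  obtain ⟨U₂, hU₂, hU₂'⟩ := h.hopf_cop.bijective_T₂
  refine ⟨⟨h.hopf, h.hopf_cop, hε, he, .ofBijective T hT,
    (LinearEquiv.ofBijective U hU).trans (TensorProduct.comm K A A), .ofBijective T₂ hT₂,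
    (LinearEquiv.ofBijective U₂ hU₂).trans (TensorProduct.comm K A A), hT', fun a b => ?_, hT₂',
    fun a b => ?_⟩⟩
  · change incl K (Two K A) (TensorProduct.comm K A A (U (a ⊗ₜ b))) = _
    rw [← flip_incl, hU', map_mul, cop_apply, flip_flip, flip_inr]
  · change incl K (Two K A) (TensorProduct.comm K A A (U₂ (a ⊗ₜ b))) = _
    rw [← flip_incl, hU₂', map_mul, cop_apply, flip_flip, flip_inl]

namespace HopfData

variable {Δ : A →ₙₐ[K] Multiplier K (Two K A)} {ε : A →ₙₐ[K] K}

/-- The co-opposite regular multiplier Hopf algebra. -/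
def cop (d : HopfData Δ ε) : HopfData (MultiplierHopf.cop Δ) ε where
  hopf := d.hopf_cop
  hopf_cop := by rw [cop_cop]; exact d.hopf
  counit := d.counit.cop d.hopf d.exists_one
  exists_one := d.exists_one
  T := d.T'.trans (TensorProduct.comm K A A)
  T' := d.T.trans (TensorProduct.comm K A A)
  T₂ := d.T₂'.trans (TensorProduct.comm K A A)
  T₂' := d.T₂.trans (TensorProduct.comm K A A)
  T_spec a b := by
    rw [LinearEquiv.trans_apply, ← flip_incl, d.T'_spec, map_mul, flip_inl]; rfl
  T'_spec a b := by
    rw [LinearEquiv.trans_apply, ← flip_incl, d.T_spec, map_mul, flip_inr]; rfl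
  T₂_spec a b := by
    rw [LinearEquiv.trans_apply, ← flip_incl, d.T₂'_spec, map_mul, flip_inr]; rfl
  T₂'_spec a b := by
    rw [LinearEquiv.trans_apply, ← flip_incl, d.T₂_spec, map_mul, flip_inl]; rfl

variable (d : HopfData Δ ε)

theorem nd (d : HopfData Δ ε) : NondegenerateMul A := d.hopf.nondegenerate

theorem nd₂ (d : HopfData Δ ε) : NondegenerateMul (Two K A) := d.nd.tensor d.nd

theorem nd₃ (d : HopfData Δ ε) : NondegenerateMul (Three K A) := d.nd₂.tensor d.nd

theorem sq (d : HopfData Δ ε) : IdempotentMul K A := d.counit.idempotentMul d.hopf d.exists_one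

theorem T_inl_left (p : A) (x : Two K A) : d.T ((inl (K := K) p).left x) = (Δ p).left (d.T x) := by
  refine LinearMap.congr_fun (TensorProduct.ext' (g := d.T.toLinearMap ∘ₗ (inl (K := K) p).left)
    (h := (Δ p).left ∘ₗ d.T.toLinearMap) fun a b => incl_injective (K := K) d.nd₂ ?_) x
  change incl K (Two K A) (d.T ((p * a) ⊗ₜ b)) = incl K (Two K A) ((Δ p).left (d.T (a ⊗ₜ b)))
  rw [← mul_incl d.nd₂, d.T_spec, d.T_spec, map_mul, mul_assoc]

theorem inr_mul (a b : A) : inr (K := K) (a * b) = inr a * inr b := by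
  rw [inr, inr, inr, tensorMul_mul, one_mul, map_mul (incl K A)]

theorem T_inr_right (r : A) (x : Two K A) :
    d.T ((inr (K := K) r).right x) = (inr (K := K) r).right (d.T x) := by
  refine LinearMap.congr_fun (TensorProduct.ext' (g := d.T.toLinearMap ∘ₗ (inr (K := K) r).right)
    (h := (inr (K := K) r).right ∘ₗ d.T.toLinearMap) fun a b => incl_injective (K := K) d.nd₂ ?_) x
  change incl K (Two K A) (d.T (a ⊗ₜ (b * r))) =
    incl K (Two K A) ((inr (K := K) r).right (d.T (a ⊗ₜ b)))
  rw [← incl_mul d.nd₂, d.T_spec, d.T_spec, inr_mul, mul_assoc]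

/-- `x ↦ (ε ⊗ ι)(T⁻¹(x))`, which is `a ⊗ b ↦ S(a) b` for the antipode `S`. -/
def antipodeMul : Two K A →ₗ[K] A := sliceLeft ε ∘ₗ d.T.symm.toLinearMap

theorem antipodeMul_T (x : Two K A) : d.antipodeMul (d.T x) = sliceLeft ε x := by
  rw [antipodeMul, LinearMap.comp_apply, LinearEquiv.coe_coe, LinearEquiv.symm_apply_apply]

theorem cop_antipodeMul_comm_T' (x : Two K A) :
    d.cop.antipodeMul (TensorProduct.comm K A A (d.T' x)) = sliceLeft ε x :=
  d.cop.antipodeMul_T x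

theorem cop_cop_antipodeMul (x : Two K A) : d.cop.cop.antipodeMul x = d.antipodeMul x := by
  obtain ⟨y, rfl⟩ := d.T.surjective x
  rw [antipodeMul_T]
  have := d.cop.cop.antipodeMul_T y
  rwa [show d.cop.cop.T y = d.T y from TensorProduct.comm_comm K _ _ _] at this

theorem antipodeMul_comul (p : A) (x : Two K A) :
    d.antipodeMul ((Δ p).left x) = ε p • d.antipodeMul x := by
  obtain ⟨y, rfl⟩ := d.T.surjective x
  rw [← T_inl_left, antipodeMul_T, antipodeMul_T, sliceLeft_inl_left]

theorem antipodeMul_inr_right (r : A) (x : Two K A) :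
    d.antipodeMul ((inr (K := K) r).right x) = d.antipodeMul x * r := by
  obtain ⟨y, rfl⟩ := d.T.surjective x
  rw [← T_inr_right, antipodeMul_T, antipodeMul_T, sliceLeft_inr_right]

theorem antipodeMul_surjective : Function.Surjective d.antipodeMul := fun a => by
  obtain ⟨x, hx⟩ := sliceLeft_surjective d.exists_one a
  exact ⟨d.T x, by rw [antipodeMul_T, hx]⟩

/-- `T` on the last two factors of `A ⊗ A ⊗ A`. -/
def T₂₃ : Three K A ≃ₗ[K] Three K A :=
  (TensorProduct.assoc K A A A).trans
    ((TensorProduct.congr (LinearEquiv.refl K A) d.T).trans (TensorProduct.assoc K A A A).symm)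

theorem T₂₃_tmul (a b c : A) : d.T₂₃ ((a ⊗ₜ b) ⊗ₜ c) =
    (TensorProduct.assoc K A A A).symm (a ⊗ₜ d.T (b ⊗ₜ c)) := rfl

theorem incl_T₂₃ (z : Two K A) (c : A) :
    incl K (Three K A) (d.T₂₃ (z ⊗ₜ c)) = comulRight Δ z * leg23 (inr c) := by
  induction z using TensorProduct.induction_on with
  | zero => simp
  | add x y hx hy => rw [TensorProduct.add_tmul, map_add, map_add, hx, hy, map_add, add_mul]
  | tmul a b =>
    rw [T₂₃_tmul, incl_three_tmul', d.T_spec, leg23_mul, ← mul_assoc, comulRight_tmul, leg12_inl,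
      leg23, ← map_mul, tensorMul_mul, one_mul, mul_one]

theorem incl_rTensor_T_rightComm (z : Two K A) (b : A) :
    incl K (Three K A) (d.T.toLinearMap.rTensor A (TensorProduct.rightComm K A A A (z ⊗ₜ b))) =
      comulLeft Δ z * leg12 (inr b) := by
  induction z using TensorProduct.induction_on with
  | zero => simp
  | add x y hx hy =>
    rw [TensorProduct.add_tmul, map_add, map_add, map_add, hx, hy, map_add, add_mul]
  | tmul a c =>
    rw [TensorProduct.rightComm_tmul, LinearMap.rTensor_tmul, LinearEquiv.coe_coe,
      incl_three_tmul, d.T_spec, leg12_mul, mul_assoc, leg12_leg23_inr_comm, ← mul_assoc,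
      comulLeft_tmul, leg23_inr, leg12, tensorMul_mul, one_mul, mul_one]

theorem leg13_left_rightComm (X : Multiplier K (Two K A)) (z : Two K A) (b : A) :
    (leg13 X).left (TensorProduct.rightComm K A A A (z ⊗ₜ b)) =
      TensorProduct.rightComm K A A A (X.left z ⊗ₜ b) := by
  change TensorProduct.rightComm K A A A ((leg12 X).left ((TensorProduct.rightComm K A A A).symm
    (TensorProduct.rightComm K A A A (z ⊗ₜ b)))) = _
  rw [LinearEquiv.symm_apply_apply]
  rfl

/-- `(Δ ⊗ ι)(X)` is conjugate to `X¹³` under `T ⊗ ι`. -/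
theorem comulLeftExt_left_rTensor_T (X : Multiplier K (Two K A)) (z : Three K A) :
    (comulLeftExt Δ X).left (d.T.toLinearMap.rTensor A z) =
      d.T.toLinearMap.rTensor A ((leg13 X).left z) := by
  refine LinearMap.congr_fun (three_ext (F := (comulLeftExt Δ X).left ∘ₗ d.T.toLinearMap.rTensor A)
    (G := d.T.toLinearMap.rTensor A ∘ₗ (leg13 X).left) fun a b c =>
    incl_injective (K := K) d.nd₃ ?_) z
  rw [LinearMap.comp_apply, LinearMap.comp_apply, ← TensorProduct.rightComm_tmul,
    leg13_left_rightComm, ← mul_incl d.nd₃, incl_rTensor_T_rightComm, incl_rTensor_T_rightComm,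
    ← mul_assoc, (isExtendedValue_comulLeftExt d.hopf d.sq X).1]

theorem rTensor_sliceLeft_rightComm (z : Two K A) (b : A) :
    (sliceLeft ε).rTensor A (TensorProduct.rightComm K A A A (z ⊗ₜ b)) =
      b ⊗ₜ sliceLeft ε z := by
  induction z using TensorProduct.induction_on with
  | zero => simp
  | add x y hx hy =>
    rw [TensorProduct.add_tmul, map_add, map_add, hx, hy, map_add, TensorProduct.tmul_add]
  | tmul a c => simp [TensorProduct.smul_tmul]

/-- If `(ε ⊗ ι)(X) = n`, then applying `S(·)·` to the first two legs turns `(Δ ⊗ ι)(X)`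
into `1 ⊗ n`. -/
theorem rTensor_antipodeMul_comulLeftExt {X : Multiplier K (Two K A)} {n : A →ₗ[K] A}
    (hn : ∀ x, sliceLeft ε (X.left x) = n (sliceLeft ε x)) (w : Three K A) :
    d.antipodeMul.rTensor A ((comulLeftExt Δ X).left w) =
      n.lTensor A (d.antipodeMul.rTensor A w) := by
  have hT : d.antipodeMul.rTensor A ∘ₗ d.T.toLinearMap.rTensor A = (sliceLeft ε).rTensor A := by
    rw [← LinearMap.rTensor_comp]
    exact congrArg _ (LinearMap.ext d.antipodeMul_T)
  have hT' : ∀ z, d.antipodeMul.rTensor A (d.T.toLinearMap.rTensor A z) =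
    (sliceLeft ε).rTensor A z := LinearMap.congr_fun hT
  obtain ⟨z, rfl⟩ := d.T.toLinearMap.rTensor_surjective A d.T.surjective w
  rw [comulLeftExt_left_rTensor_T, hT', hT']
  refine LinearMap.congr_fun (three_ext (F := (sliceLeft ε).rTensor A ∘ₗ (leg13 X).left)
    (G := n.lTensor A ∘ₗ (sliceLeft ε).rTensor A) fun a b c => ?_) z
  rw [LinearMap.comp_apply, LinearMap.comp_apply, ← TensorProduct.rightComm_tmul,
    leg13_left_rightComm, rTensor_sliceLeft_rightComm, rTensor_sliceLeft_rightComm, hn,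
    LinearMap.lTensor_tmul]

end HopfData

end Data

/-! ### Normalized cocycles and the antipode -/

section Antipode

variable {K : Type u} [Field K]
variable {A : Type v} [NonUnitalRing A] [Module K A] [SMulCommClass K A A] [IsScalarTower K A A]

/-- A normalized 2-cocycle: an invertible `J` with `(Δ ⊗ ι)(J) J¹² = (ι ⊗ Δ)(J) J²³` and
`(ε ⊗ ι)(J) = 1 = (ι ⊗ ε)(J)`, the normalization being expressed by the action on `A ⊗ A`. -/
structure IsNormalizedCocycle (Δ : A →ₙₐ[K] Multiplier K (Two K A)) (ε : A →ₙₐ[K] K)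
    (J : (Multiplier K (Two K A))ˣ) : Prop where
  cocycle : comulLeftExt Δ J * leg12 J = comulRightExt Δ J * leg23 J
  slice_left : ∀ x, sliceLeft ε ((J : Multiplier K (Two K A)).left x) = sliceLeft ε x
  slice_right : ∀ x, sliceRight ε ((J : Multiplier K (Two K A)).left x) = sliceRight ε x

variable {Δ : A →ₙₐ[K] Multiplier K (Two K A)} {ε : A →ₙₐ[K] K}

theorem sliceLeft_inv {J : (Multiplier K (Two K A))ˣ}
    (h : ∀ x, sliceLeft ε ((J : Multiplier K (Two K A)).left x) = sliceLeft ε x) (x : Two K A) :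
    sliceLeft ε (((J⁻¹ : (Multiplier K (Two K A))ˣ) : Multiplier K (Two K A)).left x) =
      sliceLeft ε x := by
  rw [← h, ← Multiplier.mul_left, Units.mul_inv, Multiplier.one_left]

theorem sliceRight_inv {J : (Multiplier K (Two K A))ˣ}
    (h : ∀ x, sliceRight ε ((J : Multiplier K (Two K A)).left x) = sliceRight ε x) (x : Two K A) :
    sliceRight ε (((J⁻¹ : (Multiplier K (Two K A))ˣ) : Multiplier K (Two K A)).left x) =
      sliceRight ε x := by
  rw [← h, ← Multiplier.mul_left, Units.mul_inv, Multiplier.one_left]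

/-- The flip as an automorphism of the group of invertible multipliers. -/
def flipUnits : (Multiplier K (Two K A))ˣ →* (Multiplier K (Two K A))ˣ :=
  Units.map (flip : Multiplier K (Two K A) →ₐ[K] Multiplier K (Two K A)).toMonoidHom

@[simp] theorem coe_flipUnits (J : (Multiplier K (Two K A))ˣ) :
    (flipUnits J : Multiplier K (Two K A)) = flip J := rfl

namespace HopfData

variable (d : HopfData Δ ε)

theorem isNormalizedCocycle_one (d : HopfData Δ ε) : IsNormalizedCocycle Δ ε 1 where
  cocycle := by
    rw [Units.val_one, comulLeftExt_one d.hopf d.sq, comulRightExt_one d.hopf d.sq, leg12_one,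
      leg23_one]
  slice_left _ := rfl
  slice_right _ := rfl

theorem rev_comulRightExt_cop (d : HopfData Δ ε) (X : Multiplier K (Two K A)) :
    rev (comulRightExt (MultiplierHopf.cop Δ) (flip X)) = comulLeftExt Δ X := by
  have := MultiplierHopf.rev_comulLeftExt_cop d.hopf_cop d.sq
    (by rw [cop_cop]; exact d.hopf) (flip X)
  rw [← this, rev_rev, flip_flip, cop_cop]

theorem rev_comulLeftExt_cop (d : HopfData Δ ε) (X : Multiplier K (Two K A)) :
    rev (comulLeftExt (MultiplierHopf.cop Δ) (flip X)) = comulRightExt Δ X :=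
  MultiplierHopf.rev_comulLeftExt_cop d.hopf d.sq d.hopf_cop X

theorem isNormalizedCocycle_flip (d : HopfData Δ ε) {J : (Multiplier K (Two K A))ˣ}
    (hJ : IsNormalizedCocycle Δ ε J) :
    IsNormalizedCocycle (MultiplierHopf.cop Δ) ε (flipUnits J) where
  cocycle := by
    refine Function.LeftInverse.injective rev_rev ?_
    rw [coe_flipUnits, map_mul, map_mul, d.rev_comulLeftExt_cop, d.rev_comulRightExt_cop, rev_leg12, rev_leg23,
      flip_flip, hJ.cocycle]
  slice_left x := by
    rw [coe_flipUnits, flip_left, sliceLeft_comm, hJ.slice_right, sliceRight_comm]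
  slice_right x := by
    rw [coe_flipUnits, flip_left, sliceRight_comm, hJ.slice_left, sliceLeft_comm]

theorem leg12_mul_leg23_inv (d : HopfData Δ ε) {J : (Multiplier K (Two K A))ˣ}
    (hJ : IsNormalizedCocycle Δ ε J) :
    leg12 (J : Multiplier K (Two K A)) *
        leg23 ((J⁻¹ : (Multiplier K (Two K A))ˣ) : Multiplier K (Two K A)) =
      comulLeftExt Δ ((J⁻¹ : (Multiplier K (Two K A))ˣ) : Multiplier K (Two K A)) *
        comulRightExt Δ J := by
  have h1 : comulLeftExt Δ ((J⁻¹ : (Multiplier K (Two K A))ˣ) : Multiplier K (Two K A)) *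
      comulLeftExt Δ J = 1 := by
    rw [← comulLeftExt_mul d.hopf d.sq, Units.inv_mul, comulLeftExt_one d.hopf d.sq]
  have h2 : leg23 (J : Multiplier K (Two K A)) *
      leg23 ((J⁻¹ : (Multiplier K (Two K A))ˣ) : Multiplier K (Two K A)) = 1 := by
    rw [← leg23_mul, Units.mul_inv, leg23_one]
  calc _ = comulLeftExt Δ ((J⁻¹ : (Multiplier K (Two K A))ˣ) : Multiplier K (Two K A)) *
        (comulLeftExt Δ J * leg12 J) *
        leg23 ((J⁻¹ : (Multiplier K (Two K A))ˣ) : Multiplier K (Two K A)) := by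
        rw [← mul_assoc, h1, one_mul]
    _ = _ := by rw [hJ.cocycle, mul_assoc, mul_assoc, h2, mul_one]

theorem incl_three_tmul_tmul (a b c : A) : incl K (Three K A) ((a ⊗ₜ b) ⊗ₜ c) =
    leg12 (inl a) * (leg12 (inr b) * leg23 (inr c)) := by
  rw [incl_three_tmul, incl_two_tmul, leg12_mul, mul_assoc]

/-- For `s = ∑ x ⊗ y` the element `w` is `∑ x₁ y ⊗ x₂ c ⊗ x₃ e`, and applying `S(·)·` to its first
two legs gives `∑ S(y) c ⊗ x e`. -/
theorem rTensor_antipodeMul_of_incl_eq (s : Two K A) (c e : A) :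
    ∃ w : Three K A,
      incl K (Three K A) w = comulRight Δ (d.T' s) * (leg12 (inr c) * leg23 (inr e)) ∧
      d.antipodeMul.rTensor A w =
        TensorProduct.map (d.antipodeMul ∘ₗ (TensorProduct.mk K A A).flip c)
          (LinearMap.mulRight K e) (TensorProduct.comm K A A s) := by
  induction s using TensorProduct.induction_on with
  | zero => exact ⟨0, by simp, by simp⟩
  | add s t hs ht =>
    obtain ⟨w₁, h₁, h₁'⟩ := hs
    obtain ⟨w₂, h₂, h₂'⟩ := ht
    exact ⟨w₁ + w₂, by simp only [map_add, add_mul, h₁, h₂], by simp only [map_add, h₁', h₂']⟩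
  | tmul x y =>
    refine ⟨(comulLeftExt Δ (Δ x)).left ((y ⊗ₜ c) ⊗ₜ e), ?_, ?_⟩
    · rw [← mul_incl d.nd₃, incl_three_tmul_tmul, comulLeftExt_comul d.hopf d.sq,
        ← comulRightExt_inl d.hopf d.sq, ← mul_assoc, ← comulRightExt_mul d.hopf d.sq,
        ← d.T'_spec, comulRightExt_incl d.hopf d.sq]
    · rw [d.rTensor_antipodeMul_comulLeftExt (n := LinearMap.mulLeft K x)
        (d.counit.sliceLeft_comul d.hopf d.exists_one x)]
      simp

/-- For a normalized cocycle `J` and `∑ Δ(x)(y ⊗ 1) = J(a ⊗ b)`, this says that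
`(S(J₁ a) J₂ ⊗ 1) J⁻¹ Δ(b) = ∑ S(y) ⊗ x`, both sides being applied to `c ⊗ e`. -/
theorem rTensor_antipodeMul_cocycle {J : (Multiplier K (Two K A))ˣ}
    (hJ : IsNormalizedCocycle Δ ε J) (a b c e : A) :
    (d.antipodeMul ∘ₗ (J : Multiplier K (Two K A)).left ∘ₗ TensorProduct.mk K A A a).rTensor A
        (((J⁻¹ : (Multiplier K (Two K A))ˣ) : Multiplier K (Two K A)).left
          ((Δ b).left (c ⊗ₜ e))) =
      TensorProduct.map (d.antipodeMul ∘ₗ (TensorProduct.mk K A A).flip c)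
        (LinearMap.mulRight K e) (TensorProduct.comm K A A
          (d.T'.symm ((J : Multiplier K (Two K A)).left (a ⊗ₜ b)))) := by
  have h1 : ∀ v : Two K A,
      (d.antipodeMul ∘ₗ (J : Multiplier K (Two K A)).left ∘ₗ TensorProduct.mk K A A a).rTensor A v =
        d.antipodeMul.rTensor A ((leg12 (J : Multiplier K (Two K A))).left
          ((TensorProduct.assoc K A A A).symm (a ⊗ₜ v))) := by
    intro v
    induction v using TensorProduct.induction_on with
    | zero => simp
    | add x y hx hy => simp only [TensorProduct.tmul_add, map_add, hx, hy]
    | tmul x y => rfl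
  have h2 : ∀ (X : Multiplier K (Two K A)) (v : Two K A),
      (TensorProduct.assoc K A A A).symm (a ⊗ₜ X.left v) =
        (leg23 X).left ((TensorProduct.assoc K A A A).symm (a ⊗ₜ v)) := fun X v => by
    rw [leg23, reassoc_left, LinearEquiv.apply_symm_apply]; rfl
  rw [h1, h2, ← Multiplier.mul_left, d.leg12_mul_leg23_inv hJ, Multiplier.mul_left,
    d.rTensor_antipodeMul_comulLeftExt (n := LinearMap.id) (sliceLeft_inv hJ.slice_left),
    LinearMap.lTensor_id, LinearMap.id_apply, h2, TensorProduct.assoc_symm_tmul]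
  obtain ⟨w, hw, hw'⟩ := d.rTensor_antipodeMul_of_incl_eq
    (d.T'.symm ((J : Multiplier K (Two K A)).left (a ⊗ₜ b))) c e
  rw [← hw']
  congr 1
  refine incl_injective (K := K) d.nd₃ ?_
  rw [hw, LinearEquiv.apply_symm_apply, ← mul_incl d.nd₃, ← mul_incl d.nd₃, incl_three_tmul_tmul,
    ← comulRightExt_inr d.hopf d.sq, ← comulRightExt_inl d.hopf d.sq,
    ← comulRightExt_incl d.hopf d.sq, ← mul_incl d.nd₂, incl_two_tmul, inl_inr_comm,
    comulRightExt_mul d.hopf d.sq, comulRightExt_mul d.hopf d.sq]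
  simp only [mul_assoc]

theorem sliceRight_rTensor (g : A →ₗ[K] A) (x : Two K A) :
    sliceRight ε (g.rTensor A x) = g (sliceRight ε x) :=
  LinearMap.congr_fun (TensorProduct.ext' (g := sliceRight ε ∘ₗ g.rTensor A)
    (h := g ∘ₗ sliceRight ε) fun x y => by simp) x

/-- In terms of the antipode `S`, this is `S(J₁ a) J₂ b c = S(S⁻¹(J₂ b) J₁ a) c`. For `J = 1` it is
the source of the antimultiplicativity of `S` and of the inverse of `S`. -/
theorem antipodeMul_cocycle {J : (Multiplier K (Two K A))ˣ}
    (hJ : IsNormalizedCocycle Δ ε J) (a b c : A) :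
    d.antipodeMul ((J : Multiplier K (Two K A)).left (a ⊗ₜ (b * c))) =
      d.antipodeMul (d.cop.antipodeMul (TensorProduct.comm K A A
        ((J : Multiplier K (Two K A)).left (a ⊗ₜ b))) ⊗ₜ c) := by
  obtain ⟨e, he⟩ := d.exists_one
  have h := congrArg (sliceRight ε) (d.rTensor_antipodeMul_cocycle hJ a b c e)
  rw [sliceRight_rTensor, sliceRight_inv hJ.slice_right, d.counit.sliceRight_comul d.hopf,
    sliceRight_tmul, he, one_smul] at h
  refine h.trans ?_
  obtain ⟨s, hs⟩ := d.T'.surjective ((J : Multiplier K (Two K A)).left (a ⊗ₜ b))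
  rw [← hs, LinearEquiv.symm_apply_apply, cop_antipodeMul_comm_T']
  refine LinearMap.congr_fun (TensorProduct.ext'
    (g := sliceRight ε ∘ₗ TensorProduct.map (d.antipodeMul ∘ₗ (TensorProduct.mk K A A).flip c)
        (LinearMap.mulRight K e) ∘ₗ (TensorProduct.comm K A A).toLinearMap)
    (h := d.antipodeMul ∘ₗ (TensorProduct.mk K A A).flip c ∘ₗ sliceLeft ε) fun x y => ?_) s
  simp [he]

theorem antipodeMul_tmul_mul (a c : A) (x : A) :
    d.antipodeMul (x ⊗ₜ (a * c)) = d.antipodeMul (x ⊗ₜ a) * c :=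
  d.antipodeMul_inr_right c (x ⊗ₜ a)

theorem antipodeMul_mul (z : Two K A) (c : A) :
    d.antipodeMul z * c =
      d.antipodeMul (d.cop.antipodeMul (TensorProduct.comm K A A z) ⊗ₜ c) :=
  LinearMap.congr_fun (TensorProduct.ext' (g := LinearMap.mulRight K c ∘ₗ d.antipodeMul)
    (h := d.antipodeMul ∘ₗ (TensorProduct.mk K A A).flip c ∘ₗ d.cop.antipodeMul ∘ₗ
      (TensorProduct.comm K A A).toLinearMap) fun x a =>
    (d.antipodeMul_tmul_mul a c x).symm.trans
      (d.antipodeMul_cocycle d.isNormalizedCocycle_one x a c)) z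

/-- The antipode `S : A → A`, with `S(y) = ∑ S(xᵢ) aᵢ` for `∑ xᵢ ⊗ aᵢ = Δ(e)(y ⊗ 1)`, where
`ε(e) = 1`. -/
def antipode : A →ₗ[K] A :=
  d.antipodeMul ∘ₗ d.T'.toLinearMap ∘ₗ TensorProduct.mk K A A d.exists_one.choose

theorem antipode_mul (y c : A) : d.antipode y * c = d.antipodeMul (y ⊗ₜ c) := by
  change d.antipodeMul (d.T' (d.exists_one.choose ⊗ₜ y)) * c = _
  rw [antipodeMul_mul, cop_antipodeMul_comm_T', sliceLeft_tmul, d.exists_one.choose_spec, one_smul]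

theorem antipode_cop_antipodeMul (z : Two K A) :
    d.antipode (d.cop.antipodeMul (TensorProduct.comm K A A z)) = d.antipodeMul z := by
  refine sub_eq_zero.1 (d.nd.1 _ fun c => ?_)
  rw [sub_mul, antipode_mul, ← antipodeMul_mul, sub_self]

theorem cop_antipode_antipodeMul (z : Two K A) :
    d.cop.antipode (d.antipodeMul z) = d.cop.antipodeMul (TensorProduct.comm K A A z) := by
  have := d.cop.antipode_cop_antipodeMul (TensorProduct.comm K A A z)
  rwa [TensorProduct.comm_comm, cop_cop_antipodeMul] at this

theorem antipode_cop_antipode (a : A) : d.antipode (d.cop.antipode a) = a := by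
  obtain ⟨z, rfl⟩ := d.antipodeMul_surjective a
  rw [cop_antipode_antipodeMul, antipode_cop_antipodeMul]

theorem cop_antipode_antipode (a : A) : d.cop.antipode (d.antipode a) = a := by
  obtain ⟨z, rfl⟩ := d.cop.antipodeMul_surjective a
  obtain ⟨z, rfl⟩ := (TensorProduct.comm K A A).surjective z
  rw [antipode_cop_antipodeMul, cop_antipode_antipodeMul]

theorem antipode_bijective : Function.Bijective d.antipode :=
  Function.bijective_iff_has_inverse.2
    ⟨d.cop.antipode, d.cop_antipode_antipode, d.antipode_cop_antipode⟩

theorem antipode_antimul (a b : A) : d.antipode (a * b) = d.antipode b * d.antipode a := by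
  have h := d.antipode_cop_antipodeMul (b ⊗ₜ d.antipode a)
  rwa [TensorProduct.comm_tmul, ← antipode_mul, cop_antipode_antipode, ← antipode_mul] at h

end HopfData

end Antipode

/-! ### Subspaces stable under the Galois map -/

section Stable

variable {K : Type u} [Field K]
variable {A : Type v} [NonUnitalRing A] [Module K A] [SMulCommClass K A A] [IsScalarTower K A A]

/-- The slice of the first factor by a functional. -/
def slice {V W : Type*} [AddCommGroup V] [Module K V] [AddCommGroup W] [Module K W]
    (φ : V →ₗ[K] K) : V ⊗[K] W →ₗ[K] W :=
  (TensorProduct.lid K W).toLinearMap ∘ₗ φ.rTensor W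

@[simp] theorem slice_tmul {V W : Type*} [AddCommGroup V] [Module K V] [AddCommGroup W]
    [Module K W] (φ : V →ₗ[K] K) (v : V) (w : W) : slice φ (v ⊗ₜ[K] w) = φ v • w := rfl

theorem slice_inr_left (φ : A →ₗ[K] K) (q : A) (x : Two K A) :
    slice φ ((inr (K := K) q).left x) = q * slice φ x :=
  LinearMap.congr_fun (TensorProduct.ext' (g := slice φ ∘ₗ (inr (K := K) q).left)
    (h := LinearMap.mulLeft K q ∘ₗ slice φ) fun x y => by simp [inr]) x

theorem slice_inr_right (φ : A →ₗ[K] K) (q : A) (x : Two K A) :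
    slice φ ((inr (K := K) q).right x) = slice φ x * q :=
  LinearMap.congr_fun (TensorProduct.ext' (g := slice φ ∘ₗ (inr (K := K) q).right)
    (h := LinearMap.mulRight K q ∘ₗ slice φ) fun x y => by simp [inr]) x

theorem slice_assoc_symm_tmul (ω : Two K A →ₗ[K] K) (m : A) (x : Two K A) :
    slice ω ((TensorProduct.assoc K A A A).symm (m ⊗ₜ x)) =
      slice (ω ∘ₗ TensorProduct.mk K A A m) x :=
  LinearMap.congr_fun (TensorProduct.ext'
    (g := slice ω ∘ₗ (TensorProduct.assoc K A A A).symm.toLinearMap ∘ₗ TensorProduct.mk K A _ m)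
    (h := slice (ω ∘ₗ TensorProduct.mk K A A m)) fun x y => by simp) x

theorem rTensor_slice_assoc_symm_tmul (φ : A →ₗ[K] K) (a : A) (t : Two K A) :
    (slice φ).rTensor A ((TensorProduct.assoc K A A A).symm (a ⊗ₜ t)) = φ a • t := by
  induction t using TensorProduct.induction_on with
  | zero => simp
  | add x y hx hy => rw [TensorProduct.tmul_add, map_add, map_add, hx, hy, smul_add]
  | tmul x y => rw [TensorProduct.assoc_symm_tmul, LinearMap.rTensor_tmul, slice_tmul,
      TensorProduct.smul_tmul']

theorem rTensor_slice_leg23_left (φ : A →ₗ[K] K) (X : Multiplier K (Two K A)) (u : Three K A) :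
    (slice φ).rTensor A ((leg23 X).left u) = X.left ((slice φ).rTensor A u) := by
  refine LinearMap.congr_fun (three_ext (F := (slice φ).rTensor A ∘ₗ (leg23 X).left)
    (G := X.left ∘ₗ (slice φ).rTensor A) fun a b c => ?_) u
  rw [LinearMap.comp_apply, leg23, reassoc_left, TensorProduct.assoc_tmul, tensorMul_left,
    TensorProduct.map_tmul, rTensor_slice_assoc_symm_tmul]
  simp [← TensorProduct.smul_tmul']

namespace HopfData

variable {Δ : A →ₙₐ[K] Multiplier K (Two K A)} {ε : A →ₙₐ[K] K} (d : HopfData Δ ε)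

theorem rTensor_slice_T₂₃ (φ : A →ₗ[K] K) (v : Two K A) (c : A) :
    (slice φ).rTensor A (d.T₂₃ (v ⊗ₜ c)) = d.T (slice φ v ⊗ₜ c) := by
  induction v using TensorProduct.induction_on with
  | zero => simp
  | add x y hx hy => simp only [TensorProduct.add_tmul, map_add, hx, hy]
  | tmul a b => rw [T₂₃_tmul, rTensor_slice_assoc_symm_tmul, slice_tmul, ← TensorProduct.smul_tmul', map_smul]

theorem sliceRight_T₂' (q b : A) : sliceRight ε (d.T₂' (q ⊗ₜ b)) = ε q • b := by
  refine sub_eq_zero.1 (d.nd.1 _ fun e => ?_)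
  obtain ⟨y, rfl⟩ := sliceRight_surjective d.exists_one e
  rw [sub_mul, ← sliceRight_mul, ← incl_left (K := K), d.T₂'_spec, Multiplier.mul_left,
    sliceRight_inr_left, d.counit.sliceRight_comul d.hopf, smul_mul_assoc, sub_self]

/-- `Λ_q(m ⊗ b) = (ω ⊗ ι)(m ⊗ (1 ⊗ q)Δ(b))`. -/
def coslice (ω : Two K A →ₗ[K] K) : A →ₗ[K] Two K A →ₗ[K] A :=
  LinearMap.llcomp K _ _ _ (slice ω ∘ₗ (TensorProduct.assoc K A A A).symm.toLinearMap) ∘ₗ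
    LinearMap.lTensorHom A ∘ₗ (TensorProduct.mk K A A).compr₂ d.T₂'.toLinearMap

theorem coslice_tmul (ω : Two K A →ₗ[K] K) (q m b : A) : d.coslice ω q (m ⊗ₜ b) =
    slice (ω ∘ₗ TensorProduct.mk K A A m) (d.T₂' (q ⊗ₜ b)) :=
  slice_assoc_symm_tmul ω m _

theorem coslice_mul (ω : Two K A →ₗ[K] K) (q c : A) (w : Two K A) :
    d.coslice ω q w * c = q * slice ω (d.T₂₃ (w ⊗ₜ c)) := by
  induction w using TensorProduct.induction_on with
  | zero => simp
  | add x y hx hy => simp only [TensorProduct.add_tmul, map_add, add_mul, mul_add, hx, hy]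
  | tmul m b =>
    rw [coslice_tmul, T₂₃_tmul, slice_assoc_symm_tmul, ← slice_inr_left, ← slice_inr_right]
    congr 1
    refine incl_injective (K := K) d.nd₂ ?_
    rw [← incl_mul d.nd₂, ← mul_incl d.nd₂, d.T₂'_spec, d.T_spec, mul_assoc]

theorem counit_coslice (ω : Two K A →ₗ[K] K) (q : A) (w : Two K A) :
    ε (d.coslice ω q w) = ε q * ω w := by
  have h : ∀ (φ : A →ₗ[K] K) (x : Two K A), ε (slice φ x) = φ (sliceRight ε x) := fun φ x =>
    LinearMap.congr_fun (TensorProduct.ext' (g := (ε : A →ₗ[K] K) ∘ₗ slice φ)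
      (h := φ ∘ₗ sliceRight ε) fun x y => by simp [mul_comm]) x
  induction w using TensorProduct.induction_on with
  | zero => simp
  | add x y hx hy => simp only [map_add, mul_add, hx, hy]
  | tmul m b => rw [coslice_tmul, h, sliceRight_T₂']; simp

/-- `(q ⊗ s, w ⊗ c) ↦ Λ_q(w) ⊗ s c`. -/
def coslice₂ (ω : Two K A →ₗ[K] K) : Two K A →ₗ[K] Three K A →ₗ[K] Two K A :=
  TensorProduct.map₂ (d.coslice ω) (LinearMap.mul K A)

theorem coslice₂_tmul (ω : Two K A →ₗ[K] K) (q s : A) (x : Three K A) :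
    d.coslice₂ ω (q ⊗ₜ s) x = TensorProduct.map (d.coslice ω q) (LinearMap.mulLeft K s) x := rfl

/-- `(q ⊗ s, b ⊗ c) ↦ ∑ (1 ⊗ q)Δ(b) ⊗ s c` depends on `t = ∑ q ⊗ s` and `z = ∑ b ⊗ c` through the
product `(1 ⊗ t)(Δ ⊗ ι)(z)`. -/
theorem exists_coslice₂_assoc_symm (ω : Two K A →ₗ[K] K) (m : A) (t z : Two K A) :
    ∃ k : Three K A, incl K (Three K A) k = leg23 (incl K (Two K A) t) * comulLeft Δ z ∧
      d.coslice₂ ω t ((TensorProduct.assoc K A A A).symm (m ⊗ₜ z)) =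
        (slice (ω ∘ₗ TensorProduct.mk K A A m)).rTensor A k := by
  induction t using TensorProduct.induction_on with
  | zero =>
    refine ⟨0, ?_, by simp⟩
    rw [map_zero, map_zero, leg23, map_zero, map_zero, zero_mul]
  | add t₁ t₂ h₁ h₂ =>
    obtain ⟨k₁, h₁, h₁'⟩ := h₁
    obtain ⟨k₂, h₂, h₂'⟩ := h₂
    refine ⟨k₁ + k₂, ?_, by simp only [map_add, LinearMap.add_apply, h₁', h₂']⟩
    rw [map_add, h₁, h₂, ← add_mul, map_add, leg23, leg23, leg23, map_add, map_add]
  | tmul q s =>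
    induction z using TensorProduct.induction_on with
    | zero => exact ⟨0, by simp, by simp⟩
    | add z₁ z₂ h₁ h₂ =>
      obtain ⟨k₁, h₁, h₁'⟩ := h₁
      obtain ⟨k₂, h₂, h₂'⟩ := h₂
      exact ⟨k₁ + k₂, by simp only [map_add, h₁, h₂, mul_add],
        by simp only [TensorProduct.tmul_add, map_add, h₁', h₂']⟩
    | tmul b c =>
      refine ⟨d.T₂' (q ⊗ₜ b) ⊗ₜ (s * c), ?_, ?_⟩
      · have hc : comulLeft Δ (b ⊗ₜ c) = leg12 (Δ b) * leg23 (inr c) := by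
          rw [comulLeft_tmul, leg23_inr, leg12, tensorMul_mul, one_mul, mul_one]
        rw [incl_three_tmul, d.T₂'_spec, incl_two_tmul, leg23_mul, leg23_inl, leg12_mul, hc,
          inr_mul, leg23_mul, mul_assoc, mul_assoc, ← mul_assoc (leg23 (inr s)),
          ← leg12_leg23_inr_comm, mul_assoc]
      · rw [TensorProduct.assoc_symm_tmul, coslice₂_tmul, TensorProduct.map_tmul, coslice_tmul,
          LinearMap.rTensor_tmul]
        rfl

theorem coslice₂_T₂₃ (ω : Two K A →ₗ[K] K) (r : A) (h : Two K A) (y : Three K A) :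
    d.coslice₂ ω ((Δ r).right h) (d.T₂₃ y) = h * d.T ((d.coslice ω r).rTensor A y) := by
  refine LinearMap.congr_fun (three_ext
    (F := d.coslice₂ ω ((Δ r).right h) ∘ₗ d.T₂₃.toLinearMap)
    (G := LinearMap.mulLeft K h ∘ₗ d.T.toLinearMap ∘ₗ (d.coslice ω r).rTensor A)
    fun m b c => ?_) y
  change d.coslice₂ ω ((Δ r).right h) (d.T₂₃ ((m ⊗ₜ b) ⊗ₜ c)) =
    h * d.T (d.coslice ω r (m ⊗ₜ b) ⊗ₜ c)
  obtain ⟨k, hk, hk'⟩ := d.exists_coslice₂_assoc_symm ω m ((Δ r).right h) (d.T (b ⊗ₜ c))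
  rw [T₂₃_tmul, hk', coslice_tmul, ← rTensor_slice_T₂₃, ← incl_left (K := K),
    ← rTensor_slice_leg23_left]
  congr 1
  refine incl_injective (K := K) d.nd₃ ?_
  rw [hk, ← mul_incl d.nd₃, incl_T₂₃, ← comulRightExt_incl d.hopf d.sq, d.T₂'_spec,
    comulRightExt_mul d.hopf d.sq, comulRightExt_inr d.hopf d.sq, ← comulLeftExt_comul d.hopf d.sq,
    ← comulLeftExt_incl d.hopf d.sq, d.T_spec, comulLeftExt_mul d.hopf d.sq,
    comulLeftExt_inr d.hopf d.sq, ← incl_mul d.nd₂, leg23_mul]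
  simp only [mul_assoc]

/-- If `P ⊆ A ⊗ A` is a right subcomodule for the coaction of `(A, Δ)` on the second factor, in
the form `T²³(P ⊗ A) ⊆ P ⊗ A`, then also `(T²³)⁻¹(P ⊗ A) ⊆ P ⊗ A`. Here `P` is the range
of `W`. A functional `ω` killing `P` gives maps `Λ_q` that kill `P`, so
`∑ Λ_q(m ⊗ b₁) ⊗ s b₂ c = 0` whenever `T²³(∑ m ⊗ b ⊗ c) ∈ P ⊗ A`. By coassociativity, taking
`h Δ(r)` for `q ⊗ s` turns this into `h T(∑ Λ_r(m ⊗ b) ⊗ c) = 0`; then `T` is cancelled and the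
counit is applied. -/
theorem mem_range_rTensor_of_T₂₃ (W : Two K A →ₗ[K] Two K A)
    (hW : ∀ x, d.T₂₃ (W.rTensor A x) ∈ LinearMap.range (W.rTensor A)) {y : Three K A}
    (hy : d.T₂₃ y ∈ LinearMap.range (W.rTensor A)) : y ∈ LinearMap.range (W.rTensor A) := by
  let π := (LinearMap.range W).mkQ
  have hex : Function.Exact (W.rTensor A) (π.rTensor A) :=
    rTensor_exact A (LinearMap.exact_map_mkQ_range W) (Submodule.mkQ_surjective _)
  refine (hex y).1 (tensor_eq_zero_of_slices _ fun φ => ?_)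
  let ω : Two K A →ₗ[K] K := φ ∘ₗ π
  have hωW : ω ∘ₗ W = 0 := by
    rw [LinearMap.comp_assoc, LinearMap.range_mkQ_comp, LinearMap.comp_zero]
  have hω : ∀ x, slice ω (W.rTensor A x) = 0 := by
    intro x
    change TensorProduct.lid K A (ω.rTensor A (W.rTensor A x)) = 0
    rw [← LinearMap.comp_apply (ω.rTensor A), ← LinearMap.rTensor_comp, hωW,
      LinearMap.rTensor_zero, LinearMap.zero_apply, map_zero]
  have hgoal : slice ω y = 0 := by
    have hΛ : ∀ q, d.coslice ω q ∘ₗ W = 0 := by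
      intro q
      refine LinearMap.ext fun x => d.nd.1 _ fun c => ?_
      obtain ⟨x', hx'⟩ := hW (x ⊗ₜ c)
      rw [LinearMap.rTensor_tmul] at hx'
      rw [LinearMap.comp_apply, coslice_mul, ← hx', hω, mul_zero]
    have hE : ∀ t x, d.coslice₂ ω t (W.rTensor A x) = 0 := by
      intro t x
      induction t using TensorProduct.induction_on with
      | zero => simp
      | add t₁ t₂ h₁ h₂ => rw [map_add, LinearMap.add_apply, h₁, h₂, add_zero]
      | tmul q s =>
        rw [coslice₂_tmul, ← LinearMap.comp_apply, LinearMap.map_comp_rTensor, hΛ,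
          TensorProduct.map_zero_left, LinearMap.zero_apply]
    obtain ⟨e, he⟩ := d.exists_one
    have h0 : (d.coslice ω e).rTensor A y = 0 := by
      refine d.T.injective ?_
      rw [map_zero]
      refine d.nd₂.2 _ fun h => ?_
      obtain ⟨x, hx⟩ := hy
      rw [← coslice₂_T₂₃, ← hx, hE]
    have h1 : ∀ z : Three K A, sliceLeft ε ((d.coslice ω e).rTensor A z) = slice ω z := fun z =>
      LinearMap.congr_fun (TensorProduct.ext' (g := sliceLeft ε ∘ₗ (d.coslice ω e).rTensor A)
        (h := slice ω) fun w c => by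
          rw [LinearMap.comp_apply, LinearMap.rTensor_tmul, sliceLeft_tmul, counit_coslice, he,
            one_mul, slice_tmul]) z
    rw [← h1, h0, map_zero]
  rw [← hgoal]
  change _ = TensorProduct.lid K A ((φ ∘ₗ π).rTensor A y)
  rw [LinearMap.rTensor_comp, LinearMap.comp_apply]

end HopfData
end Stable

/-! ### The twisted Galois map -/

section Twisted

variable {K : Type u} [Field K]
variable {A : Type v} [NonUnitalRing A] [Module K A] [SMulCommClass K A A] [IsScalarTower K A A]

/-- A normalized cocycle `J` with `J(1 ⊗ a) ∈ M(A) ⊗ A` and `J(a ⊗ 1) ∈ A ⊗ M(A)`. -/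
structure IsBoundedCocycle (Δ : A →ₙₐ[K] Multiplier K (Two K A)) (ε : A →ₙₐ[K] K)
    (J : (Multiplier K (Two K A))ˣ) : Prop extends IsNormalizedCocycle Δ ε J where
  mul_inr_mem : ∀ a : A, (J : Multiplier K (Two K A)) * inr a ∈ multTensorAlg K A
  mul_inl_mem : ∀ a : A, (J : Multiplier K (Two K A)) * inl a ∈ algTensorMult K A

/-- `W` is the map `a ⊗ b ↦ Δ(a)J(1 ⊗ b)` of `A ⊗ A`. -/
def IsTwistedGalois (Δ : A →ₙₐ[K] Multiplier K (Two K A)) (J : Multiplier K (Two K A))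
    (W : Two K A →ₗ[K] Two K A) : Prop :=
  ∀ a b, incl K (Two K A) (W (a ⊗ₜ b)) = Δ a * J * inr b

theorem flip_mem_algTensorMult {X : Multiplier K (Two K A)} (hX : X ∈ multTensorAlg K A) :
    flip X ∈ algTensorMult K A := by
  induction hX using Submodule.span_induction with
  | mem x hx =>
    obtain ⟨m, a, rfl⟩ := hx
    exact Submodule.subset_span ⟨a, m, flip_tensorMul _ _⟩
  | zero => rw [map_zero]; exact zero_mem _
  | add x y _ _ hx hy => rw [map_add]; exact add_mem hx hy
  | smul r x _ hx => rw [map_smul]; exact Submodule.smul_mem _ r hx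

theorem flip_mem_multTensorAlg {X : Multiplier K (Two K A)} (hX : X ∈ algTensorMult K A) :
    flip X ∈ multTensorAlg K A := by
  induction hX using Submodule.span_induction with
  | mem x hx =>
    obtain ⟨a, m, rfl⟩ := hx
    exact Submodule.subset_span ⟨m, a, flip_tensorMul _ _⟩
  | zero => rw [map_zero]; exact zero_mem _
  | add x y _ _ hx hy => rw [map_add]; exact add_mem hx hy
  | smul r x _ hx => rw [map_smul]; exact Submodule.smul_mem _ r hx

namespace HopfData

variable {Δ : A →ₙₐ[K] Multiplier K (Two K A)} {ε : A →ₙₐ[K] K} (d : HopfData Δ ε)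
variable {J : (Multiplier K (Two K A))ˣ}

theorem isBoundedCocycle_flip (d : HopfData Δ ε) (hJ : IsBoundedCocycle Δ ε J) :
    IsBoundedCocycle (MultiplierHopf.cop Δ) ε (flipUnits J) where
  toIsNormalizedCocycle := d.isNormalizedCocycle_flip hJ.toIsNormalizedCocycle
  mul_inr_mem a := by
    have := flip_mem_multTensorAlg (hJ.mul_inl_mem a)
    rwa [map_mul, flip_inl] at this
  mul_inl_mem a := by
    have := flip_mem_algTensorMult (hJ.mul_inr_mem a)
    rwa [map_mul, flip_inr] at this

theorem comul_mul_mem (d : HopfData Δ ε) (a : A) {Y : Multiplier K (Two K A)}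
    (hY : Y ∈ multTensorAlg K A) :
    ∃ x, incl K (Two K A) x = Δ a * Y := by
  induction hY using Submodule.span_induction with
  | mem y hy =>
    obtain ⟨m, c, rfl⟩ := hy
    refine ⟨(tensorMul K A A m 1).right (d.T (a ⊗ₜ c)), ?_⟩
    rw [← incl_mul d.nd₂, d.T_spec, mul_assoc, inr, tensorMul_mul, one_mul, mul_one]
  | zero => exact ⟨0, by rw [map_zero, mul_zero]⟩
  | add x y _ _ hx hy =>
    obtain ⟨x', hx⟩ := hx
    obtain ⟨y', hy⟩ := hy
    exact ⟨x' + y', by rw [map_add, hx, hy, mul_add]⟩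
  | smul r x _ hx =>
    obtain ⟨x', hx⟩ := hx
    exact ⟨r • x', by rw [map_smul, hx, mul_smul_comm]⟩

theorem exists_twistedGalois (d : HopfData Δ ε) (hJ : IsBoundedCocycle Δ ε J) :
    ∃ W, IsTwistedGalois Δ (J : Multiplier K (Two K A)) W := by
  refine exists_linearMap_of_forall_mem d.nd₂ (LinearMap.mk₂ K
    (fun a b => Δ a * (J : Multiplier K (Two K A)) * inr b)
    (fun a a' b => by simp only [map_add, add_mul])
    (fun r a b => by simp only [map_smul, smul_mul_assoc])
    (fun a b b' => ?_) (fun r a b => ?_)) fun a b => ?_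
  · rw [inr, map_add, map_add, mul_add]; rfl
  · rw [inr, map_smul, map_smul, mul_smul_comm]; rfl
  · rw [LinearMap.mk₂_apply, mul_assoc]
    exact d.comul_mul_mem a (hJ.mul_inr_mem b)

variable {W : Two K A →ₗ[K] Two K A}

theorem incl_rTensor_twistedGalois_rightComm
    (hW : IsTwistedGalois Δ J W) (y : Two K A) (b : A) :
    incl K (Three K A) (W.rTensor A (TensorProduct.rightComm K A A A (y ⊗ₜ b))) =
      comulLeft Δ y * (leg12 (J : Multiplier K (Two K A)) * leg12 (inr b)) := by
  induction y using TensorProduct.induction_on with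
  | zero => simp
  | add x y hx hy =>
    rw [TensorProduct.add_tmul, map_add, map_add, map_add, hx, hy, map_add, add_mul]
  | tmul a c =>
    have hc : comulLeft Δ (a ⊗ₜ c) = leg12 (Δ a) * leg23 (inr c) := by
      rw [comulLeft_tmul, leg23_inr, leg12, tensorMul_mul, one_mul, mul_one]
    rw [TensorProduct.rightComm_tmul, LinearMap.rTensor_tmul, incl_three_tmul, hW, hc, mul_assoc,
      leg12_mul, ← leg12_mul (J : Multiplier K (Two K A)), mul_assoc, mul_assoc,
      leg12_leg23_inr_comm]

/-- `W` on the first and third factor. -/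
def on13 (W : Two K A →ₗ[K] Two K A) : Three K A →ₗ[K] Three K A :=
  (TensorProduct.rightComm K A A A).toLinearMap ∘ₗ W.rTensor A ∘ₗ
    (TensorProduct.rightComm K A A A).toLinearMap

theorem on13_tmul (W : Two K A →ₗ[K] Two K A) (a b c : A) : on13 W ((a ⊗ₜ b) ⊗ₜ c) =
    TensorProduct.rightComm K A A A (W (a ⊗ₜ c) ⊗ₜ b) := rfl

theorem incl_rTensor_on13 (d : HopfData Δ ε)
    (hW : IsTwistedGalois Δ J W) (a : A) (z : Two K A) :
    incl K (Three K A) (W.rTensor A (on13 W ((TensorProduct.assoc K A A A).symm (a ⊗ₜ z)))) =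
      comulLeftExt Δ (Δ a * (J : Multiplier K (Two K A))) * (leg12 (J : Multiplier K (Two K A)) *
        leg23 (incl K (Two K A) z)) := by
  induction z using TensorProduct.induction_on with
  | zero => rw [TensorProduct.tmul_zero, map_zero, map_zero, map_zero, map_zero, map_zero, leg23,
      map_zero, map_zero, mul_zero, mul_zero]
  | add x y hx hy =>
    rw [TensorProduct.tmul_add, map_add, map_add, map_add, map_add, hx, hy, ← mul_add, ← mul_add,
      map_add, leg23, leg23, leg23, map_add, map_add]
  | tmul b c =>
    rw [TensorProduct.assoc_symm_tmul, on13_tmul, incl_rTensor_twistedGalois_rightComm hW,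
      ← comulLeftExt_incl d.hopf d.sq, hW, comulLeftExt_mul d.hopf d.sq,
      comulLeftExt_inr d.hopf d.sq, incl_two_tmul, leg23_mul, leg23_inl, mul_assoc,
      leg12_leg23_inr_comm, ← mul_assoc (leg23 (inr c)), ← leg12_leg23_inr_comm, mul_assoc,
      ← leg12_leg23_inr_comm]

/-- The mixed pentagon equation `T²³ W¹² = W¹² W¹³ (J⁻¹T)²³`. -/
theorem pentagon (hJ : IsNormalizedCocycle Δ ε J)
    (hW : IsTwistedGalois Δ J W) (a b c : A) :
    d.T₂₃ (W (a ⊗ₜ b) ⊗ₜ c) = W.rTensor A (on13 W ((TensorProduct.assoc K A A A).symm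
      (a ⊗ₜ ((J⁻¹ : (Multiplier K (Two K A))ˣ) : Multiplier K (Two K A)).left
        (d.T (b ⊗ₜ c))))) := by
  refine incl_injective (K := K) d.nd₃ ?_
  have h2 : leg23 (J : Multiplier K (Two K A)) *
      leg23 ((J⁻¹ : (Multiplier K (Two K A))ˣ) : Multiplier K (Two K A)) = 1 := by
    rw [← leg23_mul, Units.mul_inv, leg23_one]
  have h3 : ∀ X : Multiplier K (Three K A), comulLeftExt Δ (J : Multiplier K (Two K A)) *
      (leg12 (J : Multiplier K (Two K A)) *
        (leg23 ((J⁻¹ : (Multiplier K (Two K A))ˣ) : Multiplier K (Two K A)) * X)) =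
      comulRightExt Δ (J : Multiplier K (Two K A)) * X := fun X => by
    rw [← mul_assoc, hJ.cocycle, mul_assoc, ← mul_assoc (leg23 _), h2, one_mul]
  rw [incl_T₂₃, d.incl_rTensor_on13 hW, ← comulRightExt_incl d.hopf d.sq, hW,
    comulRightExt_mul d.hopf d.sq, comulRightExt_mul d.hopf d.sq, comulRightExt_inr d.hopf d.sq,
    ← mul_incl d.nd₂, d.T_spec, leg23_mul, leg23_mul, comulLeftExt_mul d.hopf d.sq,
    comulLeftExt_comul d.hopf d.sq]
  simp only [mul_assoc]
  rw [h3]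

theorem sliceRight_twistedGalois (d : HopfData Δ ε) (hJ : IsNormalizedCocycle Δ ε J)
    (hW : IsTwistedGalois Δ J W) (x : Two K A) :
    sliceRight ε (W x) = sliceRight ε x := by
  refine LinearMap.congr_fun (TensorProduct.ext' (g := sliceRight ε ∘ₗ W)
    (h := sliceRight ε) fun a b => ?_) x
  refine sub_eq_zero.1 (d.nd.1 _ fun e => ?_)
  obtain ⟨y, rfl⟩ := sliceRight_surjective d.exists_one e
  rw [LinearMap.comp_apply, sub_mul, ← sliceRight_mul, ← incl_left (K := K), hW,
    Multiplier.mul_left, Multiplier.mul_left, d.counit.sliceRight_comul d.hopf, hJ.slice_right,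
    sliceRight_inr_left, sliceRight_tmul, mul_smul_comm, smul_mul_assoc, sub_self]

theorem rTensor_sliceRight_rightComm (w : Two K A) (b : A) :
    (sliceRight ε).rTensor A (TensorProduct.rightComm K A A A (w ⊗ₜ b)) = ε b • w := by
  induction w using TensorProduct.induction_on with
  | zero => simp
  | add x y hx hy => rw [TensorProduct.add_tmul, map_add, map_add, hx, hy, smul_add]
  | tmul a c => simp [TensorProduct.smul_tmul']

theorem rTensor_sliceRight_on13 (W : Two K A →ₗ[K] Two K A) (u : Three K A) :
    (sliceRight ε).rTensor A (on13 W u) = W ((sliceRight ε).rTensor A u) :=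
  LinearMap.congr_fun (three_ext (F := (sliceRight ε).rTensor A ∘ₗ on13 W)
    (G := W ∘ₗ (sliceRight ε).rTensor A) fun a b c => by
      rw [LinearMap.comp_apply, LinearMap.comp_apply, on13_tmul, rTensor_sliceRight_rightComm,
        LinearMap.rTensor_tmul, sliceRight_tmul, ← TensorProduct.smul_tmul', map_smul]) u

/-- `J⁻¹T` on the last two factors. -/
def twist₂₃ (J : (Multiplier K (Two K A))ˣ) : Three K A →ₗ[K] Three K A :=
  (TensorProduct.assoc K A A A).symm.toLinearMap ∘ₗ
    (((J⁻¹ : (Multiplier K (Two K A))ˣ) : Multiplier K (Two K A)).left ∘ₗ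
      d.T.toLinearMap).lTensor A ∘ₗ (TensorProduct.assoc K A A A).toLinearMap

theorem T₂₃_rTensor_twistedGalois (hJ : IsNormalizedCocycle Δ ε J)
    (hW : IsTwistedGalois Δ J W) (x : Three K A) :
    d.T₂₃ (W.rTensor A x) = W.rTensor A (on13 W (d.twist₂₃ J x)) :=
  LinearMap.congr_fun (three_ext (F := d.T₂₃.toLinearMap ∘ₗ W.rTensor A)
    (G := W.rTensor A ∘ₗ on13 W ∘ₗ d.twist₂₃ J) fun a b c => d.pentagon hJ hW a b c) x

theorem rTensor_sliceRight_rTensor_twistedGalois (d : HopfData Δ ε)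
    (hJ : IsNormalizedCocycle Δ ε J) (hW : IsTwistedGalois Δ J W) (y : Three K A) :
    (sliceRight ε).rTensor A (W.rTensor A y) = (sliceRight ε).rTensor A y := by
  rw [← LinearMap.comp_apply, ← LinearMap.rTensor_comp]
  congr 2
  exact LinearMap.ext (d.sliceRight_twistedGalois hJ hW)

/-- By the pentagon equation and the stability of its range, every `W¹²x` has the form
`W¹²W¹³u`. As `(ι ⊗ ε)W = ι ⊗ ε`, applying `ι ⊗ ε ⊗ ι` gives `(ι ⊗ ε ⊗ ι)(x) ∈ range W`. -/
theorem twistedGalois_surjective (d : HopfData Δ ε) (hJ : IsNormalizedCocycle Δ ε J)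
    (hW : IsTwistedGalois Δ J W) :
    Function.Surjective W := by
  intro w
  obtain ⟨e, he⟩ := d.exists_one
  let x : Three K A := TensorProduct.rightComm K A A A (w ⊗ₜ e)
  have hx : (sliceRight ε).rTensor A x = w := by
    rw [rTensor_sliceRight_rightComm, he, one_smul]
  obtain ⟨x', hx'⟩ := d.mem_range_rTensor_of_T₂₃ W
    (fun x => ⟨_, (d.T₂₃_rTensor_twistedGalois hJ hW x).symm⟩)
    (y := d.T₂₃.symm (W.rTensor A x)) ⟨x, (d.T₂₃.apply_symm_apply _).symm⟩
  have h1 : W.rTensor A (on13 W (d.twist₂₃ J x')) = W.rTensor A x := by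
    rw [← d.T₂₃_rTensor_twistedGalois hJ hW, hx', LinearEquiv.apply_symm_apply]
  refine ⟨(sliceRight ε).rTensor A (d.twist₂₃ J x'), ?_⟩
  rw [← rTensor_sliceRight_on13, ← d.rTensor_sliceRight_rTensor_twistedGalois hJ hW, h1,
    d.rTensor_sliceRight_rTensor_twistedGalois hJ hW, hx]

end HopfData
end Twisted

/-! ### The twisted multiplier Hopf algebra -/

section TwistedHopf

variable {K : Type u} [Field K]
variable {A : Type v} [NonUnitalRing A] [Module K A] [SMulCommClass K A A] [IsScalarTower K A A]
variable {Δ : A →ₙₐ[K] Multiplier K (Two K A)} {ε : A →ₙₐ[K] K}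

theorem twistedComul_apply (J : (Multiplier K (Two K A))ˣ) (a : A) : twistedComul Δ J a =
    ((J⁻¹ : (Multiplier K (Two K A))ˣ) : Multiplier K (Two K A)) * Δ a * J := rfl

theorem cop_twistedComul (J : (Multiplier K (Two K A))ˣ) :
    cop (twistedComul Δ J) = twistedComul (cop Δ) (flipUnits J) := by
  refine NonUnitalAlgHom.ext fun a => ?_
  rw [cop_apply, twistedComul_apply, twistedComul_apply, map_mul, map_mul, ← map_inv,
    coe_flipUnits, coe_flipUnits, cop_apply]

namespace HopfData

variable (d : HopfData Δ ε) {J : (Multiplier K (Two K A))ˣ}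

theorem antipodeMul_inl_right (e : A) (x : Two K A) :
    d.antipodeMul ((inl (K := K) e).right x) = d.antipode e * d.antipodeMul x := by
  refine LinearMap.congr_fun (TensorProduct.ext' (g := d.antipodeMul ∘ₗ (inl (K := K) e).right)
    (h := LinearMap.mulLeft K (d.antipode e) ∘ₗ d.antipodeMul) fun a b => ?_) x
  change d.antipodeMul ((a * e) ⊗ₜ b) = d.antipode e * d.antipodeMul (a ⊗ₜ b)
  rw [← antipode_mul, ← antipode_mul, antipode_antimul, mul_assoc]

/-- For `Y = ∑ a ⊗ m` in `A ⊗ M(A)` the element `s` is `∑ S(a) m`. -/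
theorem exists_antipodeMul_eq_mul {Y : Multiplier K (Two K A)} (hY : Y ∈ algTensorMult K A) :
    ∃ s, ∀ c, ∃ x, incl K (Two K A) x = Y * inr c ∧ d.antipodeMul x = s * c := by
  induction hY using Submodule.span_induction with
  | mem y hy =>
    obtain ⟨a, m, rfl⟩ := hy
    refine ⟨m.right (d.antipode a), fun c => ⟨a ⊗ₜ m.left c, ?_, ?_⟩⟩
    · rw [incl_tmul, ← mul_incl d.nd, inr, tensorMul_mul, mul_one]
    · rw [← antipode_mul, m.central]
  | zero => exact ⟨0, fun c => ⟨0, by rw [map_zero, zero_mul], by rw [map_zero, zero_mul]⟩⟩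
  | add x y _ _ hx hy =>
    obtain ⟨s, hs⟩ := hx
    obtain ⟨t, ht⟩ := hy
    refine ⟨s + t, fun c => ?_⟩
    obtain ⟨x₁, h₁, h₁'⟩ := hs c
    obtain ⟨x₂, h₂, h₂'⟩ := ht c
    exact ⟨x₁ + x₂, by rw [map_add, h₁, h₂, add_mul], by rw [map_add, h₁', h₂', add_mul]⟩
  | smul r x _ hx =>
    obtain ⟨s, hs⟩ := hx
    refine ⟨r • s, fun c => ?_⟩
    obtain ⟨x₁, h₁, h₁'⟩ := hs c
    exact ⟨r • x₁, by rw [map_smul, h₁, smul_mul_assoc], by rw [map_smul, h₁', smul_mul_assoc]⟩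

/-- `s` is the map `a ↦ S(a) Q` of `A`, where `Q = S(J₁) J₂` for `J = J₁ ⊗ J₂`; it is
characterized by `s(a) c = S(J₁ a) J₂ c`. -/
def IsTwistedAntipode (J : Multiplier K (Two K A)) (s : A →ₗ[K] A) : Prop :=
  ∀ a c, s a * c = d.antipodeMul (J.left (a ⊗ₜ c))

theorem exists_twistedAntipode (hJ : IsBoundedCocycle Δ ε J) :
    ∃ s, d.IsTwistedAntipode (J : Multiplier K (Two K A)) s := by
  obtain ⟨s, hs⟩ := exists_linearMap_of_forall_mulLeft (K := K) d.nd
    ((TensorProduct.mk K A A).compr₂ (d.antipodeMul ∘ₗ (J : Multiplier K (Two K A)).left))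
    fun a => by
      obtain ⟨s, hs⟩ := d.exists_antipodeMul_eq_mul (hJ.mul_inl_mem a)
      refine ⟨s, fun c => ?_⟩
      obtain ⟨x, hx, hx'⟩ := hs c
      rw [← hx']
      change d.antipodeMul ((J : Multiplier K (Two K A)).left (a ⊗ₜ c)) = _
      congr 1
      refine incl_injective (K := K) d.nd₂ ?_
      rw [hx, ← mul_incl d.nd₂, incl_two_tmul, mul_assoc]
  exact ⟨s, fun a c => (hs a c).symm⟩

variable {W : Two K A →ₗ[K] Two K A} {s : A →ₗ[K] A}

/-- Here `W` is the twisted Galois map of the co-opposite algebra; both sides equal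
`ε(p) S⁻¹(J₂) J₁ a`. -/
theorem cop_antipodeMul_twistedGalois
    (hs : d.IsTwistedAntipode (J : Multiplier K (Two K A)) s)
    (hW : IsTwistedGalois (MultiplierHopf.cop Δ) (flipUnits J : Multiplier K (Two K A)) W)
    (p a : A) :
    d.cop.antipodeMul (W (p ⊗ₜ a)) = ε p • d.cop.antipode (s a) := by
  refine sub_eq_zero.1 (d.nd.2 _ fun e => ?_)
  obtain ⟨b, rfl⟩ := d.cop.antipode_bijective.2 e
  have h1 : (inl (K := K) b).right (W (p ⊗ₜ a)) =
      (MultiplierHopf.cop Δ p).left ((flip (J : Multiplier K (Two K A))).left (b ⊗ₜ a)) := by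
    refine incl_injective (K := K) d.nd₂ ?_
    rw [← incl_mul d.nd₂, hW, ← mul_incl d.nd₂, ← mul_incl d.nd₂, incl_two_tmul, inl_inr_comm,
      mul_assoc, mul_assoc, coe_flipUnits]
  rw [mul_sub, ← antipodeMul_inl_right, h1, antipodeMul_comul, flip_left, TensorProduct.comm_tmul,
    ← cop_antipode_antipodeMul, ← hs, antipode_antimul, mul_smul_comm, sub_self]

/-- `S⁻¹ ∘ s` is surjective, since `W` and `x ⊗ y ↦ S⁻¹(x) y` are. -/
theorem twistedAntipode_surjective (hJ : IsBoundedCocycle Δ ε J)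
    (hs : d.IsTwistedAntipode (J : Multiplier K (Two K A)) s) : Function.Surjective s := by
  have hJ' := d.isBoundedCocycle_flip hJ
  obtain ⟨W, hW⟩ := d.cop.exists_twistedGalois hJ'
  intro a
  obtain ⟨x, hx⟩ := d.cop.antipodeMul_surjective (d.cop.antipode a)
  obtain ⟨y, rfl⟩ := d.cop.twistedGalois_surjective hJ'.toIsNormalizedCocycle hW x
  refine ⟨sliceLeft ε y, d.cop.antipode_bijective.1 ?_⟩
  rw [← hx]
  refine LinearMap.congr_fun (TensorProduct.ext' (g := d.cop.antipode ∘ₗ s ∘ₗ sliceLeft ε)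
    (h := d.cop.antipodeMul ∘ₗ W) fun p a => ?_) y
  simp [d.cop_antipodeMul_twistedGalois hs hW]

theorem cop_twistedAntipode_mul {t : A →ₗ[K] A}
    (hs : d.IsTwistedAntipode (J : Multiplier K (Two K A)) s)
    (ht : d.cop.IsTwistedAntipode (flipUnits J : Multiplier K (Two K A)) t) (a b : A) :
    t b * a = d.cop.antipode (s a * b) := by
  rw [ht, hs, cop_antipode_antipodeMul, coe_flipUnits, flip_left, TensorProduct.comm_tmul]

theorem twistedAntipode_bijective (hJ : IsBoundedCocycle Δ ε J)
    (hs : d.IsTwistedAntipode (J : Multiplier K (Two K A)) s) : Function.Bijective s := by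
  refine ⟨(injective_iff_map_eq_zero s).2 fun a ha => d.nd.2 a fun b => ?_,
    d.twistedAntipode_surjective hJ hs⟩
  have hJ' := d.isBoundedCocycle_flip hJ
  obtain ⟨t, ht⟩ := d.cop.exists_twistedAntipode hJ'
  obtain ⟨b, rfl⟩ := d.cop.twistedAntipode_surjective hJ' ht b
  rw [d.cop_twistedAntipode_mul hs ht, ha, zero_mul, map_zero]

theorem rTensor_sliceRight_assoc_symm (a : A) (v : Two K A) :
    (sliceRight ε).rTensor A ((TensorProduct.assoc K A A A).symm (a ⊗ₜ v)) =
      a ⊗ₜ sliceLeft ε v := by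
  induction v using TensorProduct.induction_on with
  | zero => simp
  | add x y hx hy => simp only [TensorProduct.tmul_add, map_add, hx, hy]
  | tmul b c => simp [TensorProduct.smul_tmul]

/-- For `k` in the kernel of `W`, applying `W¹²W¹³` to `k¹³b²` gives `0`. By the pentagon equation
`W¹²` kills `(T⁻¹J)²³(k¹³b²)`, and applying `ι ⊗ ε ⊗ ι` yields `(1 ⊗ s(b))k = 0`, where `s` is
surjective. -/
theorem twistedGalois_injective (d : HopfData Δ ε) (hJ : IsBoundedCocycle Δ ε J)
    (hW : IsTwistedGalois Δ J W) : Function.Injective W := by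
  obtain ⟨s, hs⟩ := d.exists_twistedAntipode hJ
  refine (injective_iff_map_eq_zero W).2 fun k hk => ?_
  refine tensor_eq_zero_of_mulLeft d.nd k fun a => ?_
  obtain ⟨b, rfl⟩ := d.twistedAntipode_surjective hJ hs a
  let g : A →ₗ[K] Two K A := d.T.symm.toLinearMap ∘ₗ (J : Multiplier K (Two K A)).left ∘ₗ
    TensorProduct.mk K A A b
  let y : Three K A := (TensorProduct.assoc K A A A).symm (g.lTensor A k)
  have h1 : on13 W (d.twist₂₃ J y) = 0 := by
    have h2 : ∀ k : Two K A, on13 W (d.twist₂₃ J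
        ((TensorProduct.assoc K A A A).symm (g.lTensor A k))) =
        TensorProduct.rightComm K A A A (W k ⊗ₜ b) := fun k =>
      LinearMap.congr_fun (TensorProduct.ext' (g := on13 W ∘ₗ d.twist₂₃ J ∘ₗ
          (TensorProduct.assoc K A A A).symm.toLinearMap ∘ₗ g.lTensor A)
        (h := (TensorProduct.rightComm K A A A).toLinearMap ∘ₗ
          (TensorProduct.mk K (Two K A) A).flip b ∘ₗ W) fun a c => by
        change on13 W (d.twist₂₃ J ((TensorProduct.assoc K A A A).symm
          (a ⊗ₜ d.T.symm ((J : Multiplier K (Two K A)).left (b ⊗ₜ c))))) = _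
        rw [twist₂₃, LinearMap.comp_apply, LinearMap.comp_apply, LinearEquiv.coe_coe,
          LinearEquiv.coe_coe, LinearEquiv.apply_symm_apply, LinearMap.lTensor_tmul,
          LinearMap.comp_apply, LinearEquiv.coe_coe, LinearEquiv.apply_symm_apply,
          ← Multiplier.mul_left, Units.inv_mul, Multiplier.one_left, TensorProduct.assoc_symm_tmul,
          on13_tmul]
        rfl) k
    rw [h2, hk, TensorProduct.zero_tmul, map_zero]
  have h2 : W.rTensor A y = 0 := by
    refine d.T₂₃.injective ?_
    rw [d.T₂₃_rTensor_twistedGalois hJ.toIsNormalizedCocycle hW, h1, map_zero, map_zero]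
  have h3 : (sliceRight ε).rTensor A (W.rTensor A y) = (LinearMap.mulLeft K (s b)).lTensor A k := by
    rw [d.rTensor_sliceRight_rTensor_twistedGalois hJ.toIsNormalizedCocycle hW]
    refine LinearMap.congr_fun (TensorProduct.ext' (g := (sliceRight ε).rTensor A ∘ₗ
          (TensorProduct.assoc K A A A).symm.toLinearMap ∘ₗ g.lTensor A)
        (h := (LinearMap.mulLeft K (s b)).lTensor A) fun a c => ?_) k
    change (sliceRight ε).rTensor A ((TensorProduct.assoc K A A A).symm
          (a ⊗ₜ d.T.symm ((J : Multiplier K (Two K A)).left (b ⊗ₜ c)))) = a ⊗ₜ (s b * c)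
    rw [rTensor_sliceRight_assoc_symm, hs]
    rfl
  rw [← h3, h2, map_zero]

theorem exists_bijective_twistedComul_mul_inr (d : HopfData Δ ε) (hJ : IsBoundedCocycle Δ ε J) :
    ∃ T : Two K A →ₗ[K] Two K A, Function.Bijective T ∧
      ∀ a b : A, incl K (Two K A) (T (a ⊗ₜ[K] b)) = twistedComul Δ J a * inr b := by
  obtain ⟨W, hW⟩ := d.exists_twistedGalois hJ
  refine ⟨((J⁻¹ : (Multiplier K (Two K A))ˣ) : Multiplier K (Two K A)).left ∘ₗ W,
    (Multiplier.left_bijective J⁻¹).comp ⟨d.twistedGalois_injective hJ hW,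
      d.twistedGalois_surjective hJ.toIsNormalizedCocycle hW⟩, fun a b => ?_⟩
  rw [LinearMap.comp_apply, ← mul_incl d.nd₂, hW, twistedComul_apply]
  simp only [mul_assoc]

/-- `(s(a) ⊗ 1) J⁻¹ Δ(b) = ∑ S(y) ⊗ x` for `∑ Δ(x)(y ⊗ 1) = J(a ⊗ b)`. -/
theorem inl_mul_inv_mul_comul (hJ : IsBoundedCocycle Δ ε J)
    (hs : d.IsTwistedAntipode (J : Multiplier K (Two K A)) s) (a b : A) :
    inl (s a) * ((J⁻¹ : (Multiplier K (Two K A))ˣ) : Multiplier K (Two K A)) * Δ b =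
      incl K (Two K A) (d.antipode.rTensor A (TensorProduct.comm K A A
        (d.T'.symm ((J : Multiplier K (Two K A)).left (a ⊗ₜ b))))) := by
  refine Multiplier.ext_left d.nd₂ fun x => ?_
  rw [Multiplier.mul_left, Multiplier.mul_left, incl_left]
  refine LinearMap.congr_fun (TensorProduct.ext' (g := (inl (K := K) (s a)).left ∘ₗ
    ((J⁻¹ : (Multiplier K (Two K A))ˣ) : Multiplier K (Two K A)).left ∘ₗ (Δ b).left)
    (h := LinearMap.mulLeft K _) fun c e => ?_) x
  refine Eq.trans ?_ ((d.rTensor_antipodeMul_cocycle hJ.toIsNormalizedCocycle a b c e).trans ?_)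
  · refine LinearMap.congr_fun (TensorProduct.ext' (g := (inl (K := K) (s a)).left)
      (h := (d.antipodeMul ∘ₗ (J : Multiplier K (Two K A)).left ∘ₗ
        TensorProduct.mk K A A a).rTensor A) fun x y => ?_) _
    change (s a * x) ⊗ₜ y = d.antipodeMul ((J : Multiplier K (Two K A)).left (a ⊗ₜ x)) ⊗ₜ y
    rw [hs]
  · refine LinearMap.congr_fun (TensorProduct.ext'
      (g := TensorProduct.map (d.antipodeMul ∘ₗ (TensorProduct.mk K A A).flip c)
        (LinearMap.mulRight K e))
      (h := LinearMap.mulRight K (c ⊗ₜ[K] e : Two K A) ∘ₗ d.antipode.rTensor A) fun x y => ?_) _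
    change d.antipodeMul (x ⊗ₜ c) ⊗ₜ (y * e) = (d.antipode x ⊗ₜ[K] y : Two K A) * (c ⊗ₜ[K] e)
    rw [Algebra.TensorProduct.tmul_mul_tmul, antipode_mul]

theorem exists_bijective_inl_mul_twistedComul (d : HopfData Δ ε) (hJ : IsBoundedCocycle Δ ε J) :
    ∃ T : Two K A →ₗ[K] Two K A, Function.Bijective T ∧
      ∀ a b : A, incl K (Two K A) (T (a ⊗ₜ[K] b)) = inl a * twistedComul Δ J b := by
  obtain ⟨s, hs⟩ := d.exists_twistedAntipode hJ
  let s' := LinearEquiv.ofBijective s (d.twistedAntipode_bijective hJ hs)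
  let S := LinearEquiv.ofBijective d.antipode d.antipode_bijective
  refine ⟨(J : Multiplier K (Two K A)).right ∘ₗ (S.rTensor A).toLinearMap ∘ₗ
    (TensorProduct.comm K A A).toLinearMap ∘ₗ d.T'.symm.toLinearMap ∘ₗ
    (J : Multiplier K (Two K A)).left ∘ₗ (s'.symm.rTensor A).toLinearMap,
    (Multiplier.right_bijective J).comp ((S.rTensor A).bijective.comp
      ((TensorProduct.comm K A A).bijective.comp (d.T'.symm.bijective.comp
      ((Multiplier.left_bijective J).comp (s'.symm.rTensor A).bijective)))), fun a b => ?_⟩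
  obtain ⟨a, rfl⟩ := s'.surjective a
  change incl K (Two K A) ((J : Multiplier K (Two K A)).right (d.antipode.rTensor A
    (TensorProduct.comm K A A (d.T'.symm ((J : Multiplier K (Two K A)).left
      (s'.symm (s' a) ⊗ₜ b)))))) = inl (s a) * _
  rw [LinearEquiv.symm_apply_apply, ← incl_mul d.nd₂, ← d.inl_mul_inv_mul_comul hJ hs,
    twistedComul_apply]
  simp only [mul_assoc]

theorem comulLeft_twistedComul (x : Two K A) : comulLeft (twistedComul Δ J) x =
    leg12 ((J⁻¹ : (Multiplier K (Two K A))ˣ) : Multiplier K (Two K A)) * comulLeft Δ x *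
      leg12 (J : Multiplier K (Two K A)) := by
  induction x using TensorProduct.induction_on with
  | zero => simp
  | add x y hx hy => rw [map_add, hx, hy, map_add, mul_add, add_mul]
  | tmul a b =>
    rw [comulLeft_tmul, comulLeft_tmul, leg12, leg12, tensorMul_mul, tensorMul_mul, one_mul,
      mul_one, twistedComul_apply]

theorem comulRight_twistedComul (x : Two K A) : comulRight (twistedComul Δ J) x =
    leg23 ((J⁻¹ : (Multiplier K (Two K A))ˣ) : Multiplier K (Two K A)) * comulRight Δ x *
      leg23 (J : Multiplier K (Two K A)) := by
  induction x using TensorProduct.induction_on with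
  | zero => simp
  | add x y hx hy => rw [map_add, hx, hy, map_add, mul_add, add_mul]
  | tmul a b =>
    rw [comulRight_tmul, comulRight_tmul, leg23, leg23, ← map_mul, ← map_mul, tensorMul_mul,
      tensorMul_mul, one_mul, mul_one, twistedComul_apply]

theorem inv_mul_comulExt_inv (d : HopfData Δ ε) (hJ : IsNormalizedCocycle Δ ε J) :
    leg12 ((J⁻¹ : (Multiplier K (Two K A))ˣ) : Multiplier K (Two K A)) *
        comulLeftExt Δ ((J⁻¹ : (Multiplier K (Two K A))ˣ) : Multiplier K (Two K A)) =
      leg23 ((J⁻¹ : (Multiplier K (Two K A))ˣ) : Multiplier K (Two K A)) *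
        comulRightExt Δ ((J⁻¹ : (Multiplier K (Two K A))ˣ) : Multiplier K (Two K A)) := by
  refine left_inv_eq_right_inv (a := comulLeftExt Δ J * leg12 (J : Multiplier K (Two K A))) ?_ ?_
  · rw [mul_assoc, ← mul_assoc (comulLeftExt Δ _), ← comulLeftExt_mul d.hopf d.sq, Units.inv_mul,
      comulLeftExt_one d.hopf d.sq, one_mul, ← leg12_mul, Units.inv_mul, leg12_one]
  · rw [hJ.cocycle, mul_assoc, ← mul_assoc (leg23 _), ← leg23_mul, Units.mul_inv, leg23_one,
      one_mul, ← comulRightExt_mul d.hopf d.sq, Units.mul_inv, comulRightExt_one d.hopf d.sq]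

theorem isMultiplierHopfAlgebra_twistedComul (d : HopfData Δ ε) (hJ : IsBoundedCocycle Δ ε J) :
    IsMultiplierHopfAlgebra (twistedComul Δ J) where
  nondegenerate := d.nd
  bijective_T₁ := d.exists_bijective_twistedComul_mul_inr hJ
  bijective_T₂ := d.exists_bijective_inl_mul_twistedComul hJ
  comul :=
    { mul_inr_mem := fun a b => by
        obtain ⟨T, -, hT⟩ := d.exists_bijective_twistedComul_mul_inr hJ
        exact ⟨_, hT a b⟩
      inl_mul_mem := fun a b => by
        obtain ⟨T, -, hT⟩ := d.exists_bijective_inl_mul_twistedComul hJ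
        exact ⟨_, hT a b⟩
      coassoc := fun a b c x y hx hy => by
        have h1 := d.inv_mul_comulExt_inv hJ.toIsNormalizedCocycle
        have h2 : ∀ X, leg12 (inl a) * (leg23 ((J⁻¹ : (Multiplier K (Two K A))ˣ) :
            Multiplier K (Two K A)) * X) = leg23 ((J⁻¹ : (Multiplier K (Two K A))ˣ) :
            Multiplier K (Two K A)) * (leg12 (inl a) * X) := fun X => by
          rw [← mul_assoc, leg12_inl_leg23_comm, mul_assoc]
        rw [comulLeft_twistedComul, comulRight_twistedComul, ← comulLeftExt_incl d.hopf d.sq, hx,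
          ← comulRightExt_incl d.hopf d.sq, hy, twistedComul_apply, comulLeftExt_mul d.hopf d.sq,
          comulLeftExt_mul d.hopf d.sq, comulLeftExt_mul d.hopf d.sq, comulRightExt_mul d.hopf d.sq,
          comulRightExt_mul d.hopf d.sq, comulRightExt_mul d.hopf d.sq,
          comulLeftExt_inr d.hopf d.sq, comulRightExt_inl d.hopf d.sq,
          comulLeftExt_comul d.hopf d.sq]
        calc _ = leg12 (inl a) * (leg12 ((J⁻¹ : (Multiplier K (Two K A))ˣ) :
              Multiplier K (Two K A)) * comulLeftExt Δ ((J⁻¹ : (Multiplier K (Two K A))ˣ) :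
              Multiplier K (Two K A))) * comulRightExt Δ (Δ b) *
              (comulLeftExt Δ (J : Multiplier K (Two K A)) *
                (leg23 (inr c) * leg12 (J : Multiplier K (Two K A)))) := by simp only [mul_assoc]
          _ = leg12 (inl a) * (leg23 ((J⁻¹ : (Multiplier K (Two K A))ˣ) :
              Multiplier K (Two K A)) * comulRightExt Δ ((J⁻¹ : (Multiplier K (Two K A))ˣ) :
              Multiplier K (Two K A))) * comulRightExt Δ (Δ b) *
              (comulRightExt Δ (J : Multiplier K (Two K A)) *
                leg23 (J : Multiplier K (Two K A)) * leg23 (inr c)) := by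
            rw [h1, ← leg12_leg23_inr_comm, ← mul_assoc (comulLeftExt Δ _), hJ.cocycle]
          _ = _ := by simp only [mul_assoc, h2] }

theorem isCounit_twistedComul (d : HopfData Δ ε) (hJ : IsNormalizedCocycle Δ ε J) :
    IsCounit (twistedComul Δ J) ε where
  slice_left a b x hx := by
    refine sub_eq_zero.1 (d.nd.1 _ fun e => ?_)
    obtain ⟨y, rfl⟩ := sliceLeft_surjective d.exists_one e
    rw [sub_mul, ← sliceLeft_mul, ← incl_left (K := K), hx, twistedComul_apply,
      Multiplier.mul_left, Multiplier.mul_left, Multiplier.mul_left, sliceLeft_inv hJ.slice_left,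
      d.counit.sliceLeft_comul d.hopf d.exists_one, hJ.slice_left, sliceLeft_inr_left, mul_assoc,
      sub_self]
  slice_right a b x hx := by
    refine sub_eq_zero.1 (d.nd.1 _ fun e => ?_)
    obtain ⟨y, rfl⟩ := sliceRight_surjective d.exists_one e
    rw [sub_mul, ← sliceRight_mul, ← incl_left (K := K), hx, twistedComul_apply,
      Multiplier.mul_left, Multiplier.mul_left, Multiplier.mul_left, sliceRight_inl_left,
      sliceRight_inv hJ.slice_right, d.counit.sliceRight_comul d.hopf, hJ.slice_right, mul_assoc,
      sub_self]

theorem isRegular_twistedComul (d : HopfData Δ ε) (hJ : IsBoundedCocycle Δ ε J) :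
    IsRegularMultiplierHopfAlgebra (twistedComul Δ J) where
  hopf := d.isMultiplierHopfAlgebra_twistedComul hJ
  hopf_cop := by
    rw [cop_twistedComul]
    exact d.cop.isMultiplierHopfAlgebra_twistedComul (d.isBoundedCocycle_flip hJ)

end HopfData
end TwistedHopf

/-! ### The twisted R-matrix -/

section RMatrix

variable {K : Type u} [Field K]
variable {A : Type v} [NonUnitalRing A] [Module K A] [SMulCommClass K A A] [IsScalarTower K A A]
variable {Δ : A →ₙₐ[K] Multiplier K (Two K A)} {ε : A →ₙₐ[K] K}

theorem flip23_left (X : Multiplier K (Three K A)) (z : Three K A) : (flip23 X).left z =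
    TensorProduct.rightComm K A A A (X.left (TensorProduct.rightComm K A A A z)) := rfl

theorem flip23_right (X : Multiplier K (Three K A)) (z : Three K A) : (flip23 X).right z =
    TensorProduct.rightComm K A A A (X.right (TensorProduct.rightComm K A A A z)) := rfl

theorem rightComm_rightComm (z : Three K A) :
    TensorProduct.rightComm K A A A (TensorProduct.rightComm K A A A z) = z :=
  (TensorProduct.rightComm K A A A).apply_symm_apply z

theorem flip23_flip23 (X : Multiplier K (Three K A)) : flip23 (flip23 X) = X :=
  Multiplier.ext' (fun z => by simp only [flip23_left, rightComm_rightComm])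
    (fun z => by simp only [flip23_right, rightComm_rightComm])

theorem rightComm_assoc_symm_tmul (a : A) (x : Two K A) :
    TensorProduct.rightComm K A A A ((TensorProduct.assoc K A A A).symm (a ⊗ₜ x)) =
      (TensorProduct.assoc K A A A).symm (a ⊗ₜ TensorProduct.comm K A A x) := by
  induction x using TensorProduct.induction_on with
  | zero => simp
  | add x y hx hy => simp only [TensorProduct.tmul_add, map_add, hx, hy]
  | tmul b c => rfl

theorem revEquiv_rightComm_tmul (x : Two K A) (c : A) :
    revEquiv (TensorProduct.rightComm K A A A (x ⊗ₜ c)) =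
      TensorProduct.rightComm K A A A (TensorProduct.comm K A A x ⊗ₜ c) := by
  induction x using TensorProduct.induction_on with
  | zero => simp
  | add x y hx hy => simp only [TensorProduct.add_tmul, map_add, hx, hy]
  | tmul a b => rfl

theorem flip23_reassoc_tensorMul (m : Multiplier K A) (X : Multiplier K (Two K A)) :
    flip23 (reassoc (tensorMul K A (Two K A) m X)) =
      reassoc (tensorMul K A (Two K A) m (flip X)) := by
  refine Multiplier.ext' (fun z => ?_) (fun z => ?_)
  · refine LinearMap.congr_fun (three_ext (F := (flip23 (reassoc (tensorMul K A (Two K A) m X))).left)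
      (G := (reassoc (tensorMul K A (Two K A) m (flip X))).left) fun a b c => ?_) z
    rw [flip23_left, reassoc_left, reassoc_left, TensorProduct.rightComm_tmul,
      TensorProduct.assoc_tmul, TensorProduct.assoc_tmul, tensorMul_left, tensorMul_left,
      TensorProduct.map_tmul, TensorProduct.map_tmul, rightComm_assoc_symm_tmul, flip_left,
      TensorProduct.comm_tmul]
  · refine LinearMap.congr_fun (three_ext (F := (flip23 (reassoc (tensorMul K A (Two K A) m X))).right)
      (G := (reassoc (tensorMul K A (Two K A) m (flip X))).right) fun a b c => ?_) z
    rw [flip23_right, reassoc_right, reassoc_right, TensorProduct.rightComm_tmul,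
      TensorProduct.assoc_tmul, TensorProduct.assoc_tmul, tensorMul_right, tensorMul_right,
      TensorProduct.map_tmul, TensorProduct.map_tmul, rightComm_assoc_symm_tmul, flip_right,
      TensorProduct.comm_tmul]

theorem rev_flip23_tensorMul (X : Multiplier K (Two K A)) (m : Multiplier K A) :
    rev (flip23 (tensorMul K (Two K A) A X m)) = flip23 (tensorMul K (Two K A) A (flip X) m) := by
  refine Multiplier.ext' (fun z => ?_) (fun z => ?_)
  · refine LinearMap.congr_fun (three_ext (F := (rev (flip23 (tensorMul K (Two K A) A X m))).left)
      (G := (flip23 (tensorMul K (Two K A) A (flip X) m)).left) fun a b c => ?_) z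
    rw [rev_left, flip23_left, flip23_left, revEquiv_tmul, TensorProduct.rightComm_tmul,
      TensorProduct.rightComm_tmul, tensorMul_left, tensorMul_left,
      TensorProduct.map_tmul, TensorProduct.map_tmul, revEquiv_rightComm_tmul, flip_left,
      TensorProduct.comm_tmul]
  · refine LinearMap.congr_fun (three_ext (F := (rev (flip23 (tensorMul K (Two K A) A X m))).right)
      (G := (flip23 (tensorMul K (Two K A) A (flip X) m)).right) fun a b c => ?_) z
    rw [rev_right, flip23_right, flip23_right, revEquiv_tmul, TensorProduct.rightComm_tmul,
      TensorProduct.rightComm_tmul, tensorMul_right, tensorMul_right,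
      TensorProduct.map_tmul, TensorProduct.map_tmul, revEquiv_rightComm_tmul, flip_right,
      TensorProduct.comm_tmul]

theorem flip23_leg23 (X : Multiplier K (Two K A)) : flip23 (leg23 X) = leg23 (flip X) :=
  flip23_reassoc_tensorMul 1 X

theorem rev_leg13 (X : Multiplier K (Two K A)) : rev (leg13 X) = leg13 (flip X) :=
  rev_flip23_tensorMul X 1

theorem flip23_comulRight (x : Two K A) : flip23 (comulRight Δ x) = comulRight (cop Δ) x := by
  induction x using TensorProduct.induction_on with
  | zero => simp
  | add x y hx hy => simp only [map_add, hx, hy]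
  | tmul a b => rw [comulRight_tmul, flip23_reassoc_tensorMul]; rfl

theorem rev_flip23_comulLeft (x : Two K A) :
    rev (flip23 (comulLeft Δ x)) = flip23 (comulLeft (cop Δ) x) := by
  induction x using TensorProduct.induction_on with
  | zero => simp
  | add x y hx hy => simp only [map_add, hx, hy]
  | tmul a b => rw [comulLeft_tmul, rev_flip23_tensorMul]; rfl

theorem leg12_mul_comulLeft {R : Multiplier K (Two K A)} (hR : ∀ a, R * Δ a = cop Δ a * R)
    (x : Two K A) : leg12 R * comulLeft Δ x = comulLeft (cop Δ) x * leg12 R := by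
  induction x using TensorProduct.induction_on with
  | zero => simp
  | add x y hx hy => simp only [map_add, mul_add, add_mul, hx, hy]
  | tmul a b => rw [comulLeft_tmul, comulLeft_tmul, leg12, tensorMul_mul, tensorMul_mul, hR,
      one_mul, mul_one]

theorem leg23_mul_comulRight {R : Multiplier K (Two K A)} (hR : ∀ a, R * Δ a = cop Δ a * R)
    (x : Two K A) : leg23 R * comulRight Δ x = comulRight (cop Δ) x * leg23 R := by
  induction x using TensorProduct.induction_on with
  | zero => simp
  | add x y hx hy => simp only [map_add, mul_add, add_mul, hx, hy]
  | tmul a b => rw [comulRight_tmul, comulRight_tmul, leg23, ← map_mul, ← map_mul, tensorMul_mul,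
      tensorMul_mul, hR, one_mul, mul_one]

/-- If `u φ(a) = ψ(a) u` for an invertible `u`, then also the extensions of `φ` and `ψ` are
conjugate by `u`. -/
theorem IsExtendedValue.conj {A : Type v} [NonUnitalRing A] [Module K A] [SMulCommClass K A A]
    [IsScalarTower K A A] {B : Type w} [NonUnitalRing B] [Module K B] [SMulCommClass K B B]
    [IsScalarTower K B B] {φ ψ : A →ₗ[K] Multiplier K B} {m : Multiplier K A} {n : Multiplier K B}
    (h : IsExtendedValue φ m n) (u : (Multiplier K B)ˣ)
    (hu : ∀ a, (u : Multiplier K B) * φ a = ψ a * u) :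
    IsExtendedValue ψ m (u * n * ((u⁻¹ : (Multiplier K B)ˣ) : Multiplier K B)) := by
  have h1 : ∀ a, ψ a = u * φ a * ((u⁻¹ : (Multiplier K B)ˣ) : Multiplier K B) := fun a => by
    rw [hu, mul_assoc, Units.mul_inv, mul_one]
  refine ⟨fun a => ?_, fun a => ?_⟩
  · rw [h1, h1, ← h.1]
    simp only [mul_assoc, Units.inv_mul_cancel_left]
  · rw [h1, h1, ← h.2]
    simp only [mul_assoc, Units.inv_mul_cancel_left]

/-- `X¹²` as an invertible multiplier. -/
def leg12Units (X : (Multiplier K (Two K A))ˣ) : (Multiplier K (Three K A))ˣ :=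
  Units.map ⟨⟨leg12, leg12_one⟩, leg12_mul⟩ X

/-- `X²³` as an invertible multiplier. -/
def leg23Units (X : (Multiplier K (Two K A))ˣ) : (Multiplier K (Three K A))ˣ :=
  Units.map ⟨⟨leg23, leg23_one⟩, leg23_mul⟩ X

namespace HopfData

variable {R J : (Multiplier K (Two K A))ˣ}

theorem flip23_comulRightExt (d : HopfData Δ ε) (X : Multiplier K (Two K A)) :
    flip23 (comulRightExt Δ X) = comulRightExt (MultiplierHopf.cop Δ) X := by
  have hX := isExtendedValue_comulRightExt d.hopf d.sq X
  refine (comulRightExt_eq d.hopf_cop d.sq ⟨fun x => ?_, fun x => ?_⟩).symm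
  · rw [← flip23_comulRight, ← map_mul, hX.1, flip23_comulRight]
  · rw [← flip23_comulRight, ← map_mul, hX.2, flip23_comulRight]

theorem rev_flip23_comulLeftExt (d : HopfData Δ ε) (X : Multiplier K (Two K A)) :
    rev (flip23 (comulLeftExt Δ X)) = flip23 (comulLeftExt (MultiplierHopf.cop Δ) X) := by
  have hX := isExtendedValue_comulLeftExt d.hopf d.sq X
  have h : comulLeftExt (MultiplierHopf.cop Δ) X = flip23 (rev (flip23 (comulLeftExt Δ X))) := by
    have h1 : ∀ x, comulLeft (MultiplierHopf.cop Δ) x = flip23 (rev (flip23 (comulLeft Δ x))) :=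
      fun x => by rw [rev_flip23_comulLeft, flip23_flip23]
    refine comulLeftExt_eq d.hopf_cop d.sq ⟨fun x => ?_, fun x => ?_⟩
    · rw [h1, h1, ← map_mul, ← map_mul, ← map_mul, hX.1]
    · rw [h1, h1, ← map_mul, ← map_mul, ← map_mul, hX.2]
  rw [h, flip23_flip23]

theorem rev_flip23_comulRightExt (d : HopfData Δ ε) (X : Multiplier K (Two K A)) :
    rev (flip23 (comulRightExt Δ X)) = comulLeftExt Δ (flip X) := by
  rw [d.flip23_comulRightExt, ← d.rev_comulRightExt_cop, flip_flip]

theorem leg12_mul_comulLeftExt (d : HopfData Δ ε)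
    (hR : ∀ a, (R : Multiplier K (Two K A)) * Δ a = MultiplierHopf.cop Δ a * R)
    (X : Multiplier K (Two K A)) :
    leg12 (R : Multiplier K (Two K A)) * comulLeftExt Δ X =
      comulLeftExt (MultiplierHopf.cop Δ) X * leg12 (R : Multiplier K (Two K A)) := by
  rw [comulLeftExt_eq d.hopf_cop d.sq ((isExtendedValue_comulLeftExt d.hopf d.sq X).conj
    (leg12Units R) (leg12_mul_comulLeft hR))]
  exact ((leg12Units R).inv_mul_cancel_right _).symm

theorem leg23_mul_comulRightExt (d : HopfData Δ ε)
    (hR : ∀ a, (R : Multiplier K (Two K A)) * Δ a = MultiplierHopf.cop Δ a * R)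
    (X : Multiplier K (Two K A)) :
    leg23 (R : Multiplier K (Two K A)) * comulRightExt Δ X =
      flip23 (comulRightExt Δ X) * leg23 (R : Multiplier K (Two K A)) := by
  rw [d.flip23_comulRightExt, comulRightExt_eq d.hopf_cop d.sq
    ((isExtendedValue_comulRightExt d.hopf d.sq X).conj (leg23Units R) (leg23_mul_comulRight hR))]
  exact ((leg23Units R).inv_mul_cancel_right _).symm

theorem comulLeftExt_twistedComul (d : HopfData Δ ε) (hJ : IsBoundedCocycle Δ ε J)
    (X : Multiplier K (Two K A)) : comulLeftExt (twistedComul Δ J) X =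
      leg12 ((J⁻¹ : (Multiplier K (Two K A))ˣ) : Multiplier K (Two K A)) * comulLeftExt Δ X *
        leg12 (J : Multiplier K (Two K A)) := by
  refine comulLeftExt_eq (d.isMultiplierHopfAlgebra_twistedComul hJ) d.sq
    ((isExtendedValue_comulLeftExt d.hopf d.sq X).conj (leg12Units J)⁻¹ fun x => ?_)
  rw [comulLeft_twistedComul]
  exact ((leg12Units J).mul_inv_cancel_right _).symm

theorem coe_twistedRMatrix : (twistedRMatrix R J : Multiplier K (Two K A)) =
    flip ((J⁻¹ : (Multiplier K (Two K A))ˣ) : Multiplier K (Two K A)) * R * J := by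
  change (((flipUnits J)⁻¹ : (Multiplier K (Two K A))ˣ) : Multiplier K (Two K A)) * R * J = _
  rw [← map_inv, coe_flipUnits]

/-- The defining identity of the cocycle with its three legs permuted cyclically. -/
theorem cocycle_cyclic (d : HopfData Δ ε) (hJ : IsNormalizedCocycle Δ ε J) :
    flip23 (comulLeftExt (MultiplierHopf.cop Δ) (J : Multiplier K (Two K A))) *
        leg13 (flip (J : Multiplier K (Two K A))) =
      comulLeftExt Δ (flip (J : Multiplier K (Two K A))) * leg12 (J : Multiplier K (Two K A)) := by
  have h := congrArg (fun X => rev (flip23 X)) hJ.cocycle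
  simp only [map_mul] at h
  rwa [d.rev_flip23_comulLeftExt, d.rev_flip23_comulRightExt, flip23_leg23, rev_leg23, flip_flip,
    show flip23 (leg12 (J : Multiplier K (Two K A))) = leg13 (J : Multiplier K (Two K A)) from rfl,
    rev_leg13] at h

theorem comulLeftExt_twistedRMatrix (d : HopfData Δ ε) (hJ : IsBoundedCocycle Δ ε J)
    (hR : ∀ a, (R : Multiplier K (Two K A)) * Δ a = MultiplierHopf.cop Δ a * R)
    (hR' : comulLeftExt Δ R = leg13 (R : Multiplier K (Two K A)) * leg23 R) :
    comulLeftExt (twistedComul Δ J) (twistedRMatrix R J : Multiplier K (Two K A)) =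
      leg13 (twistedRMatrix R J : Multiplier K (Two K A)) *
        leg23 (twistedRMatrix R J : Multiplier K (Two K A)) := by
  let Ji : Multiplier K (Two K A) := ((J⁻¹ : (Multiplier K (Two K A))ˣ) : Multiplier K (Two K A))
  have hflip : flip Ji * flip (J : Multiplier K (Two K A)) = 1 := by
    rw [← map_mul, Units.inv_mul, map_one]
  have hflip' : flip (J : Multiplier K (Two K A)) * flip Ji = 1 := by
    rw [← map_mul, Units.mul_inv, map_one]
  -- The cocycle identity with the last two legs exchanged.
  have h1 : flip23 (comulLeftExt Δ (J : Multiplier K (Two K A))) *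
      leg13 (J : Multiplier K (Two K A)) =
      flip23 (comulRightExt Δ (J : Multiplier K (Two K A))) *
        leg23 (flip (J : Multiplier K (Two K A))) := by
    have h := congrArg flip23 hJ.cocycle
    rwa [map_mul, map_mul, flip23_leg23] at h
  -- `R¹³` intertwines the first and third leg.
  have h2 : leg13 (R : Multiplier K (Two K A)) *
      flip23 (comulLeftExt Δ (J : Multiplier K (Two K A))) =
      flip23 (comulLeftExt (MultiplierHopf.cop Δ) (J : Multiplier K (Two K A))) *
        leg13 (R : Multiplier K (Two K A)) := by
    have h := congrArg flip23 (d.leg12_mul_comulLeftExt hR (J : Multiplier K (Two K A)))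
    rwa [map_mul, map_mul] at h
  have h3 : flip23 (comulRightExt Δ (J : Multiplier K (Two K A))) =
      flip23 (comulLeftExt Δ (J : Multiplier K (Two K A))) *
        leg13 (J : Multiplier K (Two K A)) * leg23 (flip Ji) := by
    rw [h1, mul_assoc, ← leg23_mul, hflip', leg23_one, mul_one]
  have h4 : leg12 Ji * comulLeftExt Δ (flip Ji) *
      flip23 (comulLeftExt (MultiplierHopf.cop Δ) (J : Multiplier K (Two K A))) =
      leg13 (flip Ji) := by
    have h5 : flip23 (comulLeftExt (MultiplierHopf.cop Δ) (J : Multiplier K (Two K A))) =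
        comulLeftExt Δ (flip (J : Multiplier K (Two K A))) * leg12 (J : Multiplier K (Two K A)) *
          leg13 (flip Ji) := by
      rw [← d.cocycle_cyclic hJ.toIsNormalizedCocycle, mul_assoc, ← leg13_mul, hflip', leg13_one,
        mul_one]
    rw [h5, ← mul_assoc, ← mul_assoc, mul_assoc (leg12 Ji), ← comulLeftExt_mul d.hopf d.sq, hflip,
      comulLeftExt_one d.hopf d.sq, mul_one, ← leg12_mul, Units.inv_mul, leg12_one, one_mul]
  rw [d.comulLeftExt_twistedComul hJ, coe_twistedRMatrix, comulLeftExt_mul d.hopf d.sq,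
    comulLeftExt_mul d.hopf d.sq, hR']
  calc _ = leg12 Ji * comulLeftExt Δ (flip Ji) * leg13 (R : Multiplier K (Two K A)) *
        leg23 (R : Multiplier K (Two K A)) * (comulLeftExt Δ (J : Multiplier K (Two K A)) *
        leg12 (J : Multiplier K (Two K A))) := by simp only [mul_assoc, Ji]
    _ = leg12 Ji * comulLeftExt Δ (flip Ji) * leg13 (R : Multiplier K (Two K A)) *
        (leg23 (R : Multiplier K (Two K A)) * comulRightExt Δ (J : Multiplier K (Two K A))) *
        leg23 (J : Multiplier K (Two K A)) := by rw [hJ.cocycle]; simp only [mul_assoc]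
    _ = leg12 Ji * comulLeftExt Δ (flip Ji) * (leg13 (R : Multiplier K (Two K A)) *
        flip23 (comulLeftExt Δ (J : Multiplier K (Two K A)))) *
        leg13 (J : Multiplier K (Two K A)) * leg23 (flip Ji) *
        leg23 (R : Multiplier K (Two K A)) * leg23 (J : Multiplier K (Two K A)) := by
      rw [d.leg23_mul_comulRightExt hR, h3]; simp only [mul_assoc]
    _ = leg12 Ji * comulLeftExt Δ (flip Ji) *
        flip23 (comulLeftExt (MultiplierHopf.cop Δ) (J : Multiplier K (Two K A))) *
        leg13 (R : Multiplier K (Two K A)) *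
        leg13 (J : Multiplier K (Two K A)) * leg23 (flip Ji) *
        leg23 (R : Multiplier K (Two K A)) * leg23 (J : Multiplier K (Two K A)) := by
      rw [h2]; simp only [mul_assoc]
    _ = _ := by rw [h4]; simp only [leg13_mul, leg23_mul, mul_assoc, Ji]

theorem flip_twistedRMatrix : flip (twistedRMatrix R J : Multiplier K (Two K A)) =
    (twistedRMatrix (flipUnits R) (flipUnits J) : Multiplier K (Two K A)) := by
  rw [coe_twistedRMatrix, coe_twistedRMatrix, map_mul, map_mul, ← map_inv, coe_flipUnits,
    coe_flipUnits, coe_flipUnits]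

/-- This is `comulLeftExt_twistedRMatrix` for the co-opposite algebra, with the R-matrix `R₂₁` and the
cocycle `J₂₁`. -/
theorem comulRightExt_twistedRMatrix (d : HopfData Δ ε) (hJ : IsBoundedCocycle Δ ε J)
    (hR : ∀ a, (R : Multiplier K (Two K A)) * Δ a = MultiplierHopf.cop Δ a * R)
    (hR' : comulRightExt Δ R = leg13 (R : Multiplier K (Two K A)) * leg12 R) :
    comulRightExt (twistedComul Δ J) (twistedRMatrix R J : Multiplier K (Two K A)) =
      leg13 (twistedRMatrix R J : Multiplier K (Two K A)) *
        leg12 (twistedRMatrix R J : Multiplier K (Two K A)) := by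
  have hreg := d.isRegular_twistedComul hJ
  rw [← MultiplierHopf.rev_comulLeftExt_cop hreg.hopf d.sq hreg.hopf_cop, cop_twistedComul,
    flip_twistedRMatrix, d.cop.comulLeftExt_twistedRMatrix (d.isBoundedCocycle_flip hJ),
    ← flip_twistedRMatrix, map_mul, rev_leg13, rev_leg23, flip_flip]
  · intro a
    rw [cop_cop, cop_apply, coe_flipUnits, ← map_mul, hR, map_mul, cop_apply, flip_flip]
  · refine Function.LeftInverse.injective rev_rev ?_
    rw [coe_flipUnits, d.rev_comulLeftExt_cop, hR', map_mul, rev_leg13, rev_leg23, flip_flip]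

theorem twistedRMatrix_mul_twistedComul
    (hR : ∀ a, (R : Multiplier K (Two K A)) * Δ a = MultiplierHopf.cop Δ a * R) (a : A) :
    (twistedRMatrix R J : Multiplier K (Two K A)) * twistedComul Δ J a =
      MultiplierHopf.cop (twistedComul Δ J) a * twistedRMatrix R J := by
  have h : flip (J : Multiplier K (Two K A)) *
      flip ((J⁻¹ : (Multiplier K (Two K A))ˣ) : Multiplier K (Two K A)) = 1 := by
    rw [← map_mul, Units.mul_inv, map_one]
  rw [cop_apply, twistedComul_apply, coe_twistedRMatrix, map_mul, map_mul]
  calc _ = flip ((J⁻¹ : (Multiplier K (Two K A))ˣ) : Multiplier K (Two K A)) * (R * Δ a) * J := by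
        simp only [mul_assoc, Units.mul_inv_cancel_left]
    _ = flip ((J⁻¹ : (Multiplier K (Two K A))ˣ) : Multiplier K (Two K A)) * flip (Δ a) *
        (flip (J : Multiplier K (Two K A)) *
          flip ((J⁻¹ : (Multiplier K (Two K A))ˣ) : Multiplier K (Two K A))) * R * J := by
        rw [hR, h, mul_one, cop_apply]; simp only [mul_assoc]
    _ = _ := by simp only [mul_assoc]

/-! ### Counits -/

theorem nondegenerateHom_of_surjective (hsq : IdempotentMul K A) {f : Two K A →ₗ[K] A}
    (hf : Function.Surjective f) :
    NondegenerateHom ((incl K A : A →ₗ[K] Multiplier K A) ∘ₗ f) := by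
  refine ⟨hsq _ fun x y => ?_, hsq _ fun x y => ?_⟩
  · obtain ⟨x, rfl⟩ := hf x
    exact Submodule.subset_span ⟨x, y, rfl⟩
  · obtain ⟨y, rfl⟩ := hf y
    exact Submodule.subset_span ⟨y, x, rfl⟩

theorem extend_eq_one (d : HopfData Δ ε) {f : Two K A →ₗ[K] A} (hf : Function.Surjective f)
    (hmul : ∀ x y, f (x * y) = f x * f y) {X : Multiplier K (Two K A)}
    (hX : ∀ x, f (X.left x) = f x) :
    extend ((incl K A : A →ₗ[K] Multiplier K A) ∘ₗ f) X = 1 := by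
  refine extend_eq (nondegenerateHom_of_surjective d.sq hf) ⟨fun x => ?_, fun x => ?_⟩
  · rw [one_mul, LinearMap.comp_apply, LinearMap.comp_apply, hX]
  · rw [mul_one, LinearMap.comp_apply, LinearMap.comp_apply]
    congr 1
    refine sub_eq_zero.1 (d.nd.1 _ fun e => ?_)
    obtain ⟨y, rfl⟩ := hf e
    rw [sub_mul, ← hmul, ← hmul, X.central, hmul, hmul, hX, sub_self]

theorem isQuasitriangular_twistedComul (d : HopfData Δ ε) (hJ : IsBoundedCocycle Δ ε J)
    (hR : IsRMatrix Δ R)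
    (hRl : ∀ x, sliceLeft ε ((R : Multiplier K (Two K A)).left x) = sliceLeft ε x)
    (hRr : ∀ x, sliceRight ε ((R : Multiplier K (Two K A)).left x) = sliceRight ε x) :
    IsQuasitriangular (twistedComul Δ J) (twistedRMatrix R J) where
  regular := d.isRegular_twistedComul hJ
  rMatrix :=
    { comul_left := d.comulLeftExt_twistedRMatrix hJ hR.intertwine hR.comul_left
      comul_right := d.comulRightExt_twistedRMatrix hJ hR.intertwine hR.comul_right
      intertwine := twistedRMatrix_mul_twistedComul hR.intertwine
      counit_right := by
        rw [counitRightExt, (d.isCounit_twistedComul hJ.toIsNormalizedCocycle).counit_eq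
          (d.isMultiplierHopfAlgebra_twistedComul hJ)]
        refine d.extend_eq_one (sliceRight_surjective d.exists_one) (sliceRight_mul ε) fun x => ?_
        rw [coe_twistedRMatrix, Multiplier.mul_left, Multiplier.mul_left, flip_left,
          sliceRight_comm, sliceLeft_inv hJ.slice_left, sliceLeft_comm, hRr, hJ.slice_right]
      counit_left := by
        rw [counitLeftExt, (d.isCounit_twistedComul hJ.toIsNormalizedCocycle).counit_eq
          (d.isMultiplierHopfAlgebra_twistedComul hJ)]
        refine d.extend_eq_one (sliceLeft_surjective d.exists_one) (sliceLeft_mul ε) fun x => ?_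
        rw [coe_twistedRMatrix, Multiplier.mul_left, Multiplier.mul_left, flip_left,
          sliceLeft_comm, sliceRight_inv hJ.slice_right, sliceRight_comm, hRl, hJ.slice_left] }

end HopfData

theorem extend_zero {B : Type*} [NonUnitalRing B] [Module K B] [SMulCommClass K B B]
    [IsScalarTower K B B] [Nontrivial (Multiplier K B)] (m : Multiplier K A) :
    extend (0 : A →ₗ[K] Multiplier K B) m = 0 := by
  unfold extend
  refine dif_neg fun ⟨n, _, hn⟩ => zero_ne_one (α := Multiplier K B) ?_
  have h : ∀ n, IsExtendedValue (0 : A →ₗ[K] Multiplier K B) m n := fun n =>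
    ⟨fun _ => by simp, fun _ => by simp⟩
  rw [hn 0 (h 0), hn 1 (h 1)]

theorem nontrivial_multiplier [Nontrivial A] : Nontrivial (Multiplier K A) := by
  obtain ⟨a, ha⟩ := exists_ne (0 : A)
  refine ⟨1, 0, fun h => ha ?_⟩
  have : (1 : Multiplier K A).left a = (0 : Multiplier K A).left a := by rw [h]
  exact this

theorem exists_counit_of_counitLeftExt [Nontrivial A] {X : Multiplier K (Two K A)}
    (hX : counitLeftExt Δ X = 1) : IsCounit Δ (counit Δ) ∧ ∃ e, counit Δ e = 1 := by
  have := nontrivial_multiplier (K := K) (A := A)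
  have h0 : counit Δ ≠ 0 := by
    intro h
    refine zero_ne_one (α := Multiplier K A) ?_
    rw [← hX, counitLeftExt, ← extend_zero (A := Two K A) X]
    congr 1
    refine TensorProduct.ext' fun a b => ?_
    simp [h]
  refine ⟨?_, ?_⟩
  · by_cases h : ∃ ε, IsCounit Δ ε
    · rw [counit, dif_pos h]
      exact h.choose_spec
    · exact absurd (by rw [counit, dif_neg h]) h0
  · obtain ⟨e, he⟩ : ∃ e, counit Δ e ≠ 0 := by
      by_contra! h
      exact h0 (NonUnitalAlgHom.ext h)
    exact ⟨(counit Δ e)⁻¹ • e, by rw [map_smul, smul_eq_mul, inv_mul_cancel₀ he]⟩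

theorem apply_left_of_extend_eq_one [Nontrivial A] (hA : NondegenerateMul A) {f : Two K A →ₗ[K] A}
    {X : Multiplier K (Two K A)} (h : extend ((incl K A : A →ₗ[K] Multiplier K A) ∘ₗ f) X = 1)
    (x : Two K A) : f (X.left x) = f x := by
  have := nontrivial_multiplier (K := K) (A := A)
  refine incl_injective (K := K) hA ?_
  have h1 := (isExtendedValue_of_extend_eq h one_ne_zero).1 x
  rw [one_mul] at h1
  exact h1.symm

end RMatrix

end MultiplierHopf

end

theorem theorem2p6 {K : Type*} [Field K] {A : Type*} [NonUnitalRing A] [Module K A]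
    [SMulCommClass K A A] [IsScalarTower K A A]
    (Δ : A →ₙₐ[K] MultiplierHopf.Multiplier K (A ⊗[K] A))
    (R J : (MultiplierHopf.Multiplier K (A ⊗[K] A))ˣ)
    (hR : MultiplierHopf.IsQuasitriangular Δ R)
    (hJ : MultiplierHopf.IsGeneralTwisting Δ J) :
    MultiplierHopf.IsQuasitriangular (MultiplierHopf.twistedComul Δ J)
      (MultiplierHopf.twistedRMatrix R J) := by
  open MultiplierHopf in
  rcases subsingleton_or_nontrivial A with hA | hA
  · have hAA : Subsingleton (A ⊗[K] A) := subsingleton_of_forall_eq 0 fun x => by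
      induction x using TensorProduct.induction_on with
      | zero => rfl
      | add x y hx hy => rw [hx, hy, add_zero]
      | tmul a b => rw [Subsingleton.elim a 0, TensorProduct.zero_tmul]
    have hM : Subsingleton (Multiplier K (A ⊗[K] A)) :=
      ⟨fun m n => Multiplier.ext' (fun _ => Subsingleton.elim _ _) (fun _ => Subsingleton.elim _ _)⟩
    have h1 : twistedComul Δ J = Δ := NonUnitalAlgHom.ext fun a => Subsingleton.elim _ _
    have h2 : twistedRMatrix R J = R := Units.ext (Subsingleton.elim _ _)
    rw [h1, h2]
    exact hR
  · obtain ⟨hε, he⟩ := exists_counit_of_counitLeftExt hR.rMatrix.counit_left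
    obtain ⟨d⟩ := hR.regular.exists_hopfData hε he
    exact d.isQuasitriangular_twistedComul
      { cocycle := hJ.twist.cocycle
        slice_left := apply_left_of_extend_eq_one d.nd hJ.twist.counit_left
        slice_right := apply_left_of_extend_eq_one d.nd hJ.twist.counit_right
        mul_inr_mem := hJ.mul_inr_mem
        mul_inl_mem := hJ.mul_inl_mem } hR.rMatrix
      (apply_left_of_extend_eq_one d.nd hR.rMatrix.counit_left)
      (apply_left_of_extend_eq_one d.nd hR.rMatrix.counit_right)
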